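/- For a complex manifold $M$ and $k\ge 0$ let $J^k(M)$ be the complex manifold of $k$-jets of holomorphic map germs $(\mathbf C,0)\to M$, so that $J^0(M)\simeq M$. For $k\ge l$ let $\tau_M^{k,l}:J^k(M)\to J^l(M)$ be the natural projection, and for $Z\subset J^l(M)$ put $J^k_Z(M)=\{j\in J^k(M)\mid \tau_M^{k,l}(j)\in Z\}$. A holomorphic map $\varphi:M\to N$ induces holomorphic maps $\varphi^{(k)}:J^k(M)\to J^k(N)$. It is called non-degenerate if every connected component of $M$ contains a point at which the differential of $\varphi$ is surjective. An algebraic subvariety of $J^l(M)$ is a finite union of irreducible closed analytic subsets each of which is given, locally over $M$, by finitely many equations that are polynomial in the fibre coordinates (the Taylor coefficients of order $1,\dots,l$ of a jet in a chart of $M$) with coefficients holomorphic on the base; irreducible means that the set of regular points is connected and non-empty. The dimension $\dim S$ of a subset $S$ of a complex manifold is the largest $d$ such that $S$ contains the image of a non-empty open subset of $\mathbf C^d$ under a holomorphic immersion ($\dim\emptyset=-\infty$). **Proposition 3.2.** Let $\varphi:M\to N$ be a non-degenerate holomorphic map of (finite-dimensional, pure-dimensional) complex manifolds, let $l\ge 0$,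 and let $Z_0$ be an algebraic subvariety of $J^l(M)$. Then there exists $r\ge l$ such that for every $k\ge r$, with $$Z=J^r_{Z_0}(M),\qquad Z^k=J^k_Z(M),\qquad W=\varphi^{(r)}(Z),\qquad W^k=\varphi^{(k)}(Z^k),$$ we have $$\dim W^k=\dim W+(k-r)\dim N,$$ and $W^k$ is a dense subset of $J^k_W(N)$. -/

import Mathlib

open scoped Manifold ContDiff Topology
open Filter Asymptotics

noncomputable section

set_option linter.unusedSectionVars false

/-! ## Jets of holomorphic curves -/

section Jets

variable (E : Type*) [NormedAddCommGroup E] [NormedSpace ℂ E]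
  (M : Type*) [TopologicalSpace M] [ChartedSpace E M]

/-- A representative of a holomorphic germ from `(ℂ, 0)` to the complex manifold `M`: a map which is
holomorphic in a neighbourhood of the origin. -/
structure HolCurve where
  /-- the underlying map; only its germ at the origin matters -/
  toFun : ℂ → M
  holo : ContMDiffAt 𝓘(ℂ, ℂ) 𝓘(ℂ, E) ω toFun 0

variable {E M}

/-- Two holomorphic germs have the same `k`-jet: they take the same value at `0`, and in the chart
around this value they agree up to an error `O(t ^ (k + 1))`. -/
def HolCurve.SameJet (k : ℕ) (γ δ : HolCurve E M) : Prop :=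
  γ.toFun 0 = δ.toFun 0 ∧
    (fun t : ℂ => chartAt E (γ.toFun 0) (γ.toFun t) - chartAt E (γ.toFun 0) (δ.toFun t))
      =O[𝓝 0] fun t : ℂ => t ^ (k + 1)

variable (E M) in
/-- Equality of `k`-jets, as an equivalence relation. -/
def jetSetoid (k : ℕ) : Setoid (HolCurve E M) where
  r := HolCurve.SameJet k
  iseqv :=
    { refl := fun γ => ⟨rfl, by simpa using isBigO_zero _ _⟩
      symm := by
        rintro γ δ ⟨h0, h⟩
        refine ⟨h0.symm, ?_⟩
        rw [← h0]
        simpa using h.neg_left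
      trans := by
        rintro γ δ ε ⟨h0, h⟩ ⟨h0', h'⟩
        refine ⟨h0.trans h0', ?_⟩
        rw [← h0] at h'
        simpa using h.add h' }

variable (E M) in
/-- The space `J^k(M)` of `k`-jets of holomorphic germs from `(ℂ, 0)` to `M`. -/
def Jet (k : ℕ) : Type _ := Quotient (jetSetoid E M k)

/-- The `k`-jet of a holomorphic germ. -/
def Jet.mk (k : ℕ) (γ : HolCurve E M) : Jet E M k := Quotient.mk (jetSetoid E M k) γ

/-- The base point of a jet, that is, the projection `J^k(M) → J^0(M) ≃ M`. -/
def Jet.base {k : ℕ} : Jet E M k → M :=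
  Quotient.lift (fun γ => γ.toFun 0) fun _ _ h => h.1

/-- The natural projection `τ^{k,l} : J^k(M) → J^l(M)` for `l ≤ k`. -/
def Jet.truncate {l k : ℕ} (h : l ≤ k) : Jet E M k → Jet E M l :=
  Quotient.lift (fun γ => Jet.mk l γ) fun γ δ hγδ => by
    refine Quotient.sound (s := jetSetoid E M l) ⟨hγδ.1, hγδ.2.trans ?_⟩
    refine IsBigO.of_bound 1 ?_
    filter_upwards [Metric.closedBall_mem_nhds (0 : ℂ) one_pos] with t ht
    rw [one_mul, norm_pow, norm_pow]
    exact pow_le_pow_of_le_one (norm_nonneg t) (by simpa using ht) (by omega)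

/-- For `Z ⊆ J^l(M)` and `l ≤ k`, the set `J^k_Z(M)` of all `k`-jets whose `l`-jet lies in `Z`. -/
def jetsOver {l k : ℕ} (h : l ≤ k) (Z : Set (Jet E M l)) : Set (Jet E M k) :=
  Jet.truncate h ⁻¹' Z

end Jets

/-! ## Jet coordinates and the complex manifold `J^k(M)` -/

section Coordinates

variable {E : Type*} [NormedAddCommGroup E] [NormedSpace ℂ E]
  {F : Type*} [NormedAddCommGroup F] [NormedSpace ℂ F]

theorem isBigO_comp_sub_comp {h : E → F} {f g : ℂ → E} {k : ℕ} (hh : ContDiffAt ℂ ω h (f 0))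
    (hf : ContinuousAt f 0) (hg : ContinuousAt g 0) (h0 : f 0 = g 0)
    (hfg : (fun t => f t - g t) =O[𝓝 0] fun t : ℂ => t ^ (k + 1)) :
    (fun t => h (f t) - h (g t)) =O[𝓝 0] fun t : ℂ => t ^ (k + 1) := by
  have h1 := (hh.hasStrictFDerivAt (by simp)).isBigO_sub
  have h2 : Tendsto (fun t => (f t, g t)) (𝓝 0) (𝓝 (f 0, f 0)) := by
    have := hf.tendsto.prodMk_nhds hg.tendsto
    rwa [← h0] at this
  exact (h1.comp_tendsto h2).trans hfg

theorem isBigO_pow_succ_iff [CompleteSpace E] {f : ℂ → E} (hf : AnalyticAt ℂ f 0) (k : ℕ) :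
    f =O[𝓝 0] (fun t : ℂ => t ^ (k + 1)) ↔ ∀ i < k + 1, iteratedDeriv i f 0 = 0 := by
  rw [← natCast_le_analyticOrderAt_iff_iteratedDeriv_eq_zero hf]
  constructor
  · intro h
    by_contra hlt
    rw [not_le] at hlt
    obtain ⟨d, hd⟩ := ENat.ne_top_iff_exists.1 (ne_top_of_lt hlt)
    rw [← hd] at hlt
    have hdk : d < k + 1 := by exact_mod_cast hlt
    obtain ⟨g, hg, hg0, hfg⟩ := (hf.analyticOrderAt_eq_natCast).1 hd.symm
    simp only [sub_zero] at hfg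
    have h1 : (fun t : ℂ => t ^ d • g t) =O[𝓝[≠] 0] fun t : ℂ => t ^ (k + 1) :=
      (h.congr' hfg EventuallyEq.rfl).mono nhdsWithin_le_nhds
    have h2 := (isBigO_refl (fun t : ℂ => (t ^ d)⁻¹) (𝓝[≠] 0)).smul h1
    have h3 : g =O[𝓝[≠] 0] fun t : ℂ => t ^ (k + 1 - d) := by
      refine h2.congr' ?_ ?_
      · filter_upwards [self_mem_nhdsWithin] with t ht
        rw [smul_smul, inv_mul_cancel₀ (pow_ne_zero _ ht), one_smul]
      · filter_upwards [self_mem_nhdsWithin] with t ht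
        have ht0 : t ≠ 0 := ht
        rw [smul_eq_mul, inv_mul_eq_iff_eq_mul₀ (pow_ne_zero _ ht0), ← pow_add]
        congr 1
        omega
    have h4 : Tendsto (fun t : ℂ => t ^ (k + 1 - d)) (𝓝[≠] 0) (𝓝 0) := by
      have : ContinuousAt (fun t : ℂ => t ^ (k + 1 - d)) 0 := by fun_prop
      have h5 := this.tendsto.mono_left (nhdsWithin_le_nhds (s := {0}ᶜ))
      have h6 : k + 1 - d ≠ 0 := by omega
      simpa [h6] using h5
    exact hg0 (tendsto_nhds_unique (hg.continuousAt.tendsto.mono_left nhdsWithin_le_nhds)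
      (h3.trans_tendsto h4))
  · intro h
    obtain ⟨g, hg, hfg⟩ := (natCast_le_analyticOrderAt hf).1 h
    refine IsBigO.congr' ?_ (EventuallyEq.symm hfg) EventuallyEq.rfl
    simp only [sub_zero]
    simpa using (isBigO_refl (fun t : ℂ => t ^ (k + 1)) (𝓝 0)).smul
      (hg.continuousAt.norm.isBoundedUnder_le.isBigO_one ℂ)

/-- The `i`-th Taylor coefficient at the origin. -/
def taylorCoeff (f : ℂ → E) (i : ℕ) : E := ((i.factorial : ℂ)⁻¹) • iteratedDeriv i f 0

theorem taylorCoeff_eq_iff [CompleteSpace E] {f g : ℂ → E} (hf : AnalyticAt ℂ f 0)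
    (hg : AnalyticAt ℂ g 0) (k : ℕ) :
    (∀ i < k + 1, taylorCoeff f i = taylorCoeff g i) ↔
      (fun t => f t - g t) =O[𝓝 0] fun t : ℂ => t ^ (k + 1) := by
  rw [isBigO_pow_succ_iff (hf.fun_sub hg)]
  refine forall₂_congr fun i _ => ?_
  have hi : ((i.factorial : ℂ)⁻¹) ≠ 0 := inv_ne_zero (by exact_mod_cast i.factorial_ne_zero)
  have := iteratedDeriv_fun_sub (n := i) (x := (0 : ℂ)) hf.contDiffAt hg.contDiffAt
  rw [this, sub_eq_zero, taylorCoeff, taylorCoeff, smul_right_inj hi]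

/-- The polynomial curve `t ↦ ∑ tⁱ aᵢ`. -/
def polyCurve {k : ℕ} (a : Fin (k + 1) → E) (t : ℂ) : E := ∑ i : Fin (k + 1), t ^ (i : ℕ) • a i

theorem polyCurve_zero {k : ℕ} (a : Fin (k + 1) → E) : polyCurve a 0 = a 0 := by
  simp [polyCurve, Fin.sum_univ_succ]

theorem contDiff_polyCurve (k : ℕ) :
    ContDiff ℂ ω fun p : (Fin (k + 1) → E) × ℂ => polyCurve p.1 p.2 := by
  unfold polyCurve
  fun_prop

theorem taylorCoeff_polyCurve {k : ℕ} (a : Fin (k + 1) → E) (i : Fin (k + 1)) :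
    taylorCoeff (polyCurve a) i = a i := by
  unfold taylorCoeff polyCurve
  have h : ∀ j ∈ Finset.univ, ContDiffAt ℂ ((i : ℕ) : WithTop ℕ∞)
      (fun t : ℂ => t ^ ((j : Fin (k + 1)) : ℕ) • a j) 0 := fun j _ => by fun_prop
  rw [iteratedDeriv_fun_sum h, Finset.sum_eq_single i]
  · rw [iteratedDeriv_smul_const (by fun_prop), iteratedDeriv_fun_pow_zero, if_pos rfl, smul_smul,
      inv_mul_cancel₀ (by exact_mod_cast (i : ℕ).factorial_ne_zero), one_smul]
  · intro j _ hj
    rw [iteratedDeriv_smul_const (by fun_prop), iteratedDeriv_fun_pow_zero,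
      if_neg (fun hij => hj (Fin.ext hij.symm)), Nat.cast_zero, zero_smul]
  · simp

/-- Taylor coefficients of an analytic family of curves are analytic in the parameters. -/
theorem analyticOnNhd_taylorCoeff {H : Type*} [NormedAddCommGroup H] [NormedSpace ℂ H]
    [CompleteSpace F] {G : H × ℂ → F} {U : Set (H × ℂ)} (hU : IsOpen U)
    (hG : AnalyticOnNhd ℂ G U) (i : ℕ) :
    AnalyticOnNhd ℂ (fun a => taylorCoeff (fun t => G (a, t)) i) {a | (a, (0 : ℂ)) ∈ U} := by
  have key : ∀ i : ℕ, ∃ Gi : H × ℂ → F, AnalyticOnNhd ℂ Gi U ∧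
      ∀ p ∈ U, iteratedDeriv i (fun t => G (p.1, t)) p.2 = Gi p := by
    intro i
    induction i with
    | zero => exact ⟨G, hG, fun p _ => by simp⟩
    | succ i ih =>
      obtain ⟨Gi, hGi, hi⟩ := ih
      refine ⟨fun p => fderiv ℂ Gi p (0, 1), fun p hp => ?_, fun p hp => ?_⟩
      · exact ((ContinuousLinearMap.apply ℂ F ((0, 1) : H × ℂ)).analyticAt _).comp
          (hGi.fderiv p hp)
      · rw [iteratedDeriv_succ]
        have hline : HasDerivAt (fun t : ℂ => (p.1, t)) ((0, 1) : H × ℂ) p.2 :=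
          (hasDerivAt_const p.2 p.1).prodMk (hasDerivAt_id p.2)
        have hev : iteratedDeriv i (fun t => G (p.1, t)) =ᶠ[𝓝 p.2] fun t => Gi (p.1, t) := by
          have : ∀ᶠ t in 𝓝 p.2, (p.1, t) ∈ U :=
            hline.continuousAt.preimage_mem_nhds (hU.mem_nhds hp)
          filter_upwards [this] with t ht using hi _ ht
        rw [hev.deriv_eq]
        exact ((hGi p hp).differentiableAt.hasFDerivAt.comp_hasDerivAt p.2 hline).deriv
  obtain ⟨Gi, hGi, hi⟩ := key i
  intro a ha
  have h1 : AnalyticAt ℂ (fun b => ((i.factorial : ℂ)⁻¹) • Gi (b, 0)) a := by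
    have h2 : AnalyticAt ℂ (fun b : H => (b, (0 : ℂ))) a := by fun_prop
    exact (AnalyticAt.comp (f := fun b : H => (b, (0 : ℂ))) (x := a) (hGi (a, 0) ha) h2).const_smul
  refine h1.congr ?_
  have : ∀ᶠ b in 𝓝 a, (b, (0 : ℂ)) ∈ U := by
    have h2 : ContinuousAt (fun b : H => (b, (0 : ℂ))) a := by fun_prop
    exact h2.preimage_mem_nhds (hU.mem_nhds ha)
  filter_upwards [this] with b hb
  rw [taylorCoeff, hi (b, 0) hb]

end Coordinates

section JetCharts

variable {E : Type*} [NormedAddCommGroup E] [NormedSpace ℂ E] [CompleteSpace E]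
  {M : Type*} [TopologicalSpace M] [ChartedSpace E M] [IsManifold 𝓘(ℂ, E) ω M]

theorem analyticAt_transition (x y : M) {e : E}
    (he : e ∈ (chartAt E x).target) (he' : (chartAt E x).symm e ∈ (chartAt E y).source) :
    AnalyticAt ℂ (fun v => chartAt E y ((chartAt E x).symm v)) e := by
  have h1 : ContMDiffAt 𝓘(ℂ, E) 𝓘(ℂ, E) ω (chartAt E y) ((chartAt E x).symm e) :=
    contMDiffAt_of_mem_maximalAtlas (IsManifold.chart_mem_maximalAtlas y) he'
  have h2 : ContMDiffAt 𝓘(ℂ, E) 𝓘(ℂ, E) ω (chartAt E x).symm e :=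
    contMDiffAt_symm_of_mem_maximalAtlas (IsManifold.chart_mem_maximalAtlas x) he
  exact (contMDiffAt_iff_contDiffAt.1 (h1.comp e h2)).analyticAt

theorem HolCurve.analyticAt_chart (γ : HolCurve E M) {x : M}
    (hx : γ.toFun 0 ∈ (chartAt E x).source) :
    AnalyticAt ℂ (fun t => chartAt E x (γ.toFun t)) 0 := by
  have h1 : ContMDiffAt 𝓘(ℂ, E) 𝓘(ℂ, E) ω (chartAt E x) (γ.toFun 0) :=
    contMDiffAt_of_mem_maximalAtlas (IsManifold.chart_mem_maximalAtlas x) hx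
  exact (contMDiffAt_iff_contDiffAt.1 (h1.comp 0 γ.holo)).analyticAt

/-- Agreement of jets may be tested in any chart. -/
theorem HolCurve.sameJet_iff {k : ℕ} {γ δ : HolCurve E M} (x : M)
    (hx : γ.toFun 0 ∈ (chartAt E x).source) :
    γ.SameJet k δ ↔ γ.toFun 0 = δ.toFun 0 ∧
      (fun t : ℂ => chartAt E x (γ.toFun t) - chartAt E x (δ.toFun t))
        =O[𝓝 0] fun t : ℂ => t ^ (k + 1) := by
  have aux : ∀ y z : M, γ.toFun 0 ∈ (chartAt E y).source → γ.toFun 0 ∈ (chartAt E z).source →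
      γ.toFun 0 = δ.toFun 0 →
      (fun t : ℂ => chartAt E y (γ.toFun t) - chartAt E y (δ.toFun t))
        =O[𝓝 0] (fun t : ℂ => t ^ (k + 1)) →
      (fun t : ℂ => chartAt E z (γ.toFun t) - chartAt E z (δ.toFun t))
        =O[𝓝 0] fun t : ℂ => t ^ (k + 1) := by
    intro y z hy hz h0 h
    have hy' : δ.toFun 0 ∈ (chartAt E y).source := h0 ▸ hy
    have htr : AnalyticAt ℂ (fun v => chartAt E z ((chartAt E y).symm v))
        (chartAt E y (γ.toFun 0)) :=
      analyticAt_transition y z ((chartAt E y).map_source hy)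
        (by rwa [(chartAt E y).left_inv hy])
    have h1 := isBigO_comp_sub_comp (h := fun v => chartAt E z ((chartAt E y).symm v))
      (f := fun t => chartAt E y (γ.toFun t)) (g := fun t => chartAt E y (δ.toFun t))
      htr.contDiffAt (γ.analyticAt_chart hy).continuousAt (δ.analyticAt_chart hy').continuousAt
      (by simp only [h0]) h
    refine h1.congr' ?_ EventuallyEq.rfl
    have e1 : ∀ᶠ t in 𝓝 (0 : ℂ), γ.toFun t ∈ (chartAt E y).source :=
      γ.holo.continuousAt.preimage_mem_nhds ((chartAt E y).open_source.mem_nhds hy)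
    have e2 : ∀ᶠ t in 𝓝 (0 : ℂ), δ.toFun t ∈ (chartAt E y).source :=
      δ.holo.continuousAt.preimage_mem_nhds ((chartAt E y).open_source.mem_nhds hy')
    filter_upwards [e1, e2] with t h1 h2
    rw [(chartAt E y).left_inv h1, (chartAt E y).left_inv h2]
  exact ⟨fun h => ⟨h.1, aux _ _ (mem_chart_source E _) hx h.1 h.2⟩,
    fun h => ⟨h.1, aux _ _ hx (mem_chart_source E _) h.1 h.2⟩⟩

/-- The coordinates of a jet based in the domain of the chart around `x`: the Taylor coefficients
`a₀, …, a_k` of the jet read in this chart. -/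
def Jet.coord {k : ℕ} (x : M) (j : Jet E M k) (i : Fin (k + 1)) : E :=
  taylorCoeff (fun t => chartAt E x ((Quotient.out j).toFun t)) i

theorem Jet.exists_mk {k : ℕ} (j : Jet E M k) : ∃ γ, Jet.mk k γ = j := Quotient.exists_rep j

theorem Jet.mk_eq_iff {k : ℕ} {γ δ : HolCurve E M} (x : M)
    (hx : γ.toFun 0 ∈ (chartAt E x).source) (hx' : δ.toFun 0 ∈ (chartAt E x).source) :
    Jet.mk k γ = Jet.mk k δ ↔ ∀ i : Fin (k + 1),
      taylorCoeff (fun t => chartAt E x (γ.toFun t)) i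
        = taylorCoeff (fun t => chartAt E x (δ.toFun t)) i := by
  have h1 : Jet.mk k γ = Jet.mk k δ ↔ γ.SameJet k δ :=
    Quotient.eq (r := jetSetoid E M k)
  rw [h1, HolCurve.sameJet_iff x hx,
    ← taylorCoeff_eq_iff (γ.analyticAt_chart hx) (δ.analyticAt_chart hx')]
  constructor
  · rintro ⟨-, h⟩ i
    exact h i i.2
  · intro h
    refine ⟨?_, fun i hi => h ⟨i, hi⟩⟩
    have h0 := h 0
    simp only [taylorCoeff, Fin.val_zero, Nat.factorial_zero, Nat.cast_one, inv_one, one_smul,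
      iteratedDeriv_zero] at h0
    exact (chartAt E x).injOn hx hx' h0

theorem Jet.coord_mk {k : ℕ} (x : M) (γ : HolCurve E M) (hx : γ.toFun 0 ∈ (chartAt E x).source)
    (i : Fin (k + 1)) :
    Jet.coord x (Jet.mk k γ) i = taylorCoeff (fun t => chartAt E x (γ.toFun t)) i := by
  have h1 : Jet.mk k (Quotient.out (Jet.mk k γ)) = Jet.mk k γ := Quotient.out_eq _
  have h2 : (Quotient.out (Jet.mk k γ)).toFun 0 = γ.toFun 0 := congrArg Jet.base h1
  exact (Jet.mk_eq_iff x (h2 ▸ hx) hx).1 h1 i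

open Classical in
/-- The holomorphic curve which is the polynomial `∑ tⁱ aᵢ` in the chart around `x` (and a constant
curve if `a₀` is not in the image of this chart). -/
def chartCurve {k : ℕ} (x : M) (a : Fin (k + 1) → E) : HolCurve E M :=
  if h : a 0 ∈ (chartAt E x).target then
    { toFun := fun t => (chartAt E x).symm (polyCurve a t)
      holo := by
        have h2 : ContMDiffAt 𝓘(ℂ, E) 𝓘(ℂ, E) ω (chartAt E x).symm (polyCurve a 0) :=
          contMDiffAt_symm_of_mem_maximalAtlas (IsManifold.chart_mem_maximalAtlas x)
            (by rwa [polyCurve_zero])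
        have h3 : ContDiff ℂ ω (polyCurve a) :=
          (contDiff_polyCurve k).comp (contDiff_prodMk_right a)
        exact h2.comp 0 h3.contMDiff.contMDiffAt }
  else
    { toFun := fun _ => x
      holo := contMDiffAt_const }

theorem chartCurve_apply {k : ℕ} (x : M) {a : Fin (k + 1) → E} (h : a 0 ∈ (chartAt E x).target)
    (t : ℂ) : (chartCurve x a).toFun t = (chartAt E x).symm (polyCurve a t) := by
  rw [chartCurve, dif_pos h]

theorem chartCurve_mem_source {k : ℕ} (x : M) {a : Fin (k + 1) → E}
    (h : a 0 ∈ (chartAt E x).target) : (chartCurve x a).toFun 0 ∈ (chartAt E x).source := by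
  rw [chartCurve_apply x h, polyCurve_zero]
  exact (chartAt E x).map_target h

theorem Jet.coord_chartCurve {k : ℕ} (x y : M) {a : Fin (k + 1) → E}
    (h : a 0 ∈ (chartAt E x).target) (h' : (chartAt E x).symm (a 0) ∈ (chartAt E y).source)
    (i : Fin (k + 1)) :
    Jet.coord y (Jet.mk k (chartCurve x a)) i
      = taylorCoeff (fun t => chartAt E y ((chartAt E x).symm (polyCurve a t))) i := by
  rw [Jet.coord_mk]
  · simp only [chartCurve_apply x h]
  · rwa [chartCurve_apply x h, polyCurve_zero]

theorem taylorCoeff_congr {f g : ℂ → E} (h : f =ᶠ[𝓝 0] g) (i : ℕ) :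
    taylorCoeff f i = taylorCoeff g i := by
  rw [taylorCoeff, taylorCoeff, h.iteratedDeriv_eq]

theorem Jet.coord_chartCurve_self {k : ℕ} (x : M) {a : Fin (k + 1) → E}
    (h : a 0 ∈ (chartAt E x).target) : Jet.coord x (Jet.mk k (chartCurve x a)) = a := by
  funext i
  rw [Jet.coord_chartCurve x x h ((chartAt E x).map_target h)]
  refine Eq.trans (taylorCoeff_congr ?_ i) (taylorCoeff_polyCurve a i)
  have h3 : ContDiff ℂ ω (polyCurve a) := (contDiff_polyCurve k).comp (contDiff_prodMk_right a)
  have h4 : ∀ᶠ t in 𝓝 (0 : ℂ), polyCurve a t ∈ (chartAt E x).target :=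
    h3.continuous.continuousAt.preimage_mem_nhds
      ((chartAt E x).open_target.mem_nhds (by rwa [polyCurve_zero]))
  filter_upwards [h4] with t ht using (chartAt E x).right_inv ht

/-- The chart of `J^k(M)` induced by the chart of `M` around `x`. -/
def jetChart (k : ℕ) (x : M) : PartialEquiv (Jet E M k) (Fin (k + 1) → E) where
  toFun := Jet.coord x
  invFun a := Jet.mk k (chartCurve x a)
  source := {j | j.base ∈ (chartAt E x).source}
  target := {a | a 0 ∈ (chartAt E x).target}
  map_source' := by
    intro j hj
    obtain ⟨γ, rfl⟩ := j.exists_mk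
    have hx : γ.toFun 0 ∈ (chartAt E x).source := hj
    change Jet.coord x (Jet.mk k γ) 0 ∈ (chartAt E x).target
    rw [Jet.coord_mk x γ hx]
    simpa [taylorCoeff] using (chartAt E x).map_source hx
  map_target' := fun a ha => chartCurve_mem_source x ha
  left_inv' := by
    intro j hj
    obtain ⟨γ, rfl⟩ := j.exists_mk
    have hx : γ.toFun 0 ∈ (chartAt E x).source := hj
    have h0 : Jet.coord x (Jet.mk k γ) 0 ∈ (chartAt E x).target := by
      rw [Jet.coord_mk x γ hx]
      simpa [taylorCoeff] using (chartAt E x).map_source hx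
    rw [Jet.mk_eq_iff x (chartCurve_mem_source x h0) hx]
    intro i
    rw [← Jet.coord_mk x γ hx, ← Jet.coord_mk x _ (chartCurve_mem_source x h0),
      Jet.coord_chartCurve_self x h0]
  right_inv' := fun a ha => Jet.coord_chartCurve_self x ha

theorem jetChart_trans_source (k : ℕ) (x y : M) :
    ((jetChart k x).symm.trans (jetChart k y)).source =
      (fun a : Fin (k + 1) → E => a 0) ⁻¹'
        ((chartAt E x).symm.trans (chartAt E y)).source := by
  ext a
  constructor
  · rintro ⟨h1, h2⟩
    have h1 : a 0 ∈ (chartAt E x).target := h1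
    have h2 : (chartCurve x a).toFun 0 ∈ (chartAt E y).source := h2
    rw [chartCurve_apply x h1, polyCurve_zero] at h2
    simpa using ⟨h1, h2⟩
  · intro h
    have h : a 0 ∈ (chartAt E x).target ∧ (chartAt E x).symm (a 0) ∈ (chartAt E y).source := by
      simpa using h
    refine ⟨h.1, ?_⟩
    change (chartCurve x a).toFun 0 ∈ (chartAt E y).source
    rw [chartCurve_apply x h.1, polyCurve_zero]
    exact h.2

theorem isOpen_jetChart_trans_source (k : ℕ) (x y : M) :
    IsOpen ((jetChart (E := E) k x).symm.trans (jetChart k y)).source := by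
  rw [jetChart_trans_source]
  exact ((chartAt E x).symm.trans (chartAt E y)).open_source.preimage (continuous_apply 0)

/-- The changes of jet coordinates are holomorphic. -/
theorem analyticOnNhd_jetChart_trans (k : ℕ) (x y : M) :
    AnalyticOnNhd ℂ ((jetChart (E := E) k x).symm.trans (jetChart k y))
      ((jetChart (E := E) k x).symm.trans (jetChart k y)).source := by
  have hopen := isOpen_jetChart_trans_source (E := E) k x y
  set S := ((chartAt E x).symm.trans (chartAt E y)).source with hS
  have hSopen : IsOpen S := ((chartAt E x).symm.trans (chartAt E y)).open_source
  have hmem : ∀ v ∈ S, v ∈ (chartAt E x).target ∧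
      (chartAt E x).symm v ∈ (chartAt E y).source := fun v hv => by simpa [hS] using hv
  set U : Set ((Fin (k + 1) → E) × ℂ) := (fun p => polyCurve p.1 p.2) ⁻¹' S with hUdef
  have hU : IsOpen U := hSopen.preimage (contDiff_polyCurve k).continuous
  have hG : AnalyticOnNhd ℂ (fun p : (Fin (k + 1) → E) × ℂ =>
      chartAt E y ((chartAt E x).symm (polyCurve p.1 p.2))) U := by
    intro p hp
    have h1 := analyticAt_transition x y (hmem _ hp).1 (hmem _ hp).2
    exact AnalyticAt.comp (f := fun p : (Fin (k + 1) → E) × ℂ => polyCurve p.1 p.2) h1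
      (contDiff_polyCurve k).contDiffAt.analyticAt
  intro a ha
  have h2 : AnalyticAt ℂ (fun b : Fin (k + 1) → E => fun i : Fin (k + 1) =>
      taylorCoeff (fun t => chartAt E y ((chartAt E x).symm (polyCurve b t))) i) a := by
    rw [analyticAt_pi_iff]
    intro i
    refine analyticOnNhd_taylorCoeff hU hG i a ?_
    rw [jetChart_trans_source] at ha
    change polyCurve a 0 ∈ S
    rw [polyCurve_zero]
    exact ha
  refine h2.congr ?_
  filter_upwards [hopen.mem_nhds ha] with b hb
  rw [jetChart_trans_source] at hb
  funext i
  exact (Jet.coord_chartCurve x y (hmem _ hb).1 (hmem _ hb).2 i).symm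

variable (E M) in
/-- The charts of `J^k(M)`. -/
def jetCore (k : ℕ) : ChartedSpaceCore (Fin (k + 1) → E) (Jet E M k) where
  atlas := Set.range (jetChart k)
  chartAt j := jetChart k j.base
  mem_chart_source j := mem_chart_source E j.base
  chart_mem_atlas j := ⟨_, rfl⟩
  open_source := by
    rintro _ _ ⟨x, rfl⟩ ⟨y, rfl⟩
    exact isOpen_jetChart_trans_source k x y
  continuousOn_toFun := by
    rintro _ _ ⟨x, rfl⟩ ⟨y, rfl⟩
    exact (analyticOnNhd_jetChart_trans k x y).continuousOn

/-- The topology of `J^k(M)`. -/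
instance instTopologicalSpaceJet (k : ℕ) : TopologicalSpace (Jet E M k) := (jetCore E M k).toTopologicalSpace

/-- The charts of the complex manifold `J^k(M)`. -/
instance instChartedSpaceJet (k : ℕ) : ChartedSpace (Fin (k + 1) → E) (Jet E M k) :=
  (jetCore E M k).toChartedSpace

/-- `J^k(M)` is a complex manifold. -/
instance instIsManifoldJet (k : ℕ) : IsManifold 𝓘(ℂ, Fin (k + 1) → E) ω (Jet E M k) := by
  refine isManifold_of_contDiffOn _ _ _ ?_
  rintro e e' he he'
  obtain ⟨_, ⟨x, rfl⟩, h⟩ := Set.mem_iUnion₂.1 he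
  obtain ⟨_, ⟨y, rfl⟩, h'⟩ := Set.mem_iUnion₂.1 he'
  obtain rfl := Set.mem_singleton_iff.1 h
  obtain rfl := Set.mem_singleton_iff.1 h'
  have := (analyticOnNhd_jetChart_trans (E := E) k x y).contDiffOn (n := ω)
    (isOpen_jetChart_trans_source k x y).uniqueDiffOn
  simp only [modelWithCornersSelf_coe, modelWithCornersSelf_coe_symm, Set.preimage_id,
    Set.range_id, Set.inter_univ, Function.comp_id, Function.id_comp]
  exact this

end JetCharts

/-! ## The map of jet spaces induced by a holomorphic map -/

section Functoriality

variable {E : Type*} [NormedAddCommGroup E] [NormedSpace ℂ E] [CompleteSpace E]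
  {M : Type*} [TopologicalSpace M] [ChartedSpace E M] [IsManifold 𝓘(ℂ, E) ω M]
  {F : Type*} [NormedAddCommGroup F] [NormedSpace ℂ F] [CompleteSpace F]
  {N : Type*} [TopologicalSpace N] [ChartedSpace F N] [IsManifold 𝓘(ℂ, F) ω N]

/-- Composition of a holomorphic germ with a holomorphic map. -/
def HolCurve.map (φ : M → N) (hφ : ContMDiff 𝓘(ℂ, E) 𝓘(ℂ, F) ω φ) (γ : HolCurve E M) :
    HolCurve F N where
  toFun := fun t => φ (γ.toFun t)
  holo := (hφ (γ.toFun 0)).comp 0 γ.holo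

theorem HolCurve.sameJet_map (φ : M → N) (hφ : ContMDiff 𝓘(ℂ, E) 𝓘(ℂ, F) ω φ) {k : ℕ}
    {γ δ : HolCurve E M} (h : γ.SameJet k δ) : (γ.map φ hφ).SameJet k (δ.map φ hφ) := by
  obtain ⟨h0, h⟩ := h
  refine ⟨congrArg φ h0, ?_⟩
  set p := γ.toFun 0 with hp
  have hpm : p ∈ (chartAt E p).source := mem_chart_source E p
  have hpm' : δ.toFun 0 ∈ (chartAt E p).source := h0 ▸ hpm
  have a1 : ContMDiffAt 𝓘(ℂ, E) 𝓘(ℂ, E) ω (chartAt E p).symm (chartAt E p p) :=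
    contMDiffAt_symm_of_mem_maximalAtlas (IsManifold.chart_mem_maximalAtlas p)
      ((chartAt E p).map_source hpm)
  have a2 : ContMDiffAt 𝓘(ℂ, F) 𝓘(ℂ, F) ω (chartAt F (φ p))
      (φ ((chartAt E p).symm (chartAt E p p))) := by
    rw [(chartAt E p).left_inv hpm]
    exact contMDiffAt_of_mem_maximalAtlas (IsManifold.chart_mem_maximalAtlas _)
      (mem_chart_source F _)
  have a3 : ContDiffAt ℂ ω (fun v => chartAt F (φ p) (φ ((chartAt E p).symm v)))
      (chartAt E p p) :=
    contMDiffAt_iff_contDiffAt.1 (a2.comp (chartAt E p p) ((hφ _).comp (chartAt E p p) a1))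
  have h1 := isBigO_comp_sub_comp (f := fun t => chartAt E p (γ.toFun t))
    (g := fun t => chartAt E p (δ.toFun t)) a3 (γ.analyticAt_chart hpm).continuousAt
    (δ.analyticAt_chart hpm').continuousAt (congrArg (chartAt E p) h0) h
  refine h1.congr' ?_ EventuallyEq.rfl
  have e1 : ∀ᶠ t in 𝓝 (0 : ℂ), γ.toFun t ∈ (chartAt E p).source :=
    γ.holo.continuousAt.preimage_mem_nhds ((chartAt E p).open_source.mem_nhds hpm)
  have e2 : ∀ᶠ t in 𝓝 (0 : ℂ), δ.toFun t ∈ (chartAt E p).source :=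
    δ.holo.continuousAt.preimage_mem_nhds ((chartAt E p).open_source.mem_nhds hpm')
  filter_upwards [e1, e2] with t h1 h2
  rw [(chartAt E p).left_inv h1, (chartAt E p).left_inv h2]
  rfl

/-- The map `φ^{(k)} : J^k(M) → J^k(N)` induced by a holomorphic map `φ : M → N`. -/
def Jet.map (φ : M → N) (hφ : ContMDiff 𝓘(ℂ, E) 𝓘(ℂ, F) ω φ) (k : ℕ) :
    Jet E M k → Jet F N k :=
  Quotient.lift (fun γ => Jet.mk k (γ.map φ hφ)) fun _ _ h =>
    Quotient.sound (s := jetSetoid F N k) (HolCurve.sameJet_map φ hφ h)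

variable (E F) in
/-- A holomorphic map `φ : M → N` is non-degenerate if its generic rank on every connected component
of `M` is `dim N`, i.e. every component contains a point at which the differential is surjective. -/
def IsNondegenerate (φ : M → N) : Prop :=
  ∀ x : M, ∃ y ∈ connectedComponent x,
    Function.Surjective (mfderiv 𝓘(ℂ, E) 𝓘(ℂ, F) φ y)

end Functoriality

/-! ## Dimension, regular points, algebraic subvarieties -/

section Dimension

variable (H : Type*) [NormedAddCommGroup H] [NormedSpace ℂ H]
  {X : Type*} [TopologicalSpace X] [ChartedSpace H X]

/-- The complex dimension of an arbitrary subset `S` of a complex manifold: the largest `d` such that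
`S` contains a `d`-dimensional immersed piece of complex manifold, i.e. the image of a nonempty open
subset of `ℂ^d` under a holomorphic immersion. It is `⊥` for the empty set. For analytic sets, and
for their images under holomorphic maps, this is the usual dimension. -/
def complexDim (S : Set X) : WithBot ℕ∞ :=
  ⨆ d : {d : ℕ // ∃ (U : Set (EuclideanSpace ℂ (Fin d))) (f : EuclideanSpace ℂ (Fin d) → X),
      IsOpen U ∧ U.Nonempty ∧ ContMDiffOn 𝓘(ℂ, EuclideanSpace ℂ (Fin d)) 𝓘(ℂ, H) ω f U ∧
      (∀ u ∈ U, Function.Injective (mfderiv 𝓘(ℂ, EuclideanSpace ℂ (Fin d)) 𝓘(ℂ, H) f u)) ∧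
      Set.MapsTo f U S},
    ((d.1 : ℕ∞) : WithBot ℕ∞)

/-- The regular points of a subset `Z` of a complex manifold: the points of `Z` near which `Z` is a
complex submanifold, i.e. the zero set of a holomorphic map to some `ℂ^c` that is a submersion
at the point. -/
def regularLocus (Z : Set X) : Set X :=
  {p | p ∈ Z ∧ ∃ (c : ℕ) (U : Set X) (g : X → EuclideanSpace ℂ (Fin c)),
    IsOpen U ∧ p ∈ U ∧ ContMDiffOn 𝓘(ℂ, H) 𝓘(ℂ, EuclideanSpace ℂ (Fin c)) ω g U ∧
    Function.Surjective (mfderiv 𝓘(ℂ, H) 𝓘(ℂ, EuclideanSpace ℂ (Fin c)) g p) ∧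
    ∀ q ∈ U, q ∈ Z ↔ g q = 0}

end Dimension

section Algebraic

variable {m : ℕ} {M : Type*} [TopologicalSpace M] [ChartedSpace (EuclideanSpace ℂ (Fin m)) M]
  [IsManifold 𝓘(ℂ, EuclideanSpace ℂ (Fin m)) ω M]

/-- Closed subsets of `J^l(M)` given, locally over `M`, by finitely many equations which are
polynomial in the fibre coordinates `a₁, …, a_l ∈ ℂ^m` of the bundle `J^l(M) → M`, with coefficients
holomorphic on the base. (A polynomial over the ring `M → ℂ` is evaluated at a jet by evaluating its
coefficients at the base point of the jet and its variables at the jet coordinates.) -/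
def IsAlgebraicSet {l : ℕ} (Z : Set (Jet (EuclideanSpace ℂ (Fin m)) M l)) : Prop :=
  ∀ x : M, ∃ U : Set M, IsOpen U ∧ x ∈ U ∧ U ⊆ (chartAt (EuclideanSpace ℂ (Fin m)) x).source ∧
    ∃ s : Finset (MvPolynomial (Fin l × Fin m) (M → ℂ)),
      (∀ P ∈ s, ∀ α, ContMDiffOn 𝓘(ℂ, EuclideanSpace ℂ (Fin m)) 𝓘(ℂ, ℂ) ω (P.coeff α) U) ∧
      ∀ j : Jet (EuclideanSpace ℂ (Fin m)) M l, j.base ∈ U →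
        (j ∈ Z ↔ ∀ P ∈ s, P.eval₂ (Pi.evalRingHom (fun _ : M => ℂ) j.base)
          (fun v => Jet.coord x j v.1.succ v.2) = 0)

/-- An algebraic set is irreducible if its regular locus is connected (and nonempty). -/
def IsIrreducibleAlgebraicSet {l : ℕ} (Z : Set (Jet (EuclideanSpace ℂ (Fin m)) M l)) : Prop :=
  IsAlgebraicSet Z ∧ IsConnected (regularLocus (Fin (l + 1) → EuclideanSpace ℂ (Fin m)) Z)

/-- An algebraic subvariety of `J^l(M)`: a finite union of irreducible algebraic sets. -/
def IsAlgebraicSubvariety {l : ℕ} (Z : Set (Jet (EuclideanSpace ℂ (Fin m)) M l)) : Prop :=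
  ∃ C : Set (Set (Jet (EuclideanSpace ℂ (Fin m)) M l)), C.Finite ∧
    (∀ A ∈ C, IsIrreducibleAlgebraicSet A) ∧ Z = ⋃₀ C

end Algebraic

end

set_option linter.unusedSectionVars false

/-! ## Determinants and adjugates of families of endomorphisms -/

section Adjugate

variable {X : Type*} [NormedAddCommGroup X] [NormedSpace ℂ X]

/-! Two things are needed: jets of `N` lying over a generic jet of `W` lift to `M`, and the
dimension of `W^k` eventually grows with slope `dim N`.

Lifting is Hensel's lemma. The Jacobian of a local representative `f` of `φ` has order at most `e`
along a curve `g` when, for some analytic family `L` of linear maps, `det (f'(g) ∘ L)` does not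
vanish to order `e + 1`. If `f ∘ g` and `δ` agree to order `r ≥ 2e`, Newton's method with the
adjugate in place of the inverse improves `g` to a solution of any prescribed order, changing only
coefficients of order greater than `r - e` (`JacobianOrderLE.exists_lift`). If also `r ≥ l + e`, the
`l`-jet is untouched, so every `k`-jet over the image of such an `r`-jet is the image of a jet over
the same `l`-jet (`Jet.exists_lift`).

Such jets are generic. Since `φ` is non-degenerate, every jet extends to a germ along which the
Jacobian has finite order. Let `e` be this order for one regular point of an irreducible component
`A` of `Z₀`. A bound on the order means that some Taylor coefficient of index at most `e` is
nonzero; these coefficients are analytic in the jet, and the regular locus of `A` is connected and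
dense in `A`. The identity theorem therefore makes the jets of order at most `e` dense among all
`r`-jets over `A` (`exists_jetsOver_subset_closure_lowOrderJets`). As truncation is open and
`φ^{(r)}` is continuous, `W^k` is dense in `J^k_W(N)`.

For the dimension, truncation has fibres of dimension `(k - r) dim N`, so `dim W^k - k dim N` does
not increase with `k`. It is bounded below because, by lifting, `W^k` contains a whole fibre of
truncation. A non-increasing sequence of integers that is bounded below becomes constant, and `r` is
chosen beyond that point. The maximum of the finitely many `e` serves all components at once. -/

theorem analyticAt_matrix_det {ι : Type*} [Fintype ι] [DecidableEq ι] {M : X → Matrix ι ι ℂ}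
    {x : X} (hM : ∀ i j, AnalyticAt ℂ (fun y => M y i j) x) :
    AnalyticAt ℂ (fun y => (M y).det) x := by
  simp only [Matrix.det_apply']
  refine Finset.analyticAt_fun_sum _ fun σ _ => analyticAt_const.mul ?_
  exact Finset.analyticAt_fun_prod _ fun i _ => hM _ _

theorem analyticAt_matrix_adjugate {ι : Type*} [Fintype ι] [DecidableEq ι] {M : X → Matrix ι ι ℂ}
    {x : X} (hM : ∀ i j, AnalyticAt ℂ (fun y => M y i j) x) (i j : ι) :
    AnalyticAt ℂ (fun y => (M y).adjugate i j) x := by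
  simp only [Matrix.adjugate_apply]
  refine analyticAt_matrix_det fun a b => ?_
  simp only [Matrix.updateRow_apply]
  by_cases h : a = j
  · simp only [h, if_true]
    exact analyticAt_const
  · simp only [h, if_false]
    exact hM a b

variable {F : Type*} [NormedAddCommGroup F] [NormedSpace ℂ F] [FiniteDimensional ℂ F]

theorem analyticAt_toMatrix {A : X → F →L[ℂ] F} {x : X} (hA : AnalyticAt ℂ A x)
    (i j : Fin (Module.finrank ℂ F)) :
    AnalyticAt ℂ (fun y => LinearMap.toMatrix (Module.finBasis ℂ F) (Module.finBasis ℂ F)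
      (A y : F →ₗ[ℂ] F) i j) x := by
  simp only [LinearMap.toMatrix_apply]
  have h1 : AnalyticAt ℂ (fun y => A y (Module.finBasis ℂ F j)) x :=
    ((ContinuousLinearMap.apply ℂ F (Module.finBasis ℂ F j)).analyticAt _).comp hA
  have h2 := (LinearMap.toContinuousLinearMap ((Module.finBasis ℂ F).coord i)).analyticAt
    (A x (Module.finBasis ℂ F j))
  exact AnalyticAt.comp (f := fun y => A y (Module.finBasis ℂ F j)) h2 h1

theorem AnalyticAt.clm_det {A : X → F →L[ℂ] F} {x : X} (hA : AnalyticAt ℂ A x) :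
    AnalyticAt ℂ (fun y => (A y).det) x := by
  have : (fun y => (A y).det) = fun y => (LinearMap.toMatrix (Module.finBasis ℂ F)
      (Module.finBasis ℂ F) (A y : F →ₗ[ℂ] F)).det := by
    funext y
    rw [LinearMap.det_toMatrix]
  rw [this]
  exact analyticAt_matrix_det (analyticAt_toMatrix hA)

/-- An analytic family of endomorphisms has an analytic family of adjugates. -/
theorem AnalyticAt.exists_adjugate {A : X → F →L[ℂ] F} {x : X} (hA : AnalyticAt ℂ A x)
    {q : X → F} (hq : AnalyticAt ℂ q x) :
    ∃ v : X → F, AnalyticAt ℂ v x ∧ ∀ y, A y (v y) = (A y).det • q y := by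
  set b := Module.finBasis ℂ F
  set M : X → Matrix _ _ ℂ := fun y => LinearMap.toMatrix b b (A y : F →ₗ[ℂ] F) with hM
  refine ⟨fun y => Matrix.toLin b b (M y).adjugate (q y), ?_, fun y => ?_⟩
  · have h1 : ∀ y, Matrix.toLin b b (M y).adjugate (q y)
        = ∑ j, (∑ i, (M y).adjugate j i * b.coord i (q y)) • b j := fun y => by
      rw [Matrix.toLin_apply]
      rfl
    simp only [h1]
    refine Finset.analyticAt_fun_sum _ fun j _ => AnalyticAt.smul ?_ analyticAt_const
    refine Finset.analyticAt_fun_sum _ fun i _ => AnalyticAt.mul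
      (analyticAt_matrix_adjugate (analyticAt_toMatrix hA) _ _) ?_
    exact AnalyticAt.comp
      ((LinearMap.toContinuousLinearMap (b.coord i)).analyticAt (q x)) hq
  · have h1 : (A y : F →ₗ[ℂ] F) = Matrix.toLin b b (M y) := (Matrix.toLin_toMatrix b b _).symm
    have h2 : (A y).det = (M y).det := by
      rw [hM, LinearMap.det_toMatrix]
    have h3 : A y (Matrix.toLin b b (M y).adjugate (q y))
        = Matrix.toLin b b (M y * (M y).adjugate) (q y) := by
      rw [Matrix.toLin_mul b b b, LinearMap.comp_apply, ← h1]
      rfl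
    rw [h3, Matrix.mul_adjugate, h2, map_smul, Matrix.toLin_one]
    rfl

end Adjugate

/-! ## The order of the Jacobian along a curve and Newton's method -/

section Newton

variable {E : Type*} [NormedAddCommGroup E] [NormedSpace ℂ E] [CompleteSpace E]
  {F : Type*} [NormedAddCommGroup F] [NormedSpace ℂ F]

/-- The Jacobian of `f` vanishes along the curve `g` to order at most `e` at the origin. -/
def JacobianOrderLE (f : E → F) (e : ℕ) (g : ℂ → E) : Prop :=
  ∃ L : ℂ → F →L[ℂ] E, AnalyticAt ℂ L 0 ∧
    ¬ (fun t => ((fderiv ℂ f (g t)).comp (L t)).det) =O[𝓝 0] fun t : ℂ => t ^ (e + 1)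

theorem isBigO_pow_of_le {a b : ℕ} (h : a ≤ b) :
    (fun t : ℂ => t ^ b) =O[𝓝 0] fun t : ℂ => t ^ a := by
  refine IsBigO.of_bound 1 ?_
  filter_upwards [Metric.closedBall_mem_nhds (0 : ℂ) one_pos] with t ht
  rw [one_mul, norm_pow, norm_pow]
  exact pow_le_pow_of_le_one (norm_nonneg t) (by simpa using ht) h

variable [FiniteDimensional ℂ F]

theorem analyticAt_jacobian {f : E → F} {L : ℂ → F →L[ℂ] E} {x : E} {s : ℂ}
    (hf : AnalyticAt ℂ f x) (hL : AnalyticAt ℂ L s) :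
    AnalyticAt ℂ (fun p : E × ℂ => ((fderiv ℂ f p.1).comp (L p.2)).det) (x, s) := by
  have := FiniteDimensional.complete ℂ F
  have h1 : AnalyticAt ℂ (fun p : E × ℂ => fderiv ℂ f p.1) (x, s) :=
    AnalyticAt.comp (f := fun p : E × ℂ => p.1) (x := (x, s)) hf.fderiv analyticAt_fst
  have h2 : AnalyticAt ℂ (fun p : E × ℂ => L p.2) (x, s) :=
    AnalyticAt.comp (f := fun p : E × ℂ => p.2) (x := (x, s)) hL analyticAt_snd
  exact AnalyticAt.clm_det ((h1.contDiffAt (n := ω)).clm_comp h2.contDiffAt).analyticAt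

/-- The determinant is a single analytic function of the pair `(x, t)`, hence Lipschitz near `(g 0,
0)`; it is evaluated along `(g t, t)` and `(g' t, t)`. -/
theorem isBigO_jacobian_sub {f : E → F} {L : ℂ → F →L[ℂ] E} {g g' : ℂ → E} {k : ℕ}
    (hf : AnalyticAt ℂ f (g 0)) (hL : AnalyticAt ℂ L 0) (hg : ContinuousAt g 0)
    (hg' : ContinuousAt g' 0)
    (h0 : g 0 = g' 0) (h : (fun t => g t - g' t) =O[𝓝 0] fun t : ℂ => t ^ (k + 1)) :
    (fun t => ((fderiv ℂ f (g t)).comp (L t)).det - ((fderiv ℂ f (g' t)).comp (L t)).det)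
      =O[𝓝 0] fun t : ℂ => t ^ (k + 1) := by
  refine isBigO_comp_sub_comp
    (h := fun p : E × ℂ => ((fderiv ℂ f p.1).comp (L p.2)).det) (f := fun t => (g t, t))
    (g := fun t => (g' t, t)) (analyticAt_jacobian hf hL).contDiffAt
    (hg.prodMk continuousAt_id) (hg'.prodMk continuousAt_id) (by simp [h0]) ?_
  have : (fun t => (g t, t) - (g' t, t)) = fun t : ℂ => (g t - g' t, (0 : ℂ)) := by
    funext t; simp
  rw [this]
  exact h.prod_left (isBigO_zero _ _)

/-- Whether the Jacobian has order at most `e` along a curve only depends on the `e`-jet of the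
curve. -/
theorem JacobianOrderLE.congr {f : E → F} {g g' : ℂ → E} {e k : ℕ} (hek : e ≤ k)
    (hf : AnalyticAt ℂ f (g 0)) (hg : ContinuousAt g 0) (hg' : ContinuousAt g' 0) (h0 : g 0 = g' 0)
    (h : (fun t => g t - g' t) =O[𝓝 0] fun t : ℂ => t ^ (k + 1)) (hgd : JacobianOrderLE f e g) :
    JacobianOrderLE f e g' := by
  obtain ⟨L, hL, hn⟩ := hgd
  refine ⟨L, hL, fun hO => hn ?_⟩
  -- The same `L` serves for `g'`: the two determinants differ by `O(t ^ (k + 1))`, which is `O(t ^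
  -- (e + 1))`.
  have h1 := (isBigO_jacobian_sub hf hL hg hg' h0 h).trans
    (isBigO_pow_of_le (Nat.succ_le_succ hek))
  simpa using h1.add hO

/-- The order of the Jacobian does not depend on the choice of coordinates. -/
theorem JacobianOrderLE.of_comp {E' : Type*} [NormedAddCommGroup E'] [NormedSpace ℂ E']
    [CompleteSpace E'] {f : E → F} {f' : E' → F} {S : F → F} {T : E → E'} {g : ℂ → E} {e : ℕ}
    (hg : AnalyticAt ℂ g 0) (hT : AnalyticAt ℂ T (g 0)) (hf' : AnalyticAt ℂ f' (T (g 0)))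
    (hS : AnalyticAt ℂ S (f' (T (g 0)))) (hfc : f =ᶠ[𝓝 (g 0)] fun x => S (f' (T x)))
    (h : JacobianOrderLE f e g) : JacobianOrderLE f' e fun t => T (g t) := by
  have := FiniteDimensional.complete ℂ F
  obtain ⟨L, hL, hn⟩ := h
  have hTg : AnalyticAt ℂ (fun t => fderiv ℂ T (g t)) 0 :=
    AnalyticAt.comp (f := g) hT.fderiv hg
  -- By the chain rule the old determinant is `det S'` times the one formed with `T' ∘ L`, and `det
  -- S'` is bounded along the curve.
  refine ⟨fun t => (fderiv ℂ T (g t)).comp (L t),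
    ((hTg.contDiffAt (n := ω)).clm_comp hL.contDiffAt).analyticAt, fun hO => hn ?_⟩
  have hSg : AnalyticAt ℂ (fun t => (fderiv ℂ S (f' (T (g t)))).det) 0 := by
    refine AnalyticAt.clm_det ?_
    have h1 : AnalyticAt ℂ (fun t => f' (T (g t))) 0 :=
      AnalyticAt.comp (f := fun t => T (g t)) hf' (AnalyticAt.comp (f := g) hT hg)
    exact AnalyticAt.comp (f := fun t => f' (T (g t))) hS.fderiv h1
  have h1 := (hSg.continuousAt.norm.isBoundedUnder_le.isBigO_one ℂ).mul hO
  simp only [one_mul] at h1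
  refine h1.congr' ?_ EventuallyEq.rfl
  have e1 := hg.continuousAt.eventually hfc.eventuallyEq_nhds
  have e2 := hg.continuousAt.eventually hT.eventually_analyticAt
  have e3 := hg.continuousAt.eventually (hT.continuousAt.eventually hf'.eventually_analyticAt)
  have e4 := hg.continuousAt.eventually (hT.continuousAt.eventually
    (hf'.continuousAt.eventually hS.eventually_analyticAt))
  filter_upwards [e1, e2, e3, e4] with t h1 h2 h3 h4
  have h5 : fderiv ℂ f (g t)
      = (fderiv ℂ S (f' (T (g t)))).comp ((fderiv ℂ f' (T (g t))).comp (fderiv ℂ T (g t))) := by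
    rw [h1.fderiv_eq]
    exact (h4.differentiableAt.hasFDerivAt.comp (g t)
      (h3.differentiableAt.hasFDerivAt.comp (g t) h2.differentiableAt.hasFDerivAt)).fderiv
  rw [h5]
  exact (LinearMap.det_comp _ _).symm

/-- Mean value inequality on a segment, with a derivative that is Lipschitz near `x`. The estimate
is uniform in both points, so it may be evaluated along two moving curves. -/
theorem isBigO_taylor_two {f : E → F} {x : E} (hf : AnalyticAt ℂ f x) :
    (fun p : E × E => f p.1 - f p.2 - fderiv ℂ f p.2 (p.1 - p.2)) =O[𝓝 (x, x)]
      fun p : E × E => ‖p.1 - p.2‖ ^ 2 := by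
  have := FiniteDimensional.complete ℂ F
  obtain ⟨K, s, hs, hK⟩ := (hf.fderiv.contDiffAt (n := 1)).exists_lipschitzOnWith
  obtain ⟨ρ, hρ, hball⟩ := Metric.mem_nhds_iff.1 (inter_mem hs hf.eventually_analyticAt)
  refine IsBigO.of_bound K ?_
  have e1 : ∀ᶠ p : E × E in 𝓝 (x, x), p ∈ Metric.ball x ρ ×ˢ Metric.ball x ρ :=
    prod_mem_nhds (Metric.ball_mem_nhds x hρ) (Metric.ball_mem_nhds x hρ)
  filter_upwards [e1] with p hp
  have hseg : segment ℝ p.2 p.1 ⊆ Metric.ball x ρ :=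
    (convex_ball x ρ).segment_subset hp.2 hp.1
  have hb : ∀ z ∈ segment ℝ p.2 p.1, ‖fderiv ℂ f z - fderiv ℂ f p.2‖ ≤ K * ‖p.1 - p.2‖ := by
    intro z hz
    refine (hK.norm_sub_le (hball (hseg hz)).1 (hball hp.2).1).trans ?_
    gcongr
    have h1 : z ∈ Metric.closedBall p.2 ‖p.1 - p.2‖ :=
      (convex_closedBall p.2 ‖p.1 - p.2‖).segment_subset
        (Metric.mem_closedBall_self (norm_nonneg _)) (by simp [dist_eq_norm]) hz
    simpa [dist_eq_norm] using h1
  have h2 := (convex_segment (𝕜 := ℝ) p.2 p.1).norm_image_sub_le_of_norm_hasFDerivWithin_le'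
    (𝕜 := ℂ) (f := f) (f' := fderiv ℂ f) (φ := fderiv ℂ f p.2)
    (fun z hz => (hball (hseg hz)).2.differentiableAt.hasFDerivAt.hasFDerivWithinAt) hb
    (left_mem_segment ℝ _ _) (right_mem_segment ℝ _ _)
  simp only [norm_pow, norm_norm]
  rw [pow_two, ← mul_assoc]
  exact h2

/-- One step of Newton's method along a curve. -/
theorem JacobianOrderLE.newton_step {f : E → F} {g : ℂ → E} {δ : ℂ → F} {e s : ℕ}
    (hf : AnalyticAt ℂ f (g 0)) (hg : AnalyticAt ℂ g 0) (hδ : AnalyticAt ℂ δ 0)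
    (hgd : JacobianOrderLE f e g) (hes : 2 * e ≤ s)
    (h : (fun t => f (g t) - δ t) =O[𝓝 0] fun t : ℂ => t ^ (s + 1)) :
    ∃ g' : ℂ → E, AnalyticAt ℂ g' 0 ∧ g' 0 = g 0 ∧ JacobianOrderLE f e g' ∧
      (fun t => g' t - g t) =O[𝓝 0] (fun t : ℂ => t ^ (s - e + 1)) ∧
      (fun t => f (g' t) - δ t) =O[𝓝 0] fun t : ℂ => t ^ (s + 1 + 1) := by
  have := FiniteDimensional.complete ℂ F
  obtain ⟨L, hL, hn⟩ := id hgd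
  have hfg : AnalyticAt ℂ (fun t => f (g t)) 0 := AnalyticAt.comp (f := g) hf hg
  have hord := (isBigO_pow_succ_iff (hfg.fun_sub hδ) s).1 h
  rw [← natCast_le_analyticOrderAt_iff_iteratedDeriv_eq_zero (hfg.fun_sub hδ),
    natCast_le_analyticOrderAt (hfg.fun_sub hδ)] at hord
  -- The error is `f ∘ g - δ = t ^ (s + 1) • q` with `q` analytic.
  obtain ⟨q, hq, hfq⟩ := hord
  set A : ℂ → F →L[ℂ] F := fun t => (fderiv ℂ f (g t)).comp (L t) with hA
  have hAa : AnalyticAt ℂ A 0 := by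
    have h1 : AnalyticAt ℂ (fun t => fderiv ℂ f (g t)) 0 := AnalyticAt.comp (f := g) hf.fderiv hg
    exact ((h1.contDiffAt (n := ω)).clm_comp hL.contDiffAt).analyticAt
  have hdet : AnalyticAt ℂ (fun t => (A t).det) 0 := hAa.clm_det
  have hdn : ¬ ((e + 1 : ℕ) : ℕ∞) ≤ analyticOrderAt (fun t => (A t).det) 0 := by
    rw [natCast_le_analyticOrderAt_iff_iteratedDeriv_eq_zero hdet, ← isBigO_pow_succ_iff hdet]
    exact hn
  rw [not_le] at hdn
  obtain ⟨d, hd⟩ := ENat.ne_top_iff_exists.1 (ne_top_of_lt hdn)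
  rw [← hd] at hdn
  have hde : d < e + 1 := by exact_mod_cast hdn
  -- The determinant is `t ^ d • u` with `u 0 ≠ 0` and `d ≤ e`.
  obtain ⟨u, hu, hu0, hdu⟩ := (hdet.analyticOrderAt_eq_natCast).1 hd.symm
  obtain ⟨v, hv, hAv⟩ := hAa.exists_adjugate hq
  have hLv : AnalyticAt ℂ (fun t => L t (v t)) 0 :=
    ((hL.contDiffAt (n := ω)).clm_apply hv.contDiffAt).analyticAt
  set w : ℂ → E := fun t => (u t)⁻¹ • L t (v t) with hw
  have hwa : AnalyticAt ℂ w 0 := (hu.fun_inv hu0).fun_smul hLv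
  have hpow : AnalyticAt ℂ (fun t : ℂ => t ^ (s + 1 - d)) 0 := by fun_prop
  -- Dividing `A v = det A • q` by `t ^ d • u` shows that this correction solves the linearised
  -- equation exactly, at the cost of `d` orders of vanishing.
  set g' : ℂ → E := fun t => g t - t ^ (s + 1 - d) • w t with hg'def
  have hg' : AnalyticAt ℂ g' 0 := hg.fun_sub (hpow.fun_smul hwa)
  have h0 : g' 0 = g 0 := by
    have : s + 1 - d ≠ 0 := by omega
    simp [hg'def, this]
  have hdiff : (fun t => g' t - g t) =O[𝓝 0] fun t : ℂ => t ^ (s + 1 - d) := by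
    have h1 := ((isBigO_refl (fun t : ℂ => t ^ (s + 1 - d)) (𝓝 0)).smul
      (hwa.continuousAt.norm.isBoundedUnder_le.isBigO_one ℂ)).neg_left
    refine h1.congr (fun t => ?_) fun t => by simp
    simp [hg'def]
  have hdiff' : (fun t => g' t - g t) =O[𝓝 0] fun t : ℂ => t ^ (s - e + 1) :=
    hdiff.trans (isBigO_pow_of_le (by omega))
  refine ⟨g', hg', h0, ?_, hdiff', ?_⟩
  -- The curves agree to order `s - e`, and `s - e ≥ e` because `2 * e ≤ s`.
  · refine hgd.congr (k := s - e) (by omega) hf hg.continuousAt hg'.continuousAt h0.symm ?_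
    simpa using hdiff'.neg_left
  · have h1 : Tendsto (fun t => (g' t, g t)) (𝓝 0) (𝓝 (g 0, g 0)) := by
      have := hg'.continuousAt.tendsto.prodMk_nhds hg.continuousAt.tendsto
      rwa [h0] at this
    have h2 := (isBigO_taylor_two hf).comp_tendsto h1
    -- The quadratic remainder has order `2 * (s + 1 - d)`, which is at least `s + 2` since `2 * d ≤
    -- 2 * e ≤ s`.
    have h3 : (fun t => ‖g' t - g t‖ ^ 2) =O[𝓝 0] fun t : ℂ => t ^ (s + 1 + 1) := by
      refine ((hdiff.norm_left.pow 2).congr_right fun t => (pow_mul t _ 2).symm).trans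
        (isBigO_pow_of_le (by omega))
    refine (h2.trans h3).congr' ?_ EventuallyEq.rfl
    filter_upwards [hfq, hdu, hu.continuousAt.eventually_ne hu0] with t ht1 ht2 ht3
    have h4 : fderiv ℂ f (g t) (g' t - g t) = - (f (g t) - δ t) := by
      have h5 : fderiv ℂ f (g t) (L t (v t)) = (A t).det • q t := by
        rw [← hAv]
        rfl
      have h6 : g' t - g t = - (t ^ (s + 1 - d) • w t) := by simp [hg'def]
      rw [h6, map_neg, map_smul, hw]
      simp only [map_smul]
      rw [h5, ht1, ht2, smul_smul, smul_smul]
      congr 2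
      simp only [sub_zero, smul_eq_mul]
      have : t ^ (s + 1) = t ^ (s + 1 - d) * t ^ d := by
        rw [← pow_add]
        congr 1
        omega
      rw [this]
      field_simp
    simp only [Function.comp_apply]
    rw [h4]
    abel

/-- Newton's method: approximate solutions of `f ∘ g = δ` along which the Jacobian of `f` vanishes
to a comparatively low order can be improved to any order. -/
theorem JacobianOrderLE.exists_lift {f : E → F} {g : ℂ → E} {δ : ℂ → F} {e r : ℕ}
    (hf : AnalyticAt ℂ f (g 0)) (hg : AnalyticAt ℂ g 0) (hδ : AnalyticAt ℂ δ 0)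
    (hgd : JacobianOrderLE f e g) (her : 2 * e ≤ r)
    (h : (fun t => f (g t) - δ t) =O[𝓝 0] fun t : ℂ => t ^ (r + 1)) {k : ℕ} (hrk : r ≤ k) :
    ∃ g' : ℂ → E, AnalyticAt ℂ g' 0 ∧ g' 0 = g 0 ∧ JacobianOrderLE f e g' ∧
      (fun t => g' t - g t) =O[𝓝 0] (fun t : ℂ => t ^ (r - e + 1)) ∧
      (fun t => f (g' t) - δ t) =O[𝓝 0] fun t : ℂ => t ^ (k + 1) := by
  induction k, hrk using Nat.le_induction with
  | base => exact ⟨g, hg, rfl, hgd, by simpa using isBigO_zero _ _, h⟩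
  | succ k hk ih =>
    obtain ⟨g₁, h1, h2, h3, h4, h5⟩ := ih
    obtain ⟨g₂, k1, k2, k3, k4, k5⟩ :=
      h3.newton_step (h2 ▸ hf) h1 hδ (her.trans hk) h5
    refine ⟨g₂, k1, k2.trans h2, k3, ?_, k5⟩
    simpa using (k4.trans (isBigO_pow_of_le (by omega))).add h4

end Newton

/-! ## Generic behaviour of the order of the Jacobian -/

section Generic

variable {E : Type*} [NormedAddCommGroup E] [NormedSpace ℂ E] [CompleteSpace E]
  {F : Type*} [NormedAddCommGroup F] [NormedSpace ℂ F] [FiniteDimensional ℂ F]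

theorem polyCurve_comp_analyticAt {H : Type*} [NormedAddCommGroup H] [NormedSpace ℂ H] {r : ℕ}
    {Θ : H → Fin (r + 1) → E} {u : H} (hΘ : AnalyticAt ℂ Θ u) (t : ℂ) :
    AnalyticAt ℂ (fun p : H × ℂ => polyCurve (Θ p.1) p.2) (u, t) := by
  have h1 : AnalyticAt ℂ (fun p : H × ℂ => (Θ p.1, p.2)) (u, t) :=
    (AnalyticAt.comp (f := fun p : H × ℂ => p.1) (x := (u, t)) hΘ analyticAt_fst).prod analyticAt_snd
  exact AnalyticAt.comp (f := fun p : H × ℂ => (Θ p.1, p.2)) (x := (u, t))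
    (contDiff_polyCurve r).contDiffAt.analyticAt h1

/-- In an analytic family of polynomial curves over a connected base, a bound for the order of the
Jacobian which holds for one curve holds for a dense set of curves. -/
theorem JacobianOrderLE.frequently_polyCurve {H : Type*} [NormedAddCommGroup H] [NormedSpace ℂ H]
    {f : E → F} {Ω : Set E} (hf : AnalyticOnNhd ℂ f Ω) {r e : ℕ}
    {Θ : H → Fin (r + 1) → E} {B : Set H} (hB : IsOpen B) (hBc : IsPreconnected B)
    (hΘ : AnalyticOnNhd ℂ Θ B) (hΘΩ : ∀ u ∈ B, Θ u 0 ∈ Ω) {u₀ u₁ : H} (h₀ : u₀ ∈ B) (h₁ : u₁ ∈ B)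
    (h : JacobianOrderLE f e (polyCurve (Θ u₀))) :
    ∃ᶠ u in 𝓝 u₁, JacobianOrderLE f e (polyCurve (Θ u)) := by
  obtain ⟨L, hL, hn⟩ := h
  -- The family `L` found for `u₀` is kept fixed while `u` varies. It is analytic only near `0`, so
  -- `G` is studied on the open set `D` of its points of analyticity, which contains `B × {0}`.
  set G : H × ℂ → ℂ := fun p => ((fderiv ℂ f (polyCurve (Θ p.1) p.2)).comp (L p.2)).det with hG
  set D : Set (H × ℂ) := {p | AnalyticAt ℂ G p} with hD
  have hDo : IsOpen D := isOpen_analyticAt ℂ G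
  have hBD : ∀ u ∈ B, (u, (0 : ℂ)) ∈ D := fun u hu => by
    have h1 : AnalyticAt ℂ (fun p : H × ℂ => (polyCurve (Θ p.1) p.2, p.2)) (u, 0) :=
      (polyCurve_comp_analyticAt (hΘ u hu) 0).prod analyticAt_snd
    refine AnalyticAt.comp (f := fun p : H × ℂ => (polyCurve (Θ p.1) p.2, p.2)) (x := (u, 0))
      (analyticAt_jacobian (f := f) (L := L) ?_ hL) h1
    simp only [polyCurve_zero]
    exact hf _ (hΘΩ u hu)
  have hGu : ∀ u ∈ B, AnalyticAt ℂ (fun t => G (u, t)) 0 := fun u hu =>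
    AnalyticAt.comp (f := fun t : ℂ => (u, t)) (hBD u hu) (analyticAt_const.prod analyticAt_id)
  have hcoef : ∀ i, AnalyticOnNhd ℂ (fun u => taylorCoeff (fun t => G (u, t)) i) B := fun i u hu =>
    analyticOnNhd_taylorCoeff hDo (fun p hp => hp) i u (hBD u hu)
  rw [isBigO_pow_succ_iff (hGu u₀ h₀)] at hn
  push Not at hn
  obtain ⟨i, hie, hi⟩ := hn
  have hif : ((i.factorial : ℂ)⁻¹) ≠ 0 := inv_ne_zero (by exact_mod_cast i.factorial_ne_zero)
  -- If the `i`-th coefficient vanished near `u₁`, the identity theorem on `B` would make it vanish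
  -- at `u₀`.
  have hne : ∃ᶠ u in 𝓝 u₁, taylorCoeff (fun t => G (u, t)) i ≠ 0 := by
    intro h0
    simp only [ne_eq, not_not] at h0
    have := (hcoef i).eqOn_zero_of_preconnected_of_eventuallyEq_zero hBc h₁ h0 h₀
    exact (smul_ne_zero hif hi) this
  refine (hne.and_eventually (hB.mem_nhds h₁)).mono fun u hu => ⟨L, hL, fun hO => ?_⟩
  rw [isBigO_pow_succ_iff (hGu u hu.2)] at hO
  refine hu.1 ?_
  rw [taylorCoeff, hO i hie, smul_zero]

/-- If `f` is generically submersive then every jet is the jet of a curve along which the Jacobian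
of `f` does not vanish identically. -/
theorem exists_jacobianOrderLE {f : E → F} {p : ℂ → E} (hp : AnalyticAt ℂ p 0)
    (hf : AnalyticAt ℂ f (p 0)) (hs : ∃ᶠ y in 𝓝 (p 0), Function.Surjective (fderiv ℂ f y)) (l : ℕ) :
    ∃ (g : ℂ → E) (e : ℕ), AnalyticAt ℂ g 0 ∧ g 0 = p 0 ∧
      (fun t => g t - p t) =O[𝓝 0] (fun t : ℂ => t ^ (l + 1)) ∧ JacobianOrderLE f e g := by
  obtain ⟨ρ, hρ, hfρ⟩ := Metric.eventually_nhds_iff_ball.1 hf.eventually_analyticAt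
  have h4 : 0 < ρ / 4 := by positivity
  obtain ⟨σ, hσ, hpσ⟩ := Metric.eventually_nhds_iff_ball.1
    (hp.eventually_analyticAt.and (hp.continuousAt.eventually (Metric.ball_mem_nhds _ h4)))
  obtain ⟨y, hy, hyb⟩ := (hs.and_eventually (Metric.ball_mem_nhds _ h4)).exists
  -- A nonzero time inside the disc on which `p` is analytic and stays within `ρ / 4` of `p 0`; the
  -- perturbed curve will reach the submersive point `y` at this time.
  set τ : ℂ := ((σ / 2 : ℝ) : ℂ) with hτ
  have hτn : ‖τ‖ = σ / 2 := by
    rw [hτ, Complex.norm_real, Real.norm_of_nonneg (by positivity)]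
  have hτ0 : τ ≠ 0 := by
    rw [← norm_ne_zero_iff, hτn]
    positivity
  have hball : ∀ s ∈ Metric.closedBall (0 : ℂ) ‖τ‖, s ∈ Metric.ball (0 : ℂ) σ := fun s hs => by
    rw [mem_closedBall_zero_iff, hτn] at hs
    rw [mem_ball_zero_iff]
    linarith
  have hτb : τ ∈ Metric.closedBall (0 : ℂ) ‖τ‖ := by simp
  have h0b : (0 : ℂ) ∈ Metric.closedBall (0 : ℂ) ‖τ‖ := by simp
  set w : E := y - p τ with hw
  have hwn : ‖w‖ < ρ / 2 := by
    have h1 := mem_ball_iff_norm.1 hyb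
    have h2 := mem_ball_iff_norm.1 (hpσ τ (hball τ hτb)).2
    have h3 : w = (y - p 0) - (p τ - p 0) := by rw [hw]; abel
    rw [h3]
    exact (norm_sub_le _ _).trans_lt (by linarith)
  -- The perturbation vanishes to order `l + 1` at `0` and equals `w` at `τ`, so `g` has the `l`-jet
  -- of `p` and `g τ = y`. The bounds `ρ / 4` and `ρ / 2` keep `g` in the ball where `f` is
  -- analytic.
  set g : ℂ → E := fun s => p s + (s / τ) ^ (l + 1) • w with hg
  have hga : ∀ s ∈ Metric.closedBall (0 : ℂ) ‖τ‖, AnalyticAt ℂ g s := fun s hs => by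
    have h1 : AnalyticAt ℂ (fun s : ℂ => (s / τ) ^ (l + 1)) s := by fun_prop (disch := exact hτ0)
    exact (hpσ s (hball s hs)).1.fun_add (h1.fun_smul analyticAt_const)
  have hgb : ∀ s ∈ Metric.closedBall (0 : ℂ) ‖τ‖, g s ∈ Metric.ball (p 0) ρ := fun s hs => by
    have h2 := mem_ball_iff_norm.1 (hpσ s (hball s hs)).2
    have h5 : ‖(s / τ) ^ (l + 1) • w‖ ≤ ‖w‖ := by
      rw [norm_smul, norm_pow, norm_div]
      refine mul_le_of_le_one_left (norm_nonneg _) (pow_le_one₀ (by positivity) ?_)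
      exact div_le_one_of_le₀ (by simpa using hs) (norm_nonneg _)
    rw [mem_ball_iff_norm]
    have h3 : g s - p 0 = (p s - p 0) + (s / τ) ^ (l + 1) • w := by simp only [hg]; abel
    rw [h3]
    exact (norm_add_le _ _).trans_lt (by linarith)
  -- A constant family `L` suffices: a right inverse at `y` makes the determinant equal to `1` at
  -- time `τ`, hence not identically zero near `0`.
  obtain ⟨L₀, hL₀⟩ := (fderiv ℂ f y : E →ₗ[ℂ] F).exists_rightInverse_of_surjective
    (LinearMap.range_eq_top.2 hy)
  set L : F →L[ℂ] E := LinearMap.toContinuousLinearMap L₀ with hL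
  set Δ : ℂ → ℂ := fun s => ((fderiv ℂ f (g s)).comp L).det with hΔ
  have hΔa : AnalyticOnNhd ℂ Δ (Metric.closedBall (0 : ℂ) ‖τ‖) := fun s hs =>
    AnalyticAt.comp (f := fun s : ℂ => (g s, s))
      (analyticAt_jacobian (f := f) (L := fun _ => L) (hfρ _ (hgb s hs)) analyticAt_const)
      ((hga s hs).prod analyticAt_id)
  have hgτ : g τ = y := by simp [hg, hw, hτ0]
  have hΔτ : Δ τ ≠ 0 := by
    have h1 : ((fderiv ℂ f y).comp L : F →ₗ[ℂ] F) = LinearMap.id := hL₀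
    have h2 : Δ τ = LinearMap.det ((fderiv ℂ f y).comp L : F →ₗ[ℂ] F) := by
      simp only [hΔ, hgτ]
    rw [h2, h1, LinearMap.det_id]
    exact one_ne_zero
  have hΔ0 : analyticOrderAt Δ 0 ≠ ⊤ := by
    rw [ne_eq, analyticOrderAt_eq_top]
    intro h0
    exact hΔτ (hΔa.eqOn_zero_of_preconnected_of_eventuallyEq_zero
      (convex_closedBall (0 : ℂ) ‖τ‖).isPreconnected h0b h0 hτb)
  obtain ⟨e, he⟩ := ENat.ne_top_iff_exists.1 hΔ0
  refine ⟨g, e, hga 0 h0b, by simp [hg], ?_, fun _ => L, analyticAt_const, ?_⟩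
  · have h1 := (isBigO_refl (fun t : ℂ => t ^ (l + 1)) (𝓝 0)).smul
      (isBigO_const_const ((τ ^ (l + 1))⁻¹ • w) (one_ne_zero (α := ℂ)) (𝓝 (0 : ℂ)))
    refine h1.congr (fun t => ?_) fun t => by simp
    simp only [hg, add_sub_cancel_left, smul_smul, div_eq_mul_inv, mul_pow, inv_pow]
  · intro hO
    have hO : Δ =O[𝓝 0] fun t : ℂ => t ^ (e + 1) := hO
    rw [isBigO_pow_succ_iff (hΔa 0 h0b),
      ← natCast_le_analyticOrderAt_iff_iteratedDeriv_eq_zero (hΔa 0 h0b), ← he] at hO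
    have : e + 1 ≤ e := by exact_mod_cast hO
    omega

end Generic

/-! ## Zero sets of analytic functions -/

section ZeroSets

/-- The zero set of an analytic submersion has a local analytic parametrisation. -/
theorem exists_local_parametrisation {H : Type*} [NormedAddCommGroup H] [NormedSpace ℂ H]
    [FiniteDimensional ℂ H] {G : Type*} [NormedAddCommGroup G] [NormedSpace ℂ G]
    [FiniteDimensional ℂ G] {g : H → G} {p : H} (hg : AnalyticAt ℂ g p)
    (hs : Function.Surjective (fderiv ℂ g p)) (hp : g p = 0) :
    ∃ (K : Submodule ℂ H) (ψ : K → H) (π : H →L[ℂ] K), AnalyticAt ℂ ψ 0 ∧ ψ 0 = p ∧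
      (∀ᶠ u in 𝓝 0, g (ψ u) = 0 ∧ π (ψ u - p) = u) ∧
      (∀ᶠ x in 𝓝 p, g x = 0 → ψ (π (x - p)) = x) ∧
      ∀ᶠ x in 𝓝 p, Function.Surjective ((fderiv ℂ g x).prod π) := by
  have := FiniteDimensional.complete ℂ H
  have := FiniteDimensional.complete ℂ G
  set f' := fderiv ℂ g p with hf'
  -- With `π` a projection onto the kernel `K`, the map `x ↦ (g x, π (x - p))` is a local
  -- biholomorphism, and `ψ` is its inverse restricted to `{0} × K`.
  let K := LinearMap.ker (f' : H →ₗ[ℂ] G)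
  obtain ⟨π₀, hπ₀⟩ := K.subtype.exists_leftInverse_of_injective (Submodule.ker_subtype _)
  set π : H →L[ℂ] K := LinearMap.toContinuousLinearMap π₀ with hπ
  have hπK : ∀ u : K, π u = u := fun u => LinearMap.congr_fun hπ₀ u
  have hinj : Function.Injective (f'.prod π) := by
    rw [injective_iff_map_eq_zero]
    intro x hx
    have h1 : f' x = 0 := congrArg Prod.fst hx
    have h2 : π x = 0 := congrArg Prod.snd hx
    have h3 : π ((⟨x, h1⟩ : K) : H) = ⟨x, h1⟩ := hπK ⟨x, h1⟩
    have h4 : (⟨x, h1⟩ : K) = 0 := h3.symm.trans h2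
    exact congrArg Subtype.val h4
  have hsurj : Function.Surjective (f'.prod π) := by
    rintro ⟨y, k⟩
    obtain ⟨x, hx⟩ := hs y
    have h1 : ∀ u : K, f' u = 0 := fun u => u.2
    refine ⟨x + ((k - π x : K) : H), Prod.ext ?_ ?_⟩
    · change f' (x + _) = y
      rw [map_add, h1, hx, add_zero]
    · change π (x + _) = k
      rw [map_add, hπK]
      abel
  set Φ' : H ≃L[ℂ] G × K := ContinuousLinearEquiv.ofBijective (f'.prod π)
    (LinearMap.ker_eq_bot.2 hinj) (LinearMap.range_eq_top.2 hsurj) with hΦ'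
  have hΦ'c : (Φ' : H →L[ℂ] G × K) = f'.prod π := by ext x <;> rfl
  set Φ : H → G × K := fun x => (g x, π (x - p)) with hΦ
  have hπa : ∀ x, HasFDerivAt (fun x => π (x - p)) π x := fun x =>
    π.hasFDerivAt.comp x ((hasFDerivAt_id x).sub_const p)
  have hΦa : AnalyticAt ℂ Φ p :=
    hg.prod (AnalyticAt.comp (f := fun x => x - p) (π.analyticAt _)
      (analyticAt_id.fun_sub analyticAt_const))
  have hΦd : HasFDerivAt Φ (Φ' : H →L[ℂ] G × K) p := by
    rw [hΦ'c]
    exact hg.differentiableAt.hasFDerivAt.prodMk (hπa p)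
  set e := hΦa.contDiffAt.toOpenPartialHomeomorph Φ hΦd (n := ω) (by simp) with he
  have hcoe : ∀ x, e x = Φ x := fun x => rfl
  have hpe : p ∈ e.source := hΦa.contDiffAt.mem_toOpenPartialHomeomorph_source hΦd (by simp)
  have hΦp : Φ p = (0, 0) := by simp [hΦ, hp]
  have hes : AnalyticAt ℂ e.symm (0, 0) := by
    rw [← hΦp, ← hcoe]
    have h1 : e.symm (e p) = p := e.left_inv hpe
    refine (e.contDiffAt_symm (n := ω) (f₀' := Φ') (e.map_source hpe) ?_ ?_).analyticAt
    · rw [h1]; exact hΦd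
    · rw [h1]; exact hΦa.contDiffAt
  have h00 : ((0, 0) : G × K) ∈ e.target := by rw [← hΦp, ← hcoe]; exact e.map_source hpe
  have hψ : AnalyticAt ℂ (fun u : K => e.symm (0, u)) 0 :=
    AnalyticAt.comp (f := fun u : K => ((0 : G), u)) hes (analyticAt_const.prod analyticAt_id)
  refine ⟨K, fun u => e.symm (0, u), π, hψ, ?_, ?_, ?_, ?_⟩
  · change e.symm (0, 0) = p
    rw [← hΦp, ← hcoe, e.left_inv hpe]
  · have h1 : ∀ᶠ u : K in 𝓝 0, ((0 : G), u) ∈ e.target := by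
      have : ContinuousAt (fun u : K => ((0 : G), u)) 0 := by fun_prop
      exact this.preimage_mem_nhds (e.open_target.mem_nhds h00)
    filter_upwards [h1] with u hu
    have h2 : Φ (e.symm (0, u)) = (0, u) := e.right_inv hu
    exact ⟨congrArg Prod.fst h2, congrArg Prod.snd h2⟩
  · filter_upwards [e.open_source.mem_nhds hpe] with x hx hx0
    have h1 : e x = (0, π (x - p)) := by rw [hcoe, hΦ, ← hx0]
    rw [← h1, e.left_inv hx]
  · have h1 : ContinuousAt (fun x => (fderiv ℂ g x).prod π) p := by
      have h2 : ContDiffAt ℂ ω (fderiv ℂ g) p := hg.fderiv.contDiffAt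
      exact (ContinuousLinearMap.prodₗᵢ ℂ).continuous.continuousAt.comp
        (h2.continuousAt.prodMk continuousAt_const)
    -- Invertible operators form an open set, so the differential stays invertible near `p`.
    have h2 := h1.preimage_mem_nhds (t := Set.range ((↑) : (H ≃L[ℂ] G × K) → H →L[ℂ] G × K))
      (by rw [← hf', ← hΦ'c]; exact ContinuousLinearEquiv.nhds Φ')
    filter_upwards [h2] with x hx
    obtain ⟨A, hA⟩ := hx
    change (A : H →L[ℂ] G × K) = (fderiv ℂ g x).prod π at hA
    rw [← hA]
    exact A.surjective

/-- If an analytic function vanishes on `T` but not identically, then some analytic function which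
vanishes on `T` has a nonzero differential at a point of `T`. -/
theorem exists_fderiv_ne_zero_of_vanishing {K : Type*} [NormedAddCommGroup K] [NormedSpace ℂ K]
    {B T : Set K} {u₀ : K} (hu₀ : u₀ ∈ B) (hT : u₀ ∈ T) {f : K → ℂ}
    (hf : AnalyticOnNhd ℂ f B) (hfT : ∀ u ∈ B, u ∈ T → f u = 0) (hf0 : ¬ ∀ᶠ u in 𝓝 u₀, f u = 0) :
    ∃ h : K → ℂ, AnalyticOnNhd ℂ h B ∧ (∀ u ∈ B, u ∈ T → h u = 0) ∧
      ∃ u ∈ B, u ∈ T ∧ fderiv ℂ h u ≠ 0 := by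
  by_contra! hcon
  -- The components of the `n`-th derivative are analytic and, by induction, vanish on `T`; under
  -- the contrary assumption their differentials vanish there too. Hence the Taylor series of `f` at
  -- `u₀` is zero.
  have hit : ∀ n : ℕ, ∀ u ∈ B, u ∈ T → iteratedFDeriv ℂ n f u = 0 := by
    intro n
    induction n with
    | zero =>
      intro u hu huT
      ext m
      simp [hfT u hu huT]
    | succ n ih =>
      intro u hu huT
      ext m
      have ha : AnalyticOnNhd ℂ (iteratedFDeriv ℂ n f) B := hf.iteratedFDeriv n
      set ev := ContinuousMultilinearMap.apply ℂ (fun _ : Fin n => K) ℂ (Fin.tail m) with hev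
      have h1 := hcon (fun v => ev (iteratedFDeriv ℂ n f v))
        (fun v hv => AnalyticAt.comp (ev.analyticAt _) (ha v hv))
        (fun v hv hvT => by rw [ih v hv hvT, map_zero]) u hu huT
      have h2 : HasFDerivAt (fun v => ev (iteratedFDeriv ℂ n f v))
          (ev.comp (fderiv ℂ (iteratedFDeriv ℂ n f) u)) u :=
        ev.hasFDerivAt.comp u (ha u hu).differentiableAt.hasFDerivAt
      rw [h2.fderiv] at h1
      have h3 := DFunLike.congr_fun h1 (m 0)
      rw [iteratedFDeriv_succ_apply_left]
      exact h3
  obtain ⟨P, ρ, hP⟩ := hf u₀ hu₀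
  refine hf0 ?_
  have hball : ∀ᶠ u in 𝓝 u₀, u - u₀ ∈ Metric.eball (0 : K) ρ := by
    have : ContinuousAt (fun u : K => u - u₀) u₀ := by fun_prop
    refine this.preimage_mem_nhds ?_
    rw [sub_self]
    exact Metric.eball_mem_nhds 0 hP.r_pos
  filter_upwards [hball] with u hu
  have h1 := hP.hasSum_iteratedFDeriv hu
  simp only [hit _ u₀ hu₀ hT, zero_apply, smul_zero, add_sub_cancel] at h1
  exact h1.unique hasSum_zero

/-- `S` is a complex submanifold near `p`. -/
def IsRegularAt {H : Type*} [NormedAddCommGroup H] [NormedSpace ℂ H] (S : Set H) (p : H) : Prop :=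
  ∃ (c : ℕ) (g : H → EuclideanSpace ℂ (Fin c)), AnalyticAt ℂ g p ∧
    Function.Surjective (fderiv ℂ g p) ∧ ∀ᶠ x in 𝓝 p, x ∈ S ↔ g x = 0

/-- Regular points of analytic sets exist. -/
theorem exists_isRegularAt {H : Type*} [NormedAddCommGroup H] [NormedSpace ℂ H]
    [FiniteDimensional ℂ H] {S V : Set H} (hV : IsOpen V) {ι : Type*} (s : Finset ι)
    (f : ι → H → ℂ) (hf : ∀ i ∈ s, AnalyticOnNhd ℂ (f i) V)
    (hS : ∀ x ∈ V, x ∈ S ↔ ∀ i ∈ s, f i x = 0) {a : H} (haV : a ∈ V) (haS : a ∈ S) :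
    ∃ p ∈ V, p ∈ S ∧ IsRegularAt S p := by
  -- Induction on the remaining codimension: `S` lies near `p` in the smooth zero set of `g`. Either
  -- every equation vanishes on that zero set, and `S` equals it, or one more independent equation
  -- can be added at a nearby point of `S`. A submersion to a space of dimension `dim H + 1` is
  -- impossible, so the process stops.
  have key : ∀ (n : ℕ) (G : Type) [NormedAddCommGroup G] [NormedSpace ℂ G]
      [FiniteDimensional ℂ G], Module.finrank ℂ G + n = Module.finrank ℂ H + 1 →
      ∀ (p : H) (g : H → G), p ∈ V → p ∈ S → AnalyticAt ℂ g p →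
      Function.Surjective (fderiv ℂ g p) → (∀ᶠ x in 𝓝 p, x ∈ S → g x = 0) →
      ∃ p ∈ V, p ∈ S ∧ IsRegularAt S p := by
    intro n
    induction n with
    | zero =>
      intro G _ _ _ hfr p g _ _ _ hsurj _
      have := LinearMap.finrank_le_finrank_of_surjective (f := (fderiv ℂ g p : H →ₗ[ℂ] G)) hsurj
      omega
    | succ n ih =>
      intro G _ _ _ hfr p g hpV hpS hg hsurj hgS
      obtain ⟨K, ψ, π, hψ, hψ0, hψg, hψπ, hπs⟩ :=
        exists_local_parametrisation hg hsurj (hgS.self_of_nhds hpS)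
      by_cases hall : ∀ i ∈ s, ∀ᶠ u in 𝓝 0, f i (ψ u) = 0
      · let ε : G ≃L[ℂ] EuclideanSpace ℂ (Fin (Module.finrank ℂ G)) :=
          ContinuousLinearEquiv.ofFinrankEq (by simp)
        refine ⟨p, hpV, hpS, Module.finrank ℂ G, fun x => ε (g x),
          AnalyticAt.comp (ε.contDiff (n := ω)).contDiffAt.analyticAt hg, ?_, ?_⟩
        · have h1 : HasFDerivAt (fun x => ε (g x)) ((ε : G →L[ℂ]
              EuclideanSpace ℂ (Fin (Module.finrank ℂ G))).comp (fderiv ℂ g p)) p :=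
            ε.hasFDerivAt.comp p hg.differentiableAt.hasFDerivAt
          rw [h1.fderiv]
          exact ε.surjective.comp hsurj
        · have h1 : Tendsto (fun x => π (x - p)) (𝓝 p) (𝓝 0) := by
            have : ContinuousAt (fun x => π (x - p)) p := by fun_prop
            simpa using this.tendsto
          filter_upwards [hgS, hV.mem_nhds hpV, hψπ,
            h1.eventually ((Finset.eventually_all s).2 hall)] with x h2 h3 h4 h5
          rw [map_eq_zero_iff ε ε.injective]
          refine ⟨h2, fun h6 => (hS x h3).2 fun i hi => ?_⟩
          rw [← h4 h6]
          exact h5 i hi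
      · obtain ⟨i, hi, hfi⟩ : ∃ i ∈ s, ¬ ∀ᶠ u in 𝓝 0, f i (ψ u) = 0 := by
          simpa only [not_forall, exists_prop] using hall
        have hev : ∀ᶠ u in 𝓝 (0 : K), AnalyticAt ℂ ψ u ∧ ψ u ∈ V ∧ AnalyticAt ℂ g (ψ u) ∧
            Function.Surjective ((fderiv ℂ g (ψ u)).prod π) ∧ π (ψ u - p) = u ∧
            (∀ᶠ x in 𝓝 (ψ u), x ∈ S → g x = 0) ∧
            ∀ᶠ x in 𝓝 (ψ u), g x = 0 → ψ (π (x - p)) = x := by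
          have hc : Tendsto ψ (𝓝 0) (𝓝 p) := hψ0 ▸ hψ.continuousAt
          filter_upwards [hψ.eventually_analyticAt, hc.eventually (hV.mem_nhds hpV),
            hc.eventually hg.eventually_analyticAt, hc.eventually hπs, hψg,
            hc.eventually hgS.eventually_nhds, hc.eventually hψπ.eventually_nhds]
            with u h1 h2 h3 h4 h5 h6 h7
          exact ⟨h1, h2, h3, h4, h5.2, h6, h7⟩
        obtain ⟨ρ, hρ, hball⟩ := Metric.eventually_nhds_iff_ball.1 hev
        -- The equation `f i` itself may have zero differential along `S`, so it is replaced by a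
        -- function `h` on the parameter space that vanishes on `S` and has nonzero differential at
        -- some `u` with `ψ u ∈ S`. The point moves from `p` to `ψ u`.
        obtain ⟨h, hh, hhT, u, huB, huT, hdu⟩ := exists_fderiv_ne_zero_of_vanishing
          (T := ψ ⁻¹' S) (f := fun u => f i (ψ u))
          (Metric.mem_ball_self (x := (0 : K)) hρ) (by simpa [hψ0] using hpS)
          (fun u hu => AnalyticAt.comp (hf i hi _ (hball u hu).2.1) (hball u hu).1)
          (fun u hu huT => (hS _ (hball u hu).2.1).1 huT i hi) hfi
        obtain ⟨-, k2, k3, k4, k5, k6, k7⟩ := hball u huB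
        have hha : AnalyticAt ℂ h (π (ψ u - p)) := by rw [k5]; exact hh u huB
        have hπa : AnalyticAt ℂ (fun x => π (x - p)) (ψ u) :=
          AnalyticAt.comp (f := fun x => x - p) (π.analyticAt _)
            (analyticAt_id.fun_sub analyticAt_const)
        have hd : HasFDerivAt (fun x => (g x, h (π (x - p))))
            ((fderiv ℂ g (ψ u)).prod ((fderiv ℂ h u).comp π)) (ψ u) := by
          refine k3.differentiableAt.hasFDerivAt.prodMk ?_
          have h1 : HasFDerivAt (fun x => π (x - p)) π (ψ u) :=
            π.hasFDerivAt.comp (ψ u) ((hasFDerivAt_id (ψ u)).sub_const p)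
          have h2 : HasFDerivAt h (fderiv ℂ h u) (π (ψ u - p)) := by
            rw [k5]; exact (hh u huB).differentiableAt.hasFDerivAt
          exact h2.comp (ψ u) h1
        refine ih (G × ℂ) (by rw [Module.finrank_prod, Module.finrank_self]; omega) (ψ u)
          (fun x => (g x, h (π (x - p)))) k2 huT
          (k3.prod (AnalyticAt.comp (f := fun x => π (x - p)) hha hπa)) ?_ ?_
        · rw [hd.fderiv]
          rintro ⟨y, z⟩
          -- Since `(g', π)` is surjective at `ψ u`, the value of `g'` and the component along `v`
          -- can be prescribed independently.
          obtain ⟨v, hv⟩ : ∃ v, fderiv ℂ h u v ≠ 0 := by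
            by_contra! h0
            exact hdu (ContinuousLinearMap.ext h0)
          obtain ⟨x, hx⟩ := k4 (y, (z / fderiv ℂ h u v) • v)
          have h1 : fderiv ℂ g (ψ u) x = y := congrArg Prod.fst hx
          refine ⟨x, Prod.ext h1 ?_⟩
          have h2 : π x = (z / fderiv ℂ h u v) • v := congrArg Prod.snd hx
          change fderiv ℂ h u (π x) = z
          rw [h2, map_smul, smul_eq_mul, div_mul_cancel₀ _ hv]
        · have h1 : ∀ᶠ x in 𝓝 (ψ u), π (x - p) ∈ Metric.ball (0 : K) ρ :=
            hπa.continuousAt.preimage_mem_nhds (by rw [k5]; exact Metric.isOpen_ball.mem_nhds huB)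
          filter_upwards [k6, h1, k7] with x hx1 hx2 hx3 hxS
          have h3 := hx1 hxS
          rw [Prod.mk_eq_zero]
          exact ⟨h3, hhT _ hx2 (by rw [Set.mem_preimage, hx3 h3]; exact hxS)⟩
  -- The induction starts from no equations, that is, from the map to `ℂ^0`.
  refine key (Module.finrank ℂ H + 1) (EuclideanSpace ℂ (Fin 0)) (by simp) a (fun _ => 0) haV haS
    analyticAt_const (fun y => ⟨0, Subsingleton.elim _ _⟩) (Eventually.of_forall fun _ _ => rfl)

end ZeroSets

/-! ## Maps read in charts -/

section Charts

variable {X Y H H' : Type*} [TopologicalSpace X] [TopologicalSpace Y] [TopologicalSpace H]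
  [TopologicalSpace H'] (e : OpenPartialHomeomorph X H) (e' : OpenPartialHomeomorph Y H')
  {T : H → H'} {f : X → Y} {p : X}

theorem continuousAt_of_eventuallyEq_charts (hp : p ∈ e.source) (hTp : T (e p) ∈ e'.target)
    (hf : f =ᶠ[𝓝 p] fun q => e'.symm (T (e q))) (hT : ContinuousAt T (e p)) :
    ContinuousAt f p := by
  have h1 : ContinuousAt (fun q => T (e q)) p :=
    ContinuousAt.comp (f := e) hT (e.continuousAt hp)
  exact (ContinuousAt.comp (f := fun q => T (e q)) (e'.continuousAt_symm hTp) h1).congr hf.symm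

/-- Charts carry neighbourhood filters to neighbourhood filters, so openness of a map follows from
openness of its coordinate expression. -/
theorem nhds_le_map_of_eventuallyEq_charts (hp : p ∈ e.source) (hTp : T (e p) ∈ e'.target)
    (hf : f =ᶠ[𝓝 p] fun q => e'.symm (T (e q))) (hT : IsOpenMap T) : 𝓝 (f p) ≤ map f (𝓝 p) := by
  have h1 : map (fun q => e'.symm (T (e q))) (𝓝 p) = map e'.symm (map T (map e (𝓝 p))) := by
    rw [map_map, map_map]
    rfl
  rw [map_congr hf, hf.self_of_nhds, h1, e.map_nhds_eq hp, ← e'.symm.map_nhds_eq hTp]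
  exact map_mono (hT.nhds_le _)

end Charts

/-! ## Jets in coordinates -/

section JetCoordinates

variable {E : Type*} [NormedAddCommGroup E] [NormedSpace ℂ E] [CompleteSpace E]
  {M : Type*} [TopologicalSpace M] [ChartedSpace E M] [IsManifold 𝓘(ℂ, E) ω M]

/-- The chart of `J^k(M)` induced by the chart of `M` around `x`, as a homeomorphism. -/
noncomputable def jetHomeo (k : ℕ) (x : M) : OpenPartialHomeomorph (Jet E M k) (Fin (k + 1) → E) :=
  (jetCore E M k).openPartialHomeomorph (jetChart k x) ⟨x, rfl⟩

theorem jetHomeo_apply {k : ℕ} (x : M) (j : Jet E M k) : jetHomeo k x j = Jet.coord x j := rfl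

theorem mem_jetHomeo_source {k : ℕ} {x : M} {j : Jet E M k} :
    j ∈ (jetHomeo k x).source ↔ j.base ∈ (chartAt E x).source := Iff.rfl

theorem jetHomeo_mem_maximalAtlas (k : ℕ) (x : M) :
    jetHomeo k x ∈ IsManifold.maximalAtlas 𝓘(ℂ, Fin (k + 1) → E) ω (Jet E M k) := by
  refine IsManifold.subset_maximalAtlas ?_
  exact Set.mem_iUnion₂.2 ⟨jetChart k x, ⟨x, rfl⟩, rfl⟩

theorem mem_jetHomeo_source_base {k : ℕ} (j : Jet E M k) : j ∈ (jetHomeo k j.base).source :=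
  mem_chart_source E j.base

theorem Jet.base_truncate {l k : ℕ} (h : l ≤ k) (j : Jet E M k) :
    (Jet.truncate h j).base = j.base := by
  obtain ⟨γ, rfl⟩ := j.exists_mk
  rfl

theorem Jet.truncate_mk {l k : ℕ} (h : l ≤ k) (γ : HolCurve E M) :
    Jet.truncate h (Jet.mk k γ) = Jet.mk l γ := rfl

theorem Jet.truncate_truncate {l r k : ℕ} (hlr : l ≤ r) (hrk : r ≤ k) (j : Jet E M k) :
    Jet.truncate hlr (Jet.truncate hrk j) = Jet.truncate (hlr.trans hrk) j := by
  obtain ⟨γ, rfl⟩ := j.exists_mk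
  rfl

theorem taylorCoeff_zero_index (f : ℂ → E) : taylorCoeff f 0 = f 0 := by simp [taylorCoeff]

theorem Jet.coord_zero {k : ℕ} {x : M} {j : Jet E M k} (hj : j.base ∈ (chartAt E x).source) :
    Jet.coord x j 0 = chartAt E x j.base := by
  obtain ⟨γ, rfl⟩ := j.exists_mk
  rw [Jet.coord_mk x γ hj]
  exact taylorCoeff_zero_index _

/-- Forgetting the Taylor coefficients of order greater than `l`. -/
def truncateCoeffs {l k : ℕ} (h : l ≤ k) : (Fin (k + 1) → E) →L[ℂ] (Fin (l + 1) → E) :=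
  ContinuousLinearMap.pi fun i => ContinuousLinearMap.proj (Fin.castLE (Nat.succ_le_succ h) i)

theorem truncateCoeffs_apply {l k : ℕ} (h : l ≤ k) (a : Fin (k + 1) → E) (i : Fin (l + 1)) :
    truncateCoeffs h a i = a (Fin.castLE (Nat.succ_le_succ h) i) := rfl

/-- Replacing the Taylor coefficients of order at most `l` of `c` by those of `a`. -/
def extendCoeffs {l r : ℕ} (a : Fin (l + 1) → E) (c : Fin (r + 1) → E) : Fin (r + 1) → E :=
  fun i => if h : (i : ℕ) < l + 1 then a ⟨i, h⟩ else c i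

theorem truncateCoeffs_extendCoeffs {l r : ℕ} (h : l ≤ r) (a : Fin (l + 1) → E)
    (c : Fin (r + 1) → E) : truncateCoeffs h (extendCoeffs a c) = a := by
  funext i
  rw [truncateCoeffs_apply, extendCoeffs, dif_pos (by simpa using i.is_le)]
  rfl

theorem extendCoeffs_truncateCoeffs {l r : ℕ} (h : l ≤ r) (c : Fin (r + 1) → E) :
    extendCoeffs (truncateCoeffs h c) c = c := by
  funext i
  rw [extendCoeffs]
  split_ifs with hi
  · rfl
  · rfl

theorem extendCoeffs_zero {l r : ℕ} (a : Fin (l + 1) → E) (c : Fin (r + 1) → E) :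
    extendCoeffs a c 0 = a 0 := by
  rw [extendCoeffs, dif_pos (by simp)]
  rfl

theorem analyticAt_extendCoeffs {l r : ℕ} {H : Type*} [NormedAddCommGroup H] [NormedSpace ℂ H]
    {a : H → Fin (l + 1) → E} {c : H → Fin (r + 1) → E} {u : H} (ha : AnalyticAt ℂ a u)
    (hc : AnalyticAt ℂ c u) : AnalyticAt ℂ (fun v => extendCoeffs (a v) (c v)) u := by
  rw [analyticAt_pi_iff]
  intro i
  simp only [extendCoeffs]
  split_ifs with h
  · exact analyticAt_pi_iff.1 ha _
  · exact analyticAt_pi_iff.1 hc _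

theorem Jet.coord_truncate {l k : ℕ} (h : l ≤ k) {x : M} {j : Jet E M k}
    (hj : j.base ∈ (chartAt E x).source) :
    Jet.coord x (Jet.truncate h j) = truncateCoeffs h (Jet.coord x j) := by
  obtain ⟨γ, rfl⟩ := j.exists_mk
  funext i
  rw [Jet.truncate_mk, Jet.coord_mk x γ hj, truncateCoeffs_apply, Jet.coord_mk x γ hj]
  rfl

theorem Jet.truncate_eq {l k : ℕ} (h : l ≤ k) {x : M} {j : Jet E M k}
    (hj : j.base ∈ (chartAt E x).source) :
    Jet.truncate h j = (jetHomeo l x).symm (truncateCoeffs h (jetHomeo k x j)) := by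
  rw [jetHomeo_apply, ← Jet.coord_truncate h hj, ← jetHomeo_apply, (jetHomeo l x).left_inv]
  rw [mem_jetHomeo_source, Jet.base_truncate]
  exact hj

theorem Jet.truncate_symm {l k : ℕ} (h : l ≤ k) {x : M} {a : Fin (k + 1) → E}
    (ha : a 0 ∈ (chartAt E x).target) :
    Jet.truncate h ((jetHomeo k x).symm a) = (jetHomeo l x).symm (truncateCoeffs h a) := by
  have ha' : a ∈ (jetHomeo k x).target := ha
  rw [Jet.truncate_eq h ((jetHomeo k x).map_target ha'), (jetHomeo k x).right_inv ha']

theorem Jet.truncate_eventuallyEq {l k : ℕ} (h : l ≤ k) {x : M} {j : Jet E M k}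
    (hj : j.base ∈ (chartAt E x).source) :
    Jet.truncate h =ᶠ[𝓝 j] fun j => (jetHomeo l x).symm (truncateCoeffs h (jetHomeo k x j)) := by
  filter_upwards [(jetHomeo k x).open_source.mem_nhds (mem_jetHomeo_source.2 hj)] with j' hj'
    using Jet.truncate_eq h hj'

theorem truncateCoeffs_mem_target {l k : ℕ} (h : l ≤ k) {x : M} {j : Jet E M k}
    (hj : j.base ∈ (chartAt E x).source) :
    truncateCoeffs h (jetHomeo k x j) ∈ (jetHomeo l x).target := by
  rw [jetHomeo_apply, ← Jet.coord_truncate h hj, ← jetHomeo_apply]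
  refine (jetHomeo l x).map_source ?_
  rw [mem_jetHomeo_source, Jet.base_truncate]
  exact hj

theorem Jet.continuous_truncate {l k : ℕ} (h : l ≤ k) :
    Continuous (Jet.truncate h : Jet E M k → Jet E M l) := by
  rw [continuous_iff_continuousAt]
  intro j
  have hj := mem_jetHomeo_source_base j
  exact continuousAt_of_eventuallyEq_charts _ _ hj (truncateCoeffs_mem_target h hj)
    (Jet.truncate_eventuallyEq h hj) (truncateCoeffs h).continuous.continuousAt

theorem truncateCoeffs_surjective {l k : ℕ} (h : l ≤ k) :
    Function.Surjective (truncateCoeffs h : (Fin (k + 1) → E) →L[ℂ] (Fin (l + 1) → E)) :=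
  fun a => ⟨extendCoeffs a 0, truncateCoeffs_extendCoeffs h a 0⟩

theorem isOpenMap_truncateCoeffs {l k : ℕ} (h : l ≤ k) :
    IsOpenMap (truncateCoeffs h : (Fin (k + 1) → E) →L[ℂ] (Fin (l + 1) → E)) :=
  (truncateCoeffs h : (Fin (k + 1) → E) →L[ℂ] (Fin (l + 1) → E)).isOpenMap
    (truncateCoeffs_surjective h)

/-- In coordinates truncation is a surjective linear projection. Openness is what allows closures to
be pulled back along truncation, both for density over `A` and for density of `W^k`. -/
theorem Jet.isOpenMap_truncate {l k : ℕ} (h : l ≤ k) :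
    IsOpenMap (Jet.truncate h : Jet E M k → Jet E M l) := by
  rw [isOpenMap_iff_nhds_le]
  intro j
  have hj := mem_jetHomeo_source_base j
  exact nhds_le_map_of_eventuallyEq_charts _ _ hj (truncateCoeffs_mem_target h hj)
    (Jet.truncate_eventuallyEq h hj)
    (isOpenMap_truncateCoeffs h)

/-- The holomorphic germ given by an analytic curve in a chart. -/
def HolCurve.ofChart (x : M) (g : ℂ → E) (hg : AnalyticAt ℂ g 0)
    (h0 : g 0 ∈ (chartAt E x).target) : HolCurve E M where
  toFun := fun t => (chartAt E x).symm (g t)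
  holo := (contMDiffAt_symm_of_mem_maximalAtlas (IsManifold.chart_mem_maximalAtlas x) h0).comp 0
    hg.contDiffAt.contMDiffAt

theorem HolCurve.eventually_mem_source (γ : HolCurve E M) {x : M}
    (hx : γ.toFun 0 ∈ (chartAt E x).source) : ∀ᶠ t in 𝓝 0, γ.toFun t ∈ (chartAt E x).source :=
  γ.holo.continuousAt.preimage_mem_nhds ((chartAt E x).open_source.mem_nhds hx)

theorem HolCurve.chart_ofChart (x : M) {g : ℂ → E} (hg : AnalyticAt ℂ g 0)
    (h0 : g 0 ∈ (chartAt E x).target) :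
    ∀ᶠ t in 𝓝 0, chartAt E x ((HolCurve.ofChart x g hg h0).toFun t) = g t := by
  filter_upwards [hg.continuousAt.preimage_mem_nhds ((chartAt E x).open_target.mem_nhds h0)]
    with t ht using (chartAt E x).right_inv ht

theorem Jet.mk_eq_of_isBigO {k : ℕ} {γ δ : HolCurve E M} {x : M}
    (hx : γ.toFun 0 ∈ (chartAt E x).source) (h0 : γ.toFun 0 = δ.toFun 0)
    (h : (fun t => chartAt E x (γ.toFun t) - chartAt E x (δ.toFun t))
      =O[𝓝 0] fun t : ℂ => t ^ (k + 1)) : Jet.mk k γ = Jet.mk k δ :=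
  Quotient.sound (s := jetSetoid E M k) ((HolCurve.sameJet_iff x hx).2 ⟨h0, h⟩)

theorem Jet.isBigO_of_mk_eq {k : ℕ} {γ δ : HolCurve E M} {x : M}
    (hx : γ.toFun 0 ∈ (chartAt E x).source) (h : Jet.mk k γ = Jet.mk k δ) :
    (fun t => chartAt E x (γ.toFun t) - chartAt E x (δ.toFun t))
      =O[𝓝 0] fun t : ℂ => t ^ (k + 1) :=
  ((HolCurve.sameJet_iff x hx).1 (Quotient.exact (s := jetSetoid E M k) h)).2

theorem eventually_chart_chartCurve {k : ℕ} (x : M) {a : Fin (k + 1) → E}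
    (h : a 0 ∈ (chartAt E x).target) :
    ∀ᶠ t in 𝓝 (0 : ℂ), chartAt E x ((chartCurve x a).toFun t) = polyCurve a t := by
  have h1 : ContinuousAt (polyCurve a) 0 :=
    ((contDiff_polyCurve k).continuous.comp (Continuous.prodMk_right a)).continuousAt
  filter_upwards [h1.preimage_mem_nhds ((chartAt E x).open_target.mem_nhds
    (by rwa [polyCurve_zero]))] with t ht
  rw [chartCurve_apply x h, (chartAt E x).right_inv ht]

end JetCoordinates

/-! ## Holomorphic maps in coordinates -/

section Maps

variable {E : Type*} [NormedAddCommGroup E] [NormedSpace ℂ E] [CompleteSpace E]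
  {M : Type*} [TopologicalSpace M] [ChartedSpace E M] [IsManifold 𝓘(ℂ, E) ω M]
  {F : Type*} [NormedAddCommGroup F] [NormedSpace ℂ F] [CompleteSpace F]
  {N : Type*} [TopologicalSpace N] [ChartedSpace F N] [IsManifold 𝓘(ℂ, F) ω N]

variable (E F) in
/-- The map `φ` read in the charts around `x` and `y`. -/
def localRep (φ : M → N) (x : M) (y : N) (v : E) : F := chartAt F y (φ ((chartAt E x).symm v))

variable (E F) in
/-- The domain of definition of `φ` read in the charts around `x` and `y`. -/
def localDomain (φ : M → N) (x : M) (y : N) : Set E :=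
  (chartAt E x).target ∩ (chartAt E x).symm ⁻¹' (φ ⁻¹' (chartAt F y).source)

theorem isOpen_localDomain {φ : M → N} (hφ : Continuous φ) (x : M) (y : N) :
    IsOpen (localDomain E F φ x y) :=
  (chartAt E x).symm.isOpen_inter_preimage ((chartAt F y).open_source.preimage hφ)

theorem chart_mem_localDomain {φ : M → N} {x p : M} {y : N} (hx : p ∈ (chartAt E x).source)
    (hy : φ p ∈ (chartAt F y).source) : chartAt E x p ∈ localDomain E F φ x y := by
  refine ⟨(chartAt E x).map_source hx, ?_⟩
  rw [Set.mem_preimage, (chartAt E x).left_inv hx]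
  exact hy

theorem localRep_chart {φ : M → N} {x p : M} {y : N} (hx : p ∈ (chartAt E x).source) :
    localRep E F φ x y (chartAt E x p) = chartAt F y (φ p) := by
  rw [localRep, (chartAt E x).left_inv hx]

theorem analyticOnNhd_localRep {φ : M → N} (hφ : ContMDiff 𝓘(ℂ, E) 𝓘(ℂ, F) ω φ) (x : M) (y : N) :
    AnalyticOnNhd ℂ (localRep E F φ x y) (localDomain E F φ x y) := by
  rintro v ⟨hv, hv'⟩
  have h1 : ContMDiffAt 𝓘(ℂ, E) 𝓘(ℂ, E) ω (chartAt E x).symm v :=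
    contMDiffAt_symm_of_mem_maximalAtlas (IsManifold.chart_mem_maximalAtlas x) hv
  have h2 : ContMDiffAt 𝓘(ℂ, F) 𝓘(ℂ, F) ω (chartAt F y) (φ ((chartAt E x).symm v)) :=
    contMDiffAt_of_mem_maximalAtlas (IsManifold.chart_mem_maximalAtlas y) hv'
  exact (contMDiffAt_iff_contDiffAt.1 (h2.comp v ((hφ _).comp v h1))).analyticAt

theorem Jet.map_mk {φ : M → N} (hφ : ContMDiff 𝓘(ℂ, E) 𝓘(ℂ, F) ω φ) {k : ℕ} (γ : HolCurve E M) :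
    Jet.map φ hφ k (Jet.mk k γ) = Jet.mk k (γ.map φ hφ) := rfl

theorem Jet.base_map {φ : M → N} (hφ : ContMDiff 𝓘(ℂ, E) 𝓘(ℂ, F) ω φ) {k : ℕ} (j : Jet E M k) :
    (Jet.map φ hφ k j).base = φ j.base := by
  obtain ⟨γ, rfl⟩ := j.exists_mk
  rfl

theorem Jet.truncate_map {φ : M → N} (hφ : ContMDiff 𝓘(ℂ, E) 𝓘(ℂ, F) ω φ) {l k : ℕ} (h : l ≤ k)
    (j : Jet E M k) : Jet.truncate h (Jet.map φ hφ k j) = Jet.map φ hφ l (Jet.truncate h j) := by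
  obtain ⟨γ, rfl⟩ := j.exists_mk
  rfl

/-- The germ may be replaced by its polynomial representative, because the jet of a composite
depends only on the jet. This makes the induced map an explicit analytic function of the
coefficients. -/
theorem Jet.coord_map {φ : M → N} (hφ : ContMDiff 𝓘(ℂ, E) 𝓘(ℂ, F) ω φ) {k : ℕ} {x : M} {y : N}
    {j : Jet E M k} (hx : j.base ∈ (chartAt E x).source) (hy : φ j.base ∈ (chartAt F y).source)
    (i : Fin (k + 1)) :
    Jet.coord y (Jet.map φ hφ k j) i
      = taylorCoeff (fun t => localRep E F φ x y (polyCurve (Jet.coord x j) t)) i := by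
  have h0 : Jet.coord x j 0 ∈ (chartAt E x).target := by
    rw [Jet.coord_zero hx]
    exact (chartAt E x).map_source hx
  have hj : Jet.mk k (chartCurve x (Jet.coord x j)) = j := (jetHomeo k x).left_inv hx
  have hb : (chartCurve x (Jet.coord x j)).toFun 0 = j.base := congrArg Jet.base hj
  conv_lhs => rw [← hj]
  rw [Jet.map_mk, Jet.coord_mk]
  · simp only [HolCurve.map, chartCurve_apply x h0]
    rfl
  · simp only [HolCurve.map, hb]
    exact hy

theorem Jet.continuous_map {φ : M → N} (hφ : ContMDiff 𝓘(ℂ, E) 𝓘(ℂ, F) ω φ) (k : ℕ) :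
    Continuous (Jet.map φ hφ k) := by
  rw [continuous_iff_continuousAt]
  intro j
  set x := j.base with hx
  set y := φ x with hy
  have hjx : j.base ∈ (chartAt E x).source := mem_chart_source E x
  have hjy : φ j.base ∈ (chartAt F y).source := mem_chart_source F y
  set Φ : (Fin (k + 1) → E) → Fin (k + 1) → F := fun a i =>
    taylorCoeff (fun t => localRep E F φ x y (polyCurve a t)) i with hΦ
  have hΦa : AnalyticAt ℂ Φ (Jet.coord x j) := by
    rw [analyticAt_pi_iff]
    intro i
    have hU : IsOpen ((fun p : (Fin (k + 1) → E) × ℂ => polyCurve p.1 p.2) ⁻¹'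
        localDomain E F φ x y) :=
      (isOpen_localDomain hφ.continuous x y).preimage (contDiff_polyCurve k).continuous
    refine analyticOnNhd_taylorCoeff (G := fun p : (Fin (k + 1) → E) × ℂ =>
      localRep E F φ x y (polyCurve p.1 p.2)) hU (fun p hp => ?_) i (Jet.coord x j) ?_
    · exact AnalyticAt.comp (f := fun p : (Fin (k + 1) → E) × ℂ => polyCurve p.1 p.2)
        (analyticOnNhd_localRep hφ x y _ hp) (contDiff_polyCurve k).contDiffAt.analyticAt
    · change polyCurve (Jet.coord x j) 0 ∈ localDomain E F φ x y
      rw [polyCurve_zero, Jet.coord_zero hjx]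
      exact chart_mem_localDomain (E := E) (F := F) hjx hjy
  have hev : Jet.map φ hφ k =ᶠ[𝓝 j] fun j' => (jetHomeo k y).symm (Φ (jetHomeo k x j')) := by
    have h1 : ContinuousOn (fun j' : Jet E M k => j'.base) (jetHomeo k x).source := by
      have h2 : ContinuousOn (fun j' : Jet E M k => (chartAt E x).symm (jetHomeo k x j' 0))
          (jetHomeo k x).source :=
        (chartAt E x).continuousOn_symm.comp
          ((continuous_apply 0).comp_continuousOn (jetHomeo k x).continuousOn)
          fun j' hj' => (jetHomeo k x).map_source hj'
      refine h2.congr fun j' hj' => ?_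
      change j'.base = (chartAt E x).symm (Jet.coord x j' 0)
      rw [Jet.coord_zero hj', (chartAt E x).left_inv hj']
    have h3 : ContinuousAt (fun j' : Jet E M k => j'.base) j :=
      h1.continuousAt ((jetHomeo k x).open_source.mem_nhds hjx)
    filter_upwards [(jetHomeo k x).open_source.mem_nhds hjx,
      (hφ.continuous.continuousAt.comp h3).preimage_mem_nhds
        ((chartAt F y).open_source.mem_nhds hjy)] with j' h4 h5
    rw [← (jetHomeo k y).left_inv (x := Jet.map φ hφ k j')
      (by rw [mem_jetHomeo_source, Jet.base_map]; exact h5)]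
    congr 1
    funext i
    exact Jet.coord_map hφ h4 h5 i
  refine continuousAt_of_eventuallyEq_charts (jetHomeo k x) (jetHomeo k y) hjx ?_ hev
    hΦa.continuousAt
  have h1 : Φ (jetHomeo k x j) = jetHomeo k y (Jet.map φ hφ k j) := by
    funext i
    exact (Jet.coord_map hφ hjx hjy i).symm
  rw [h1]
  refine (jetHomeo k y).map_source ?_
  rw [mem_jetHomeo_source, Jet.base_map]
  exact hjy

end Maps

/-! ## The order of the Jacobian along germs in manifolds -/

section JacobianOrder

variable {E : Type*} [NormedAddCommGroup E] [NormedSpace ℂ E] [CompleteSpace E]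
  {M : Type*} [TopologicalSpace M] [ChartedSpace E M] [IsManifold 𝓘(ℂ, E) ω M]
  {F : Type*} [NormedAddCommGroup F] [NormedSpace ℂ F] [CompleteSpace F] [FiniteDimensional ℂ F]
  {N : Type*} [TopologicalSpace N] [ChartedSpace F N] [IsManifold 𝓘(ℂ, F) ω N]

variable (F) in
/-- The Jacobian of `φ` vanishes to order at most `e` along the germ `γ`. -/
def HolCurve.JacobianOrderLE (φ : M → N) (e : ℕ) (γ : HolCurve E M) : Prop :=
  _root_.JacobianOrderLE (localRep E F φ (γ.toFun 0) (φ (γ.toFun 0))) e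
    fun t => chartAt E (γ.toFun 0) (γ.toFun t)

theorem jacobianOrderLE_congr_right {f : E → F} {g g' : ℂ → E} {e : ℕ}
    (hg : g =ᶠ[𝓝 0] g') (h : JacobianOrderLE f e g) : JacobianOrderLE f e g' := by
  obtain ⟨L, hL, hn⟩ := h
  refine ⟨L, hL, fun hO => hn (hO.congr' ?_ EventuallyEq.rfl)⟩
  filter_upwards [hg] with t ht
  rw [ht]

/-- The order of the Jacobian along a germ can be compared in any two pairs of charts. -/
theorem HolCurve.jacobianOrderLE_change {φ : M → N} (hφ : ContMDiff 𝓘(ℂ, E) 𝓘(ℂ, F) ω φ) {e : ℕ}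
    (γ : HolCurve E M) {x x' : M} {y y' : N} (hx : γ.toFun 0 ∈ (chartAt E x).source)
    (hx' : γ.toFun 0 ∈ (chartAt E x').source) (hy : φ (γ.toFun 0) ∈ (chartAt F y).source)
    (hy' : φ (γ.toFun 0) ∈ (chartAt F y').source)
    (h : _root_.JacobianOrderLE (localRep E F φ x y) e fun t => chartAt E x (γ.toFun t)) :
    _root_.JacobianOrderLE (localRep E F φ x' y') e fun t => chartAt E x' (γ.toFun t) := by
  set p := γ.toFun 0 with hp
  have hT : AnalyticAt ℂ (fun v => chartAt E x' ((chartAt E x).symm v)) (chartAt E x p) :=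
    analyticAt_transition x x' ((chartAt E x).map_source hx)
      (by rw [(chartAt E x).left_inv hx]; exact hx')
  have hf' : AnalyticAt ℂ (localRep E F φ x' y') (chartAt E x' ((chartAt E x).symm (chartAt E x p)))
      := by
    rw [(chartAt E x).left_inv hx]
    exact analyticOnNhd_localRep hφ x' y' _ (chart_mem_localDomain hx' hy')
  have hfp : localRep E F φ x' y' (chartAt E x' ((chartAt E x).symm (chartAt E x p)))
      = chartAt F y' (φ p) := by
    rw [(chartAt E x).left_inv hx, localRep_chart hx']
  have hS : AnalyticAt ℂ (fun v => chartAt F y ((chartAt F y').symm v))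
      (localRep E F φ x' y' (chartAt E x' ((chartAt E x).symm (chartAt E x p)))) := by
    rw [hfp]
    exact analyticAt_transition y' y ((chartAt F y').map_source hy')
      (by rw [(chartAt F y').left_inv hy']; exact hy)
  -- Here `T` and `S` are the coordinate changes in the source and in the target.
  have h1 := JacobianOrderLE.of_comp (g := fun t => chartAt E x (γ.toFun t))
    (T := fun v => chartAt E x' ((chartAt E x).symm v)) (f' := localRep E F φ x' y')
    (S := fun v => chartAt F y ((chartAt F y').symm v))
    (γ.analyticAt_chart hx) hT hf' hS ?_ h
  · refine jacobianOrderLE_congr_right ?_ h1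
    filter_upwards [γ.eventually_mem_source hx] with t ht
    rw [(chartAt E x).left_inv ht]
  · have e1 : ∀ᶠ v in 𝓝 (chartAt E x p), (chartAt E x).symm v ∈ (chartAt E x').source := by
      refine ((chartAt E x).continuousAt_symm ((chartAt E x).map_source hx)).preimage_mem_nhds ?_
      rw [(chartAt E x).left_inv hx]
      exact (chartAt E x').open_source.mem_nhds hx'
    have e2 : ∀ᶠ v in 𝓝 (chartAt E x p), v ∈ localDomain E F φ x y' :=
      (isOpen_localDomain hφ.continuous x y').mem_nhds (chart_mem_localDomain hx hy')
    filter_upwards [e1, e2] with v h1 h2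
    rw [localRep, localRep, (chartAt E x').left_inv h1, (chartAt F y').left_inv h2.2]

/-- A jet is represented by a germ along which the Jacobian vanishes to order at most `e` if and
only if its polynomial representative in coordinates has this property. -/
theorem Jet.exists_jacobianOrderLE_iff {φ : M → N} (hφ : ContMDiff 𝓘(ℂ, E) 𝓘(ℂ, F) ω φ)
    {e r : ℕ} (her : e ≤ r) {x : M} {y : N} {z : Jet E M r} (hx : z.base ∈ (chartAt E x).source)
    (hy : φ z.base ∈ (chartAt F y).source) :
    (∃ γ, Jet.mk r γ = z ∧ γ.JacobianOrderLE F φ e) ↔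
      JacobianOrderLE (localRep E F φ x y) e (polyCurve (jetHomeo r x z)) := by
  have hz : jetHomeo r x z 0 ∈ (chartAt E x).target := (jetHomeo r x).map_source hx
  have hc : Jet.mk r (chartCurve x (jetHomeo r x z)) = z := (jetHomeo r x).left_inv hx
  have hcb : (chartCurve x (jetHomeo r x z)).toFun 0 = z.base := congrArg Jet.base hc
  have hev := eventually_chart_chartCurve x hz
  constructor
  · rintro ⟨γ, rfl, hγ⟩
    have h1 := γ.jacobianOrderLE_change hφ (mem_chart_source E _) hx (mem_chart_source F _) hy hγ
    have hO := Jet.isBigO_of_mk_eq (x := x) hx hc.symm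
    have h0 : chartAt E x (γ.toFun 0)
        = chartAt E x ((chartCurve x (jetHomeo r x (Jet.mk r γ))).toFun 0) :=
      congrArg (chartAt E x) hcb.symm
    refine jacobianOrderLE_congr_right hev ?_
    -- The germ and its polynomial representative agree to order `r ≥ e`, which is enough to
    -- preserve the bound.
    exact h1.congr her (analyticOnNhd_localRep hφ x y _ (chart_mem_localDomain hx hy))
      (γ.analyticAt_chart hx).continuousAt
      ((chartCurve x _).analyticAt_chart (hcb.symm ▸ hx)).continuousAt h0 hO
  · intro h
    refine ⟨_, hc, ?_⟩
    refine HolCurve.jacobianOrderLE_change hφ _ (x := x) (y := y) (hcb.symm ▸ hx)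
      (mem_chart_source E _) (hcb.symm ▸ hy) (mem_chart_source F _) ?_
    exact jacobianOrderLE_congr_right (EventuallyEq.symm hev) h

/-- Lifting of jets: above the image of a jet along which the Jacobian vanishes to a low order, all
jets lift. -/
theorem Jet.exists_lift {φ : M → N} (hφ : ContMDiff 𝓘(ℂ, E) 𝓘(ℂ, F) ω φ) {e l r k : ℕ}
    (her : 2 * e ≤ r) (hlr : l + e ≤ r) (hrk : r ≤ k) {γ : HolCurve E M}
    (hγ : γ.JacobianOrderLE F φ e) {w : Jet F N k}
    (hw : Jet.truncate hrk w = Jet.map φ hφ r (Jet.mk r γ)) :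
    ∃ z : Jet E M k, Jet.truncate (((Nat.le_add_right l e).trans hlr).trans hrk) z = Jet.mk l γ ∧
      Jet.map φ hφ k z = w := by
  obtain ⟨δ, rfl⟩ := w.exists_mk
  set p := γ.toFun 0 with hp
  have hpx : γ.toFun 0 ∈ (chartAt E p).source := mem_chart_source E p
  have hpy : φ (γ.toFun 0) ∈ (chartAt F (φ p)).source := mem_chart_source F _
  have hδ0 : φ p = δ.toFun 0 := (congrArg Jet.base hw).symm
  have hδy : δ.toFun 0 ∈ (chartAt F (φ p)).source := hδ0 ▸ hpy
  have hw' : Jet.mk r (γ.map φ hφ) = Jet.mk r δ := hw.symm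
  have hO := Jet.isBigO_of_mk_eq (x := φ p) hpy hw'
  have hf := analyticOnNhd_localRep hφ p (φ p) _ (chart_mem_localDomain hpx hpy)
  have hO' : (fun t => localRep E F φ p (φ p) (chartAt E p (γ.toFun t))
      - chartAt F (φ p) (δ.toFun t)) =O[𝓝 0] fun t : ℂ => t ^ (r + 1) := by
    refine hO.congr' ?_ EventuallyEq.rfl
    filter_upwards [γ.eventually_mem_source hpx] with t ht
    rw [localRep_chart ht]
    rfl
  obtain ⟨g, hg, hg0, -, hgγ, hgδ⟩ := JacobianOrderLE.exists_lift hf (γ.analyticAt_chart hpx)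
    (δ.analyticAt_chart hδy) hγ her hO' hrk
  have hgt : g 0 ∈ (chartAt E p).target := by
    rw [hg0]
    exact (chartAt E p).map_source hpx
  have hb : (HolCurve.ofChart p g hg hgt).toFun 0 = p := by
    change (chartAt E p).symm (g 0) = p
    rw [hg0, (chartAt E p).left_inv hpx]
  have hev := HolCurve.chart_ofChart p hg hgt
  refine ⟨Jet.mk k (HolCurve.ofChart p g hg hgt), ?_, ?_⟩
  · rw [Jet.truncate_mk]
    refine Jet.mk_eq_of_isBigO (x := p) (by rw [hb]; exact hpx) hb ?_
    -- Newton's method moved the curve by `O(t ^ (r - e + 1))` and `l ≤ r - e`, so the `l`-jet is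
    -- unchanged.
    refine (hgγ.trans (isBigO_pow_of_le (by omega))).congr' ?_ EventuallyEq.rfl
    filter_upwards [hev] with t ht
    rw [ht]
  · rw [Jet.map_mk]
    have h0 : ((HolCurve.ofChart p g hg hgt).map φ hφ).toFun 0 = φ p := congrArg φ hb
    refine Jet.mk_eq_of_isBigO (x := φ p) (by rw [h0]; exact hpy) (h0.trans hδ0) ?_
    exact hgδ

end JacobianOrder

/-! ## Derivatives in charts -/

section Derivatives

variable {E : Type*} [NormedAddCommGroup E] [NormedSpace ℂ E] [CompleteSpace E]
  {M : Type*} [TopologicalSpace M] [ChartedSpace E M] [IsManifold 𝓘(ℂ, E) ω M]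
  {F : Type*} [NormedAddCommGroup F] [NormedSpace ℂ F] [CompleteSpace F]
  {N : Type*} [TopologicalSpace N] [ChartedSpace F N] [IsManifold 𝓘(ℂ, F) ω N]

theorem mdifferentiable_of_mem_maximalAtlas_omega {e : OpenPartialHomeomorph M E}
    (he : e ∈ IsManifold.maximalAtlas 𝓘(ℂ, E) ω M) : e.MDifferentiable 𝓘(ℂ, E) 𝓘(ℂ, E) :=
  ⟨(contMDiffOn_of_mem_maximalAtlas he).mdifferentiableOn (by simp),
    (contMDiffOn_symm_of_mem_maximalAtlas he).mdifferentiableOn (by simp)⟩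

/-- The differential of a map into a manifold, read in a chart of the target. -/
theorem fderiv_chart_comp {e : OpenPartialHomeomorph N F}
    (he : e ∈ IsManifold.maximalAtlas 𝓘(ℂ, F) ω N) {f : E → N} {u : E}
    (hf : MDifferentiableAt 𝓘(ℂ, E) 𝓘(ℂ, F) f u) (hu : f u ∈ e.source) :
    fderiv ℂ (fun v => e (f v)) u
      = (mfderiv 𝓘(ℂ, F) 𝓘(ℂ, F) e (f u)).comp (mfderiv 𝓘(ℂ, E) 𝓘(ℂ, F) f u) := by
  rw [← mfderiv_eq_fderiv]
  exact mfderiv_comp u ((mdifferentiable_of_mem_maximalAtlas_omega he).mdifferentiableAt hu) hf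

theorem injective_fderiv_chart_comp_iff {e : OpenPartialHomeomorph N F}
    (he : e ∈ IsManifold.maximalAtlas 𝓘(ℂ, F) ω N) {f : E → N} {u : E}
    (hf : MDifferentiableAt 𝓘(ℂ, E) 𝓘(ℂ, F) f u) (hu : f u ∈ e.source) :
    Function.Injective (fderiv ℂ (fun v => e (f v)) u) ↔
      Function.Injective (mfderiv 𝓘(ℂ, E) 𝓘(ℂ, F) f u) := by
  have hb := (mdifferentiable_of_mem_maximalAtlas_omega he).mfderiv_injective hu
  rw [fderiv_chart_comp he hf hu]
  exact hb.of_comp_iff (mfderiv 𝓘(ℂ, E) 𝓘(ℂ, F) f u)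

/-- The differential of a function on a manifold, read in a chart of the source. -/
theorem fderiv_comp_chart_symm {e : OpenPartialHomeomorph M E}
    (he : e ∈ IsManifold.maximalAtlas 𝓘(ℂ, E) ω M) {f : M → F} {p : M} (hp : p ∈ e.source)
    (hf : MDifferentiableAt 𝓘(ℂ, E) 𝓘(ℂ, F) f p) :
    fderiv ℂ (fun v => f (e.symm v)) (e p)
      = (mfderiv 𝓘(ℂ, E) 𝓘(ℂ, F) f p).comp (mfderiv 𝓘(ℂ, E) 𝓘(ℂ, E) e.symm (e p)) := by
  have h1 := (mdifferentiable_of_mem_maximalAtlas_omega he).mdifferentiableAt_symm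
    (e.map_source hp)
  have h2 : e.symm (e p) = p := e.left_inv hp
  have h3 : MDifferentiableAt 𝓘(ℂ, E) 𝓘(ℂ, F) f (e.symm (e p)) := by rwa [h2]
  have h4 := mfderiv_comp (e p) h3 h1
  rw [← mfderiv_eq_fderiv]
  refine h4.trans ?_
  rw [h2]

theorem surjective_fderiv_comp_chart_symm_iff {e : OpenPartialHomeomorph M E}
    (he : e ∈ IsManifold.maximalAtlas 𝓘(ℂ, E) ω M) {f : M → F} {p : M} (hp : p ∈ e.source)
    (hf : MDifferentiableAt 𝓘(ℂ, E) 𝓘(ℂ, F) f p) :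
    Function.Surjective (fderiv ℂ (fun v => f (e.symm v)) (e p)) ↔
      Function.Surjective (mfderiv 𝓘(ℂ, E) 𝓘(ℂ, F) f p) := by
  have hb := (mdifferentiable_of_mem_maximalAtlas_omega he).symm.mfderiv_surjective
    (e.map_source hp)
  rw [fderiv_comp_chart_symm he hp hf]
  exact Function.Surjective.of_comp_iff (mfderiv 𝓘(ℂ, E) 𝓘(ℂ, F) f p) hb

theorem surjective_fderiv_localRep_iff {φ : M → N} (hφ : ContMDiff 𝓘(ℂ, E) 𝓘(ℂ, F) ω φ)
    {x p : M} {y : N} (hx : p ∈ (chartAt E x).source) (hy : φ p ∈ (chartAt F y).source) :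
    Function.Surjective (fderiv ℂ (localRep E F φ x y) (chartAt E x p)) ↔
      Function.Surjective (mfderiv 𝓘(ℂ, E) 𝓘(ℂ, F) φ p) := by
  have hc : MDifferentiableAt 𝓘(ℂ, F) 𝓘(ℂ, F) (chartAt F y) (φ p) :=
    (mdifferentiable_of_mem_maximalAtlas_omega
      (IsManifold.chart_mem_maximalAtlas y)).mdifferentiableAt hy
  have hφp : MDifferentiableAt 𝓘(ℂ, E) 𝓘(ℂ, F) φ p := (hφ p).mdifferentiableAt (by simp)
  have h1 : MDifferentiableAt 𝓘(ℂ, E) 𝓘(ℂ, F) (fun q => chartAt F y (φ q)) p := hc.comp p hφp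
  have h2 := surjective_fderiv_comp_chart_symm_iff (IsManifold.chart_mem_maximalAtlas x) hx h1
  have h3 : mfderiv 𝓘(ℂ, E) 𝓘(ℂ, F) (fun q => chartAt F y (φ q)) p
      = (mfderiv 𝓘(ℂ, F) 𝓘(ℂ, F) (chartAt F y) (φ p)).comp (mfderiv 𝓘(ℂ, E) 𝓘(ℂ, F) φ p) :=
    mfderiv_comp p hc hφp
  have hb := (mdifferentiable_of_mem_maximalAtlas_omega
      (IsManifold.chart_mem_maximalAtlas y)).mfderiv_bijective (I := 𝓘(ℂ, F)) (I' := 𝓘(ℂ, F)) hy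
  refine h2.trans ?_
  rw [h3]
  exact Function.Surjective.of_comp_iff' hb (mfderiv 𝓘(ℂ, E) 𝓘(ℂ, F) φ p)

/-- A non-degenerate holomorphic map is submersive at points arbitrarily close to any given
point. -/
theorem IsNondegenerate.frequently_surjective [FiniteDimensional ℂ F] {φ : M → N}
    (hφ : ContMDiff 𝓘(ℂ, E) 𝓘(ℂ, F) ω φ) (hnd : IsNondegenerate E F φ) (x : M) :
    ∃ᶠ p in 𝓝 x, Function.Surjective (mfderiv 𝓘(ℂ, E) 𝓘(ℂ, F) φ p) := by
  -- The set `O` where `φ` is nowhere submersive nearby is open by definition. Once it is shown to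
  -- be closed, it contains the whole component of each of its points, which contradicts
  -- non-degeneracy.
  set O : Set M := {x | ∀ᶠ p in 𝓝 x, ¬ Function.Surjective (mfderiv 𝓘(ℂ, E) 𝓘(ℂ, F) φ p)} with hO
  have hOs : ∀ q ∈ O, ¬ Function.Surjective (mfderiv 𝓘(ℂ, E) 𝓘(ℂ, F) φ q) := fun q hq =>
    mem_of_mem_nhds (s := {p | ¬ Function.Surjective (mfderiv 𝓘(ℂ, E) 𝓘(ℂ, F) φ p)}) hq
  have hopen : IsOpen O := isOpen_iff_mem_nhds.2 fun x hx => Eventually.eventually_nhds hx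
  have hclosed : IsClosed O := by
    refine isClosed_of_closure_subset fun x hx => ?_
    have hxx : x ∈ (chartAt E x).source := mem_chart_source E x
    have hdom := (isOpen_localDomain hφ.continuous x (φ x)).mem_nhds
      (chart_mem_localDomain hxx (mem_chart_source F (φ x)))
    obtain ⟨ρ, hρ, hball⟩ := Metric.mem_nhds_iff.1 hdom
    have hnb : (chartAt E x).source ∩ chartAt E x ⁻¹' Metric.ball (chartAt E x x) ρ ∈ 𝓝 x :=
      inter_mem ((chartAt E x).open_source.mem_nhds hxx)
        (((chartAt E x).continuousAt hxx).preimage_mem_nhds (Metric.ball_mem_nhds _ hρ))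
    have hnot : ∀ v ∈ Metric.ball (chartAt E x x) ρ,
        ¬ Function.Surjective (fderiv ℂ (localRep E F φ x (φ x)) v) := by
      intro v hv hvs
      obtain ⟨x', hx', hx'O⟩ := mem_closure_iff_nhds.1 hx _ hnb
      obtain ⟨L₀, hL₀⟩ :=
        (fderiv ℂ (localRep E F φ x (φ x)) v : E →ₗ[ℂ] F).exists_rightInverse_of_surjective
          (LinearMap.range_eq_top.2 hvs)
      set L : F →L[ℂ] E := LinearMap.toContinuousLinearMap L₀ with hL
      -- With `L` a right inverse at a supposed submersive point `v`, the function `Δ` is `1` at `v`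
      -- but vanishes near the chart image of `x' ∈ O`, against the identity theorem on the ball.
      set Δ : E → ℂ := fun v => ((fderiv ℂ (localRep E F φ x (φ x)) v).comp L).det with hΔ
      have hΔa : AnalyticOnNhd ℂ Δ (Metric.ball (chartAt E x x) ρ) := fun v hv => by
        have h1 := (analyticOnNhd_localRep hφ x (φ x) v (hball hv)).fderiv
        exact AnalyticAt.clm_det
          ((h1.contDiffAt (n := ω)).clm_comp contDiffAt_const).analyticAt
      have hΔv : Δ v = 1 := by
        have h1 : ((fderiv ℂ (localRep E F φ x (φ x)) v).comp L : F →ₗ[ℂ] F) = LinearMap.id := hL₀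
        have h2 : Δ v
          = LinearMap.det ((fderiv ℂ (localRep E F φ x (φ x)) v).comp L : F →ₗ[ℂ] F) := rfl
        rw [h2, h1, LinearMap.det_id]
      have hzero : Δ =ᶠ[𝓝 (chartAt E x x')] 0 := by
        have e1 : ∀ᶠ v in 𝓝 (chartAt E x x'), ¬ Function.Surjective
            (mfderiv 𝓘(ℂ, E) 𝓘(ℂ, F) φ ((chartAt E x).symm v)) := by
          have h1 : (chartAt E x).symm ⁻¹' O ∈ 𝓝 (chartAt E x x') := by
            refine ((chartAt E x).continuousAt_symm
              ((chartAt E x).map_source hx'.1)).preimage_mem_nhds ?_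
            rw [(chartAt E x).left_inv hx'.1]
            exact hopen.mem_nhds hx'O
          filter_upwards [h1] with v hv using hOs _ hv
        filter_upwards [e1, Metric.isOpen_ball.mem_nhds hx'.2] with v h1 h2
        by_contra hne
        refine h1 ?_
        have h3 := hball h2
        rw [← surjective_fderiv_localRep_iff hφ ((chartAt E x).map_target h3.1) h3.2,
          (chartAt E x).right_inv h3.1]
        have h5 : Function.Surjective
            ((fderiv ℂ (localRep E F φ x (φ x)) v).comp L : F →ₗ[ℂ] F) :=
          (LinearMap.equivOfDetNeZero _ hne).surjective
        exact Function.Surjective.of_comp h5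
      have h1 := hΔa.eqOn_zero_of_preconnected_of_eventuallyEq_zero
        (convex_ball (chartAt E x x) ρ).isPreconnected hx'.2 hzero hv
      rw [hΔv] at h1
      exact one_ne_zero h1
    change ∀ᶠ p in 𝓝 x, _
    filter_upwards [hnb] with p hp hps
    have h3 := hball hp.2
    refine hnot _ hp.2 ((surjective_fderiv_localRep_iff hφ hp.1 ?_).2 hps)
    have h4 := h3.2
    rwa [Set.mem_preimage, (chartAt E x).left_inv hp.1] at h4
  by_contra hx
  have hxO : x ∈ O := not_frequently.1 hx
  obtain ⟨y, hy, hys⟩ := hnd x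
  have hyO : y ∈ O := IsClopen.connectedComponent_subset ⟨hclosed, hopen⟩ hxO hy
  exact hOs y hyO hys

end Derivatives

/-! ## Regular points -/

section Regular

variable {H : Type*} [NormedAddCommGroup H] [NormedSpace ℂ H] [CompleteSpace H]
  {X : Type*} [TopologicalSpace X] [ChartedSpace H X] [IsManifold 𝓘(ℂ, H) ω X]

theorem isRegularAt_of_mem_regularLocus {Z : Set X} {e : OpenPartialHomeomorph X H}
    (he : e ∈ IsManifold.maximalAtlas 𝓘(ℂ, H) ω X) {p : X} (hp : p ∈ e.source)
    (hreg : p ∈ regularLocus H Z) : IsRegularAt (e.symm ⁻¹' Z) (e p) := by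
  obtain ⟨-, c, U, g, hU, hpU, hg, hs, hZ⟩ := hreg
  have hgp : ContMDiffAt 𝓘(ℂ, H) 𝓘(ℂ, EuclideanSpace ℂ (Fin c)) ω g (e.symm (e p)) := by
    rw [e.left_inv hp]
    exact hg.contMDiffAt (hU.mem_nhds hpU)
  refine ⟨c, fun v => g (e.symm v), ?_, ?_, ?_⟩
  · have h1 := contMDiffAt_symm_of_mem_maximalAtlas he (e.map_source hp)
    exact (contMDiffAt_iff_contDiffAt.1 (hgp.comp (e p) h1)).analyticAt
  · exact (surjective_fderiv_comp_chart_symm_iff he hp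
      ((hg.contMDiffAt (hU.mem_nhds hpU)).mdifferentiableAt (by simp))).2 hs
  · have h1 : e.symm ⁻¹' U ∈ 𝓝 (e p) := by
      refine (e.continuousAt_symm (e.map_source hp)).preimage_mem_nhds ?_
      rw [e.left_inv hp]
      exact hU.mem_nhds hpU
    filter_upwards [h1] with v hv using hZ _ hv

theorem mem_regularLocus_of_isRegularAt {Z : Set X} {e : OpenPartialHomeomorph X H}
    (he : e ∈ IsManifold.maximalAtlas 𝓘(ℂ, H) ω X) {a : H} (ha : a ∈ e.target)
    (haZ : e.symm a ∈ Z) (hreg : IsRegularAt (e.symm ⁻¹' Z) a) : e.symm a ∈ regularLocus H Z := by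
  obtain ⟨c, g, hg, hs, hZ⟩ := hreg
  obtain ⟨V, hV, hVo, haV⟩ := eventually_nhds_iff.1 (hZ.and hg.eventually_analyticAt)
  have hsrc := e.map_target ha
  have hcont : ContMDiffOn 𝓘(ℂ, H) 𝓘(ℂ, EuclideanSpace ℂ (Fin c)) ω (fun q => g (e q))
      (e.source ∩ e ⁻¹' V) := by
    rintro q ⟨hq, hqV⟩
    have h1 : ContMDiffAt 𝓘(ℂ, H) 𝓘(ℂ, H) ω e q := contMDiffAt_of_mem_maximalAtlas he hq
    have h2 : ContMDiffAt 𝓘(ℂ, H) 𝓘(ℂ, EuclideanSpace ℂ (Fin c)) ω g (e q) :=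
      (hV _ hqV).2.contDiffAt.contMDiffAt
    exact (h2.comp q h1).contMDiffWithinAt
  have hopen : IsOpen (e.source ∩ e ⁻¹' V) := e.isOpen_inter_preimage hVo
  have hmem : e.symm a ∈ e.source ∩ e ⁻¹' V :=
    ⟨hsrc, by rw [Set.mem_preimage, e.right_inv ha]; exact haV⟩
  refine ⟨haZ, c, e.source ∩ e ⁻¹' V, fun q => g (e q), hopen, hmem, hcont, ?_, ?_⟩
  · rw [← surjective_fderiv_comp_chart_symm_iff he hsrc
      ((hcont.contMDiffAt (hopen.mem_nhds hmem)).mdifferentiableAt (by simp)), e.right_inv ha]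
    have h1 : (fun v => g (e (e.symm v))) =ᶠ[𝓝 a] g := by
      filter_upwards [e.open_target.mem_nhds ha] with v hv
      rw [e.right_inv hv]
    rw [h1.fderiv_eq]
    exact hs
  · rintro q ⟨hq, hqV⟩
    have h1 := (hV _ hqV).1
    rw [Set.mem_preimage, e.left_inv hq] at h1
    exact h1

end Regular

/-! ### Density of the regular points of algebraic sets -/

section AlgebraicSets

variable {m : ℕ} {M : Type*} [TopologicalSpace M] [ChartedSpace (EuclideanSpace ℂ (Fin m)) M]
  [IsManifold 𝓘(ℂ, EuclideanSpace ℂ (Fin m)) ω M]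

/-- The regular points of an algebraic set are dense in it. -/
theorem IsAlgebraicSet.subset_closure_regularLocus {l : ℕ}
    {A : Set (Jet (EuclideanSpace ℂ (Fin m)) M l)} (hA : IsAlgebraicSet A) :
    A ⊆ closure (regularLocus (Fin (l + 1) → EuclideanSpace ℂ (Fin m)) A) := by
  intro j hj
  rw [mem_closure_iff]
  intro O hO hjO
  set x := j.base with hx
  obtain ⟨U, hU, hxU, hUs, s, hs, hAs⟩ := hA x
  set e := jetHomeo (E := EuclideanSpace ℂ (Fin m)) l x with he
  set c := chartAt (EuclideanSpace ℂ (Fin m)) x with hc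
  have hje : j ∈ e.source := mem_jetHomeo_source_base j
  -- Coordinates of the jets that lie in the given neighbourhood `O` and are based in `U`, where the
  -- equations hold. A regular point found in `V` then proves density.
  set V : Set (Fin (l + 1) → EuclideanSpace ℂ (Fin m)) :=
    (e.target ∩ e.symm ⁻¹' O) ∩ (fun a => a 0) ⁻¹' (c.target ∩ c.symm ⁻¹' U) with hV
  have hVo : IsOpen V := (e.symm.isOpen_inter_preimage hO).inter
    ((c.symm.isOpen_inter_preimage hU).preimage (continuous_apply 0))
  have hbase : ∀ a ∈ V, (e.symm a).base = c.symm (a 0) := by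
    intro a ha
    have h1 : (chartCurve x a).toFun 0 = c.symm (a 0) := by
      rw [chartCurve_apply x ha.2.1, polyCurve_zero]
    exact h1
  -- The equations in coordinates: polynomial in the higher coefficients, with coefficients analytic
  -- in `a 0`. Only their analyticity is used.
  set f : MvPolynomial (Fin l × Fin m) (M → ℂ) → (Fin (l + 1) → EuclideanSpace ℂ (Fin m)) → ℂ :=
    fun P a => P.eval₂ (Pi.evalRingHom (fun _ : M => ℂ) (c.symm (a 0)))
      (fun v => a v.1.succ v.2) with hf
  have hfa : ∀ P ∈ s, AnalyticOnNhd ℂ (f P) V := by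
    intro P hP a ha
    simp only [hf, MvPolynomial.eval₂_eq']
    refine Finset.analyticAt_fun_sum _ fun α _ => AnalyticAt.mul ?_ ?_
    · have h1 : ContMDiffAt 𝓘(ℂ, EuclideanSpace ℂ (Fin m)) 𝓘(ℂ, ℂ) ω (P.coeff α) (c.symm (a 0)) :=
        (hs P hP α).contMDiffAt (hU.mem_nhds ha.2.2)
      have h2 : ContMDiffAt 𝓘(ℂ, EuclideanSpace ℂ (Fin m)) 𝓘(ℂ, EuclideanSpace ℂ (Fin m)) ω
          c.symm (a 0) :=
        contMDiffAt_symm_of_mem_maximalAtlas (IsManifold.chart_mem_maximalAtlas x) ha.2.1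
      have h3 : AnalyticAt ℂ (fun v => P.coeff α (c.symm v)) (a 0) :=
        (contMDiffAt_iff_contDiffAt.1 (h1.comp (a 0) h2)).analyticAt
      exact AnalyticAt.comp (f := fun a : Fin (l + 1) → EuclideanSpace ℂ (Fin m) => a 0) h3
        ((ContinuousLinearMap.proj (R := ℂ)
          (φ := fun _ : Fin (l + 1) => EuclideanSpace ℂ (Fin m)) 0).analyticAt a)
    · refine Finset.analyticAt_fun_prod _ fun v _ => AnalyticAt.fun_pow ?_ _
      exact ((EuclideanSpace.proj v.2 : EuclideanSpace ℂ (Fin m) →L[ℂ] ℂ).comp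
        (ContinuousLinearMap.proj (R := ℂ)
          (φ := fun _ : Fin (l + 1) => EuclideanSpace ℂ (Fin m)) v.1.succ)).analyticAt a
  have hfA : ∀ a ∈ V, a ∈ e.symm ⁻¹' A ↔ ∀ P ∈ s, f P a = 0 := by
    intro a ha
    have hb := hbase a ha
    have h1 := hAs (e.symm a) (by rw [hb]; exact ha.2.2)
    have h2 : Jet.coord x (e.symm a) = a := e.right_inv ha.1.1
    rw [h2, hb] at h1
    exact h1
  have haV : e j ∈ V := by
    have h0 : e j 0 = c x := Jet.coord_zero (x := x) (j := j) (mem_chart_source _ x)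
    refine ⟨⟨e.map_source hje, ?_⟩, ?_, ?_⟩
    · rw [Set.mem_preimage, e.left_inv hje]
      exact hjO
    · change e j 0 ∈ c.target
      rw [h0]
      exact c.map_source (mem_chart_source _ x)
    · change c.symm (e j 0) ∈ U
      rw [h0, c.left_inv (mem_chart_source _ x)]
      exact hxU
  have haA : e j ∈ e.symm ⁻¹' A := by
    rw [Set.mem_preimage, e.left_inv hje]
    exact hj
  obtain ⟨a, ha, haA', hreg⟩ := exists_isRegularAt hVo s f hfa hfA haV haA
  exact ⟨e.symm a, ha.1.2,
    mem_regularLocus_of_isRegularAt (jetHomeo_mem_maximalAtlas l x) ha.1.1 haA' hreg⟩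

end AlgebraicSets

/-! ## Density of the liftable jets -/

section Density

variable {E : Type*} [NormedAddCommGroup E] [NormedSpace ℂ E] [FiniteDimensional ℂ E]
  [CompleteSpace E]
  {M : Type*} [TopologicalSpace M] [ChartedSpace E M] [IsManifold 𝓘(ℂ, E) ω M]
  {F : Type*} [NormedAddCommGroup F] [NormedSpace ℂ F] [CompleteSpace F] [FiniteDimensional ℂ F]
  {N : Type*} [TopologicalSpace N] [ChartedSpace F N] [IsManifold 𝓘(ℂ, F) ω N]

variable (F) in
/-- The `r`-jets over `A` represented by germs along which the Jacobian of `φ` vanishes to order at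
most `e`. -/
def lowOrderJets (φ : M → N) (e : ℕ) {l r : ℕ} (h : l ≤ r) (A : Set (Jet E M l)) :
    Set (Jet E M r) :=
  {z | z ∈ jetsOver h A ∧ ∃ γ, Jet.mk r γ = z ∧ γ.JacobianOrderLE F φ e}

/-- Near a regular point of `A` which is a limit of points that lift to jets of low Jacobian order,
the jets of low Jacobian order are dense in the space of all jets over `A`. -/
theorem eventually_subset_closure_lowOrderJets {φ : M → N} (hφ : ContMDiff 𝓘(ℂ, E) 𝓘(ℂ, F) ω φ)
    {e l r : ℕ} (hlr : l ≤ r) (her : e ≤ r) {A : Set (Jet E M l)} {j : Jet E M l}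
    (hreg : j ∈ regularLocus (Fin (l + 1) → E) A)
    (hj : j ∈ closure (Jet.truncate hlr '' lowOrderJets F φ e hlr A)) :
    ∀ᶠ j' in 𝓝 j, j' ∈ A →
      ∀ z, Jet.truncate hlr z = j' → z ∈ closure (lowOrderJets F φ e hlr A) := by
  set x := j.base with hx
  set y := φ x with hy
  set ε := jetHomeo (E := E) l x with hε
  have hjs : j ∈ ε.source := mem_jetHomeo_source_base j
  obtain ⟨c, g, hg, hgs, hgA⟩ :=
    isRegularAt_of_mem_regularLocus (jetHomeo_mem_maximalAtlas l x) hjs hreg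
  have hjA : ε j ∈ ε.symm ⁻¹' A := by
    rw [Set.mem_preimage, ε.left_inv hjs]
    exact hreg.1
  obtain ⟨K, ψ, π, hψ, hψ0, hψg, hψπ, -⟩ :=
    exists_local_parametrisation hg hgs (hgA.self_of_nhds.1 hjA)
  have hΩ : IsOpen (localDomain E F φ x y) := isOpen_localDomain hφ.continuous x y
  have hj0 : ε j 0 ∈ localDomain E F φ x y := by
    have h0 : ε j 0 = chartAt E x x := Jet.coord_zero (x := x) (j := j) (mem_chart_source _ x)
    rw [h0]
    exact chart_mem_localDomain (mem_chart_source E x) (mem_chart_source F y)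
  have hev : ∀ᶠ u in 𝓝 (0 : K), AnalyticAt ℂ ψ u ∧ ψ u ∈ ε.symm ⁻¹' A ∧
      ψ u 0 ∈ localDomain E F φ x y := by
    have hc : Tendsto ψ (𝓝 0) (𝓝 (ε j)) := hψ0 ▸ hψ.continuousAt
    have hc0 : Tendsto (fun u => ψ u 0) (𝓝 0) (𝓝 (ε j 0)) :=
      ((continuous_apply 0).tendsto (ε j)).comp hc
    filter_upwards [hψ.eventually_analyticAt, hc.eventually hgA, hψg,
      hc0.eventually (hΩ.mem_nhds hj0)] with u h1 h2 h3 h4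
    exact ⟨h1, h2.2 h3.1, h4⟩
  obtain ⟨ρ, hρ, hball⟩ := Metric.eventually_nhds_iff_ball.1 hev
  set B : Set (K × (Fin (r + 1) → E)) := Metric.ball (0 : K) ρ ×ˢ Set.univ with hB
  -- A chart for the `r`-jets over `A` near `j`: the coefficients up to order `l` come from the
  -- parametrisation `ψ` of `A`, the higher ones are free. The first `l + 1` entries of the second
  -- parameter are ignored, and the parameter domain is connected.
  set Θ : K × (Fin (r + 1) → E) → Fin (r + 1) → E := fun p => extendCoeffs (ψ p.1) p.2 with hΘ
  have hΘa : AnalyticOnNhd ℂ Θ B := fun p hp =>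
    analyticAt_extendCoeffs (a := fun p : K × (Fin (r + 1) → E) => ψ p.1)
      (AnalyticAt.comp (f := fun p : K × (Fin (r + 1) → E) => p.1) (hball _ hp.1).1 analyticAt_fst)
      analyticAt_snd
  have hΘ0 : ∀ p ∈ B, Θ p 0 ∈ localDomain E F φ x y := fun p hp => by
    rw [hΘ]
    simp only [extendCoeffs_zero]
    exact (hball _ hp.1).2.2
  have hBo : IsOpen B := Metric.isOpen_ball.prod isOpen_univ
  have hBc : IsPreconnected B :=
    (convex_ball (0 : K) ρ).isPreconnected.prod isPreconnected_univ
  have hdom : ∀ {q : Jet E M l}, q ∈ ε.source → ε q 0 ∈ localDomain E F φ x y →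
      φ q.base ∈ (chartAt F y).source := by
    intro q hq h0
    have h1 : ε q 0 = chartAt E x q.base := Jet.coord_zero hq
    rw [h1] at h0
    have h2 := h0.2
    rwa [Set.mem_preimage, (chartAt E x).left_inv hq] at h2
  have hnear : ∀ᶠ q in 𝓝 j, q ∈ ε.source ∧ ε q 0 ∈ localDomain E F φ x y ∧
      π (ε q - ε j) ∈ Metric.ball (0 : K) ρ ∧ (q ∈ A → ψ (π (ε q - ε j)) = ε q) := by
    have hc : Tendsto ε (𝓝 j) (𝓝 (ε j)) := ε.continuousAt hjs
    have h1 : Tendsto (fun a => π (a - ε j)) (𝓝 (ε j)) (𝓝 0) := by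
      have : ContinuousAt (fun a => π (a - ε j)) (ε j) := by fun_prop
      simpa using this.tendsto
    filter_upwards [ε.open_source.mem_nhds hjs,
      hc.eventually (((continuous_apply 0).tendsto (ε j)).eventually (hΩ.mem_nhds hj0)),
      hc.eventually (h1.eventually (Metric.ball_mem_nhds (0 : K) hρ)), hc.eventually hψπ,
      hc.eventually hgA] with q k1 k2 k3 k4 k5
    refine ⟨k1, k2, k3, fun hqA => k4 (k5.1 ?_)⟩
    rw [Set.mem_preimage, ε.left_inv k1]
    exact hqA
  have hcoord : ∀ z : Jet E M r, Jet.truncate hlr z ∈ ε.source →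
      ψ (π (ε (Jet.truncate hlr z) - ε j)) = ε (Jet.truncate hlr z) →
      Θ (π (ε (Jet.truncate hlr z) - ε j), jetHomeo r x z) = jetHomeo r x z := by
    intro z hz h
    have h1 : ε (Jet.truncate hlr z) = truncateCoeffs hlr (jetHomeo r x z) :=
      Jet.coord_truncate hlr (by rw [mem_jetHomeo_source, Jet.base_truncate] at hz; exact hz)
    rw [hΘ]
    simp only
    rw [h, h1, extendCoeffs_truncateCoeffs]
  -- The closure hypothesis supplies one jet of low order inside this parametrised family; the
  -- identity theorem spreads the bound to a dense set of parameters.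
  obtain ⟨_, ⟨z₀, ⟨hz₀A, hz₀⟩, rfl⟩, hz₀n⟩ : ∃ q ∈ Jet.truncate hlr '' lowOrderJets F φ e hlr A,
      q ∈ ε.source ∧ ε q 0 ∈ localDomain E F φ x y ∧
      π (ε q - ε j) ∈ Metric.ball (0 : K) ρ ∧ (q ∈ A → ψ (π (ε q - ε j)) = ε q) :=
    ((mem_closure_iff_frequently.1 hj).and_eventually hnear).exists
  obtain ⟨n1, n2, n3, n4⟩ := hz₀n
  have hpoly₀ : JacobianOrderLE (localRep E F φ x y) e
      (polyCurve (Θ (π (ε (Jet.truncate hlr z₀) - ε j), jetHomeo r x z₀))) := by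
    rw [hcoord z₀ n1 (n4 hz₀A)]
    have hs : z₀.base ∈ (chartAt E x).source := by
      rw [mem_jetHomeo_source, Jet.base_truncate] at n1; exact n1
    have ht : φ z₀.base ∈ (chartAt F y).source := by
      have := hdom n1 n2
      rwa [Jet.base_truncate] at this
    exact (Jet.exists_jacobianOrderLE_iff hφ her hs ht).1 hz₀
  filter_upwards [hnear] with q hq hqA z hzq
  subst hzq
  obtain ⟨k1, k2, k3, k4⟩ := hq
  have hfreq := JacobianOrderLE.frequently_polyCurve (analyticOnNhd_localRep hφ x y) hBo hBc hΘa
    hΘ0 (u₁ := (π (ε (Jet.truncate hlr z) - ε j), jetHomeo r x z)) ⟨n3, trivial⟩ ⟨k3, trivial⟩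
    hpoly₀
  have hzs : z ∈ (jetHomeo r x).source := by
    rw [mem_jetHomeo_source, Jet.base_truncate] at k1
    exact k1
  have hΘz := hcoord z k1 (k4 hqA)
  -- The parameter of `z` is sent to `z` itself, so low-order parameters tending to it give
  -- low-order jets tending to `z`.
  have hlim : Tendsto (fun p => (jetHomeo r x).symm (Θ p))
      (𝓝 (π (ε (Jet.truncate hlr z) - ε j), jetHomeo r x z)) (𝓝 z) := by
    have h1 : ContinuousAt Θ (π (ε (Jet.truncate hlr z) - ε j), jetHomeo r x z) :=
      (hΘa _ ⟨k3, trivial⟩).continuousAt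
    have h2 : ContinuousAt (jetHomeo r x).symm
        (Θ (π (ε (Jet.truncate hlr z) - ε j), jetHomeo r x z)) := by
      rw [hΘz]
      exact (jetHomeo r x).continuousAt_symm ((jetHomeo r x).map_source hzs)
    have h3 := (ContinuousAt.comp h2 h1).tendsto
    rw [Function.comp_apply, hΘz, (jetHomeo r x).left_inv hzs] at h3
    exact h3
  refine mem_closure_of_frequently_of_tendsto
    ((hfreq.and_eventually (hBo.mem_nhds ⟨k3, trivial⟩)).mono fun p hp => ?_) hlim
  obtain ⟨hp1, hpB⟩ := hp
  have hp0 := hΘ0 p hpB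
  have hpt : Θ p ∈ (jetHomeo r x).target := hp0.1
  have hps := (jetHomeo r x).map_target hpt
  refine ⟨?_, ?_⟩
  · change Jet.truncate hlr ((jetHomeo r x).symm (Θ p)) ∈ A
    rw [Jet.truncate_symm hlr hp0.1, hΘ]
    simp only [truncateCoeffs_extendCoeffs]
    exact (hball _ hpB.1).2.1
  · refine (Jet.exists_jacobianOrderLE_iff hφ her (x := x) (y := y) hps ?_).2 ?_
    · have h1 : jetHomeo r x ((jetHomeo r x).symm (Θ p)) = Θ p := (jetHomeo r x).right_inv hpt
      have h2 : jetHomeo r x ((jetHomeo r x).symm (Θ p)) 0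
          = chartAt E x ((jetHomeo r x).symm (Θ p)).base := Jet.coord_zero hps
      rw [h1] at h2
      have h3 := hp0.2
      rw [h2, Set.mem_preimage, (chartAt E x).left_inv hps] at h3
      exact h3
    · rw [(jetHomeo r x).right_inv hpt]
      exact hp1

/-- Every jet has a representative along which the Jacobian of a given non-degenerate map does not
vanish identically. -/
theorem Jet.exists_jacobianOrderLE {φ : M → N} (hφ : ContMDiff 𝓘(ℂ, E) 𝓘(ℂ, F) ω φ)
    (hnd : IsNondegenerate E F φ) {l : ℕ} (j : Jet E M l) :
    ∃ (γ : HolCurve E M) (e : ℕ), Jet.mk l γ = j ∧ γ.JacobianOrderLE F φ e := by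
  obtain ⟨δ, rfl⟩ := j.exists_mk
  set x := δ.toFun 0 with hx
  have hxs : δ.toFun 0 ∈ (chartAt E x).source := mem_chart_source E x
  have hys : φ (δ.toFun 0) ∈ (chartAt F (φ x)).source := mem_chart_source F (φ x)
  have hfreq : ∃ᶠ v in 𝓝 (chartAt E x (δ.toFun 0)),
      Function.Surjective (fderiv ℂ (localRep E F φ x (φ x)) v) := by
    have hc : Tendsto (chartAt E x) (𝓝 x) (𝓝 (chartAt E x (δ.toFun 0))) :=
      (chartAt E x).continuousAt hxs
    refine hc.frequently ((((hnd.frequently_surjective hφ x).and_eventually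
      ((chartAt E x).open_source.mem_nhds hxs)).and_eventually
      (hφ.continuous.continuousAt.preimage_mem_nhds
        ((chartAt F (φ x)).open_source.mem_nhds hys))).mono fun p hp => ?_)
    exact (surjective_fderiv_localRep_iff hφ hp.1.2 hp.2).2 hp.1.1
  obtain ⟨g, e, hg, hg0, hgδ, hge⟩ := _root_.exists_jacobianOrderLE (δ.analyticAt_chart hxs)
    (analyticOnNhd_localRep hφ x (φ x) _ (chart_mem_localDomain hxs hys)) hfreq l
  have hgt : g 0 ∈ (chartAt E x).target := by
    rw [hg0]
    exact (chartAt E x).map_source hxs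
  have hb : (HolCurve.ofChart x g hg hgt).toFun 0 = δ.toFun 0 := by
    change (chartAt E x).symm (g 0) = _
    rw [hg0, (chartAt E x).left_inv hxs]
  have hev := HolCurve.chart_ofChart x hg hgt
  refine ⟨HolCurve.ofChart x g hg hgt, e, ?_, ?_⟩
  · refine Jet.mk_eq_of_isBigO (x := x) (by rw [hb]; exact hxs) hb ?_
    refine hgδ.congr' ?_ EventuallyEq.rfl
    filter_upwards [hev] with t ht
    rw [ht]
  · refine HolCurve.jacobianOrderLE_change hφ _ (x := x) (y := φ x) (by rw [hb]; exact hxs)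
      (mem_chart_source E _) (by rw [hb]; exact hys) (mem_chart_source F _) ?_
    exact jacobianOrderLE_congr_right (EventuallyEq.symm hev) hge

/-- If the regular locus of `A` is connected and dense in `A` then, for a suitable `e`, the jets of
Jacobian order at most `e` are dense in the space of all jets over `A`. -/
theorem exists_jetsOver_subset_closure_lowOrderJets {φ : M → N}
    (hφ : ContMDiff 𝓘(ℂ, E) 𝓘(ℂ, F) ω φ) (hnd : IsNondegenerate E F φ) {l : ℕ}
    {A : Set (Jet E M l)} (hc : IsConnected (regularLocus (Fin (l + 1) → E) A))
    (hd : A ⊆ closure (regularLocus (Fin (l + 1) → E) A)) :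
    ∃ e : ℕ, ∀ (r : ℕ) (hlr : l ≤ r), e ≤ r →
      (lowOrderJets F φ e hlr A).Nonempty ∧
      jetsOver hlr A ⊆ closure (lowOrderJets F φ e hlr A) := by
  obtain ⟨j₀, hj₀⟩ := hc.nonempty
  -- The order along one germ over a single regular point determines `e` for all of `A`.
  obtain ⟨γ, e, hγ, hγe⟩ := Jet.exists_jacobianOrderLE hφ hnd j₀
  refine ⟨e, fun r hlr her => ?_⟩
  have hmem : Jet.mk r γ ∈ lowOrderJets F φ e hlr A := by
    refine ⟨?_, γ, rfl, hγe⟩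
    change Jet.mk l γ ∈ A
    rw [hγ]
    exact hj₀.1
  refine ⟨⟨_, hmem⟩, ?_⟩
  set R := regularLocus (Fin (l + 1) → E) A with hR
  set G := lowOrderJets F φ e hlr A with hG
  -- Connectedness argument: by the local result, a regular point in the closure has a neighbourhood
  -- whose regular points are all in the closure. Thus `u` and the complement of the closure cover
  -- `R` by two open sets that do not meet on `R`, and `j₀` lies in the first.
  have hRG : R ⊆ closure (Jet.truncate hlr '' G) := by
    by_contra hnot
    obtain ⟨j₁, hj₁, hj₁'⟩ := Set.not_subset.1 hnot
    set u : Set (Jet E M l) := {j | ∀ᶠ j' in 𝓝 j, j' ∈ R → j' ∈ closure (Jet.truncate hlr '' G)}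
      with hu
    have huo : IsOpen u := isOpen_iff_mem_nhds.2 fun _ hj => Eventually.eventually_nhds hj
    have hsub : R ⊆ u ∪ (closure (Jet.truncate hlr '' G))ᶜ := by
      intro j hj
      by_cases hjc : j ∈ closure (Jet.truncate hlr '' G)
      · left
        change ∀ᶠ j' in 𝓝 j, _
        filter_upwards [eventually_subset_closure_lowOrderJets hφ hlr her hj hjc] with j' hj' hj'R
        obtain ⟨δ, rfl⟩ := j'.exists_mk
        have h1 := hj' hj'R.1 (Jet.mk r δ) rfl
        exact image_closure_subset_closure_image (Jet.continuous_truncate hlr) ⟨_, h1, rfl⟩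
      · exact Or.inr hjc
    have hj₀u : j₀ ∈ u := by
      rcases hsub hj₀ with h | h
      · exact h
      · have h1 : j₀ ∈ Jet.truncate hlr '' G := ⟨_, hmem, hγ⟩
        exact absurd (subset_closure h1) h
    obtain ⟨j, hjR, hju, hjc⟩ := hc.isPreconnected u _ huo isClosed_closure.isOpen_compl hsub
      ⟨j₀, hj₀, hj₀u⟩ ⟨j₁, hj₁, hj₁'⟩
    exact hjc (mem_of_mem_nhds (s := {j' | j' ∈ R → j' ∈ closure (Jet.truncate hlr '' G)}) hju hjR)
  intro z hz
  -- Since truncation is open and `R` is dense in `A`, the jets over `R` are dense in the jets over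
  -- `A`.
  have h1 : z ∈ closure (Jet.truncate hlr ⁻¹' R) :=
    (Jet.isOpenMap_truncate hlr).preimage_closure_subset_closure_preimage (hd hz)
  refine closure_minimal (fun z' hz' => ?_) isClosed_closure h1
  have h2 := eventually_subset_closure_lowOrderJets hφ hlr her hz' (hRG hz')
  exact mem_of_mem_nhds (s := {j' | j' ∈ A → ∀ z, Jet.truncate hlr z = j' → z ∈ closure G}) h2
    hz'.1 z' rfl

/-- Jets over the image of a jet of low Jacobian order are images of jets. -/
theorem jetsOver_image_lowOrderJets_subset {φ : M → N} (hφ : ContMDiff 𝓘(ℂ, E) 𝓘(ℂ, F) ω φ)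
    {e l r k : ℕ} (hlr : l ≤ r) (hrk : r ≤ k) (her : 2 * e ≤ r) (hler : l + e ≤ r)
    (A : Set (Jet E M l)) :
    jetsOver hrk (Jet.map φ hφ r '' lowOrderJets F φ e hlr A)
      ⊆ Jet.map φ hφ k '' jetsOver (hlr.trans hrk) A := by
  rintro w ⟨_, ⟨hzA, γ, rfl, hγ⟩, hw⟩
  obtain ⟨z, hz, rfl⟩ := Jet.exists_lift hφ her hler hrk hγ hw.symm
  refine ⟨z, ?_, rfl⟩
  change Jet.truncate _ z ∈ A
  rw [hz]
  exact hzA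

/-- Continuity of `φ^{(r)}` puts the image of all jets over `A` in the closure of the image of the
low-order ones, openness of truncation lifts this closure to `k`-jets, and over low-order jets
everything lifts. -/
theorem jetsOver_image_subset_closure {φ : M → N} (hφ : ContMDiff 𝓘(ℂ, E) 𝓘(ℂ, F) ω φ)
    {e l r k : ℕ} (hlr : l ≤ r) (hrk : r ≤ k) (her : 2 * e ≤ r) (hler : l + e ≤ r)
    {A : Set (Jet E M l)} (hA : jetsOver hlr A ⊆ closure (lowOrderJets F φ e hlr A)) :
    jetsOver hrk (Jet.map φ hφ r '' jetsOver hlr A)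
      ⊆ closure (Jet.map φ hφ k '' jetsOver (hlr.trans hrk) A) := by
  refine Set.Subset.trans ?_
    (closure_mono (jetsOver_image_lowOrderJets_subset hφ hlr hrk her hler A))
  refine Set.Subset.trans (Set.preimage_mono ?_)
    ((Jet.isOpenMap_truncate hrk).preimage_closure_subset_closure_preimage)
  exact (Set.image_mono hA).trans (image_closure_subset_closure_image (Jet.continuous_map hφ r))

end Density

/-! ## Dimensions of sets of jets -/

section Dimension

variable {H : Type*} [NormedAddCommGroup H] [NormedSpace ℂ H] [CompleteSpace H]
  {X : Type*} [TopologicalSpace X] [ChartedSpace H X] [IsManifold 𝓘(ℂ, H) ω X]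

/-- Injectivity of the differential is an open condition, so it need only be checked at one point,
in one chart. -/
theorem le_complexDim_of_analyticAt {S : Set X} {e : OpenPartialHomeomorph X H}
    (he : e ∈ IsManifold.maximalAtlas 𝓘(ℂ, H) ω X) {d : ℕ} {f : EuclideanSpace ℂ (Fin d) → H}
    {u₀ : EuclideanSpace ℂ (Fin d)} (hf : AnalyticAt ℂ f u₀)
    (hi : Function.Injective (fderiv ℂ f u₀))
    (hS : ∀ᶠ u in 𝓝 u₀, f u ∈ e.target ∧ e.symm (f u) ∈ S) :
    ((d : ℕ∞) : WithBot ℕ∞) ≤ complexDim H S := by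
  have h1 : ∀ᶠ u in 𝓝 u₀, Function.Injective (fderiv ℂ f u) :=
    hf.fderiv.continuousAt.preimage_mem_nhds
      (ContinuousLinearMap.isOpen_injective.mem_nhds hi)
  obtain ⟨U, hU, hUo, huU⟩ := eventually_nhds_iff.1 (hS.and (h1.and hf.eventually_analyticAt))
  have hc : ∀ u ∈ U, ContMDiffAt 𝓘(ℂ, EuclideanSpace ℂ (Fin d)) 𝓘(ℂ, H) ω
      (fun u => e.symm (f u)) u := fun u hu =>
    (contMDiffAt_symm_of_mem_maximalAtlas he (hU u hu).1.1).comp u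
      (hU u hu).2.2.contDiffAt.contMDiffAt
  refine le_iSup (fun d : {d : ℕ // _} => ((d.1 : ℕ∞) : WithBot ℕ∞)) ⟨d, U, fun u => e.symm (f u),
    hUo, ⟨u₀, huU⟩, fun u hu => (hc u hu).contMDiffWithinAt, fun u hu => ?_,
    fun u hu => (hU u hu).1.2⟩
  rw [← injective_fderiv_chart_comp_iff he ((hc u hu).mdifferentiableAt (by simp))
    (e.map_target (hU u hu).1.1)]
  have h2 : (fun v => e (e.symm (f v))) =ᶠ[𝓝 u] f := by
    filter_upwards [hUo.mem_nhds hu] with v hv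
    exact e.right_inv (hU v hv).1.1
  rw [h2.fderiv_eq]
  exact (hU u hu).2.1

/-- Upper bounds for the dimension may be tested on immersions read in a chart, at one point of
their domain. -/
theorem complexDim_le {S : Set X} {b : WithBot ℕ∞}
    (h : ∀ (d : ℕ) (p : X) (f : EuclideanSpace ℂ (Fin d) → H) (u₀ : EuclideanSpace ℂ (Fin d)),
      AnalyticAt ℂ f u₀ → Function.Injective (fderiv ℂ f u₀) →
      (∀ᶠ u in 𝓝 u₀, f u ∈ (chartAt H p).target ∧ (chartAt H p).symm (f u) ∈ S) →
      ((d : ℕ∞) : WithBot ℕ∞) ≤ b) :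
    complexDim H S ≤ b := by
  refine iSup_le ?_
  rintro ⟨d, U, f, hU, ⟨u₀, hu₀⟩, hf, hi, hS⟩
  have hfu : ContMDiffAt 𝓘(ℂ, EuclideanSpace ℂ (Fin d)) 𝓘(ℂ, H) ω f u₀ :=
    hf.contMDiffAt (hU.mem_nhds hu₀)
  have hsrc : f u₀ ∈ (chartAt H (f u₀)).source := mem_chart_source H _
  have he := IsManifold.chart_mem_maximalAtlas (I := 𝓘(ℂ, H)) (n := ω) (f u₀)
  refine h d (f u₀) (fun u => chartAt H (f u₀) (f u)) u₀ ?_ ?_ ?_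
  · have h1 : ContMDiffAt 𝓘(ℂ, H) 𝓘(ℂ, H) ω (chartAt H (f u₀)) (f u₀) :=
      contMDiffAt_of_mem_maximalAtlas he hsrc
    exact (contMDiffAt_iff_contDiffAt.1 (h1.comp u₀ hfu)).analyticAt
  · exact (injective_fderiv_chart_comp_iff he (hfu.mdifferentiableAt (by simp)) hsrc).2 (hi u₀ hu₀)
  · filter_upwards [hU.mem_nhds hu₀, hfu.continuousAt.preimage_mem_nhds
      ((chartAt H (f u₀)).open_source.mem_nhds hsrc)] with u h1 h2
    refine ⟨(chartAt H (f u₀)).map_source h2, ?_⟩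
    rw [(chartAt H (f u₀)).left_inv h2]
    exact hS h1

theorem complexDim_le_finrank [FiniteDimensional ℂ H] (S : Set X) :
    complexDim H S ≤ ((Module.finrank ℂ H : ℕ∞) : WithBot ℕ∞) := by
  refine complexDim_le fun d p f u₀ _ hi _ => ?_
  have h1 := LinearMap.finrank_le_finrank_of_injective
    (f := (fderiv ℂ f u₀ : EuclideanSpace ℂ (Fin d) →ₗ[ℂ] H)) hi
  rw [finrank_euclideanSpace_fin] at h1
  exact_mod_cast h1

theorem complexDim_mono {S T : Set X} (h : S ⊆ T) : complexDim H S ≤ complexDim H T :=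
  complexDim_le fun _ p _ _ hf hi hS =>
    le_complexDim_of_analyticAt (IsManifold.chart_mem_maximalAtlas p) hf hi
      (hS.mono fun _ hu => ⟨hu.1, h hu.2⟩)

theorem complexDim_empty : complexDim H (∅ : Set X) = ⊥ :=
  le_bot_iff.1 (complexDim_le fun _ _ _ _ _ _ hS => hS.self_of_nhds.2.elim)

end Dimension

/-! ### Dimension and truncation of jets -/

section JetDimension

variable {F : Type*} [NormedAddCommGroup F] [NormedSpace ℂ F] [FiniteDimensional ℂ F]
  [CompleteSpace F]
  {N : Type*} [TopologicalSpace N] [ChartedSpace F N] [IsManifold 𝓘(ℂ, F) ω N]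

theorem finrank_ker_truncateCoeffs {r k : ℕ} (h : r ≤ k) :
    Module.finrank ℂ (LinearMap.ker ((truncateCoeffs h :
      (Fin (k + 1) → F) →L[ℂ] (Fin (r + 1) → F)) : (Fin (k + 1) → F) →ₗ[ℂ] (Fin (r + 1) → F)))
      = (k - r) * Module.finrank ℂ F := by
  have h1 := LinearMap.finrank_range_add_finrank_ker ((truncateCoeffs h :
      (Fin (k + 1) → F) →L[ℂ] (Fin (r + 1) → F)) : (Fin (k + 1) → F) →ₗ[ℂ] (Fin (r + 1) → F))
  rw [LinearMap.range_eq_top.2 (truncateCoeffs_surjective h), finrank_top, Module.finrank_pi_fintype,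
    Module.finrank_pi_fintype] at h1
  simp only [Finset.sum_const, Finset.card_univ, Fintype.card_fin, smul_eq_mul] at h1
  obtain ⟨i, rfl⟩ := Nat.exists_eq_add_of_le h
  rw [Nat.add_sub_cancel_left]
  linarith

/-- Truncation of jets lowers the dimension by at most the dimension of its fibres. -/
theorem complexDim_le_complexDim_truncate_add {r k : ℕ} (h : r ≤ k) (S : Set (Jet F N k)) :
    complexDim (Fin (k + 1) → F) S
      ≤ complexDim (Fin (r + 1) → F) (Jet.truncate h '' S)
        + ((((k - r) * Module.finrank ℂ F : ℕ) : ℕ∞) : WithBot ℕ∞) := by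
  refine complexDim_le fun d p f u₀ hf hi hS => ?_
  set x := p.base with hx
  set T : (Fin (k + 1) → F) →L[ℂ] (Fin (r + 1) → F) := truncateCoeffs h with hT
  set A : EuclideanSpace ℂ (Fin d) →ₗ[ℂ] (Fin (r + 1) → F) :=
    (T.comp (fderiv ℂ f u₀) : EuclideanSpace ℂ (Fin d) →L[ℂ] (Fin (r + 1) → F)).toLinearMap with hA
  -- Restricted to a complement `K` of `ker A`, the truncated map is still an immersion at `u₀`. The
  -- discarded directions `ker A` embed via `f'` in the kernel of truncation, which bounds their
  -- number.
  obtain ⟨K, hK⟩ := (LinearMap.ker A).exists_isCompl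
  have hdim : Module.finrank ℂ (LinearMap.ker A) + Module.finrank ℂ K = d := by
    rw [Submodule.finrank_add_eq_of_isCompl hK, finrank_euclideanSpace_fin]
  have hker : Module.finrank ℂ (LinearMap.ker A) ≤ (k - r) * Module.finrank ℂ F := by
    rw [← finrank_ker_truncateCoeffs h]
    have hmap : ∀ v ∈ LinearMap.ker A,
        (fderiv ℂ f u₀).toLinearMap v
          ∈ LinearMap.ker (T : (Fin (k + 1) → F) →ₗ[ℂ] (Fin (r + 1) → F)) := fun v hv => hv
    refine LinearMap.finrank_le_finrank_of_injective
      (f := (fderiv ℂ f u₀).toLinearMap.restrict hmap) fun v w hvw => Subtype.ext (hi ?_)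
    exact congrArg Subtype.val hvw
  let ε : EuclideanSpace ℂ (Fin (Module.finrank ℂ K)) ≃L[ℂ] K :=
    ContinuousLinearEquiv.ofFinrankEq (by simp)
  set ι : EuclideanSpace ℂ (Fin (Module.finrank ℂ K)) →L[ℂ] EuclideanSpace ℂ (Fin d) :=
    K.subtypeL.comp ε.toContinuousLinearMap with hι
  have hιi : Function.Injective ι := Subtype.val_injective.comp ε.injective
  have hιK : ∀ v, ι v ∈ K := fun v => (ε v).2
  set f₂ : EuclideanSpace ℂ (Fin (Module.finrank ℂ K)) → Fin (r + 1) → F :=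
    fun v => T (f (u₀ + ι v)) with hf₂
  have haff : HasFDerivAt (fun v => u₀ + ι v) ι 0 := ι.hasFDerivAt.const_add u₀
  have h0 : u₀ + ι 0 = u₀ := by simp
  have hfa : AnalyticAt ℂ (fun v => f (u₀ + ι v)) 0 :=
    AnalyticAt.comp (f := fun v => u₀ + ι v) (by rw [h0]; exact hf)
      (analyticAt_const.fun_add (ι.analyticAt 0))
  have hf₂a : AnalyticAt ℂ f₂ 0 := AnalyticAt.comp (f := fun v => f (u₀ + ι v)) (T.analyticAt _) hfa
  have hd : HasFDerivAt f₂ (T.comp ((fderiv ℂ f u₀).comp ι)) 0 := by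
    refine T.hasFDerivAt.comp 0 (HasFDerivAt.comp (g := f) 0 ?_ haff)
    rw [h0]
    exact hf.differentiableAt.hasFDerivAt
  have hf₂i : Function.Injective (fderiv ℂ f₂ 0) := by
    rw [hd.fderiv, injective_iff_map_eq_zero]
    intro v hv
    have h1 : ι v ∈ LinearMap.ker A := hv
    have h2 : ι v = 0 := Submodule.disjoint_def.1 hK.disjoint _ h1 (hιK v)
    exact hιi (h2.trans (map_zero ι).symm)
  have hS₂ : ∀ᶠ v in 𝓝 0, f₂ v ∈ (jetHomeo r x).target ∧
      (jetHomeo r x).symm (f₂ v) ∈ Jet.truncate h '' S := by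
    have hc : Tendsto (fun v => u₀ + ι v) (𝓝 0) (𝓝 u₀) := by
      have := haff.continuousAt.tendsto
      rwa [h0] at this
    filter_upwards [hc.eventually hS] with v hv
    have hv1 : f (u₀ + ι v) 0 ∈ (chartAt F x).target := hv.1
    exact ⟨hv1, _, hv.2, Jet.truncate_symm h hv1⟩
  have hle := le_complexDim_of_analyticAt (jetHomeo_mem_maximalAtlas r x) hf₂a hf₂i hS₂
  calc ((d : ℕ∞) : WithBot ℕ∞)
      ≤ ((Module.finrank ℂ K + (k - r) * Module.finrank ℂ F : ℕ) : ℕ∞) := by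
        have : d ≤ Module.finrank ℂ K + (k - r) * Module.finrank ℂ F := by omega
        exact_mod_cast this
    _ = ((Module.finrank ℂ K : ℕ∞) : WithBot ℕ∞)
        + ((((k - r) * Module.finrank ℂ F : ℕ) : ℕ∞) : WithBot ℕ∞) := by
        push_cast
        rfl
    _ ≤ _ := by gcongr

/-- The dimension of the fibres of the truncation of jets. -/
theorem le_complexDim_of_jetsOver_singleton_subset {r k : ℕ} (h : r ≤ k) {S : Set (Jet F N k)}
    {w : Jet F N r} (hw : jetsOver h {w} ⊆ S) :
    ((((k - r) * Module.finrank ℂ F : ℕ) : ℕ∞) : WithBot ℕ∞)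
      ≤ complexDim (Fin (k + 1) → F) S := by
  set x := w.base with hx
  set T : (Fin (k + 1) → F) →L[ℂ] (Fin (r + 1) → F) := truncateCoeffs h with hT
  set K := LinearMap.ker (T : (Fin (k + 1) → F) →ₗ[ℂ] (Fin (r + 1) → F)) with hK
  have hws : w ∈ (jetHomeo r x).source := mem_jetHomeo_source_base w
  let ε : EuclideanSpace ℂ (Fin ((k - r) * Module.finrank ℂ F)) ≃L[ℂ] K :=
    ContinuousLinearEquiv.ofFinrankEq
      (by rw [finrank_euclideanSpace_fin]; exact (finrank_ker_truncateCoeffs h).symm)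
  set ι : EuclideanSpace ℂ (Fin ((k - r) * Module.finrank ℂ F)) →L[ℂ] (Fin (k + 1) → F) :=
    K.subtypeL.comp ε.toContinuousLinearMap with hι
  have hιi : Function.Injective ι := Subtype.val_injective.comp ε.injective
  have hιK : ∀ v, T (ι v) = 0 := fun v => (ε v).2
  -- In coordinates the fibre over `w` is the affine space `c + ker T`, parametrised by `v ↦ c + ι
  -- v`.
  set c : Fin (k + 1) → F := extendCoeffs (jetHomeo r x w) 0 with hc
  have hTc : ∀ v, T (c + ι v) = jetHomeo r x w := fun v => by
    rw [map_add, hιK, add_zero, hc, hT, truncateCoeffs_extendCoeffs]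
  have h0 : ∀ a : Fin (k + 1) → F, T a = jetHomeo r x w → a 0 ∈ (chartAt F x).target := by
    intro a ha
    have h1 : a 0 = jetHomeo r x w 0 := by
      rw [← ha]
      rfl
    rw [h1]
    exact (jetHomeo r x).map_source hws
  refine le_complexDim_of_analyticAt (jetHomeo_mem_maximalAtlas k x) (f := fun v => c + ι v)
    (u₀ := 0) (analyticAt_const.fun_add (ι.analyticAt 0)) ?_ (Eventually.of_forall fun v => ?_)
  · rw [(ι.hasFDerivAt.const_add c).fderiv]
    exact hιi
  · have h1 := h0 _ (hTc v)
    refine ⟨h1, hw ?_⟩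
    change Jet.truncate h _ = w
    rw [Jet.truncate_symm h h1]
    exact (congrArg _ (hTc v)).trans ((jetHomeo r x).left_inv hws)

end JetDimension

/-! ## Stabilisation of the dimension -/

/-- A sequence which grows at most linearly with slope `n` and is bounded below by a linear function
of slope `n` is eventually linear. -/
theorem exists_eventually_linear {δ : ℕ → ℕ} {n : ℕ}
    (h1 : ∀ i j, i ≤ j → δ j ≤ δ i + (j - i) * n) (h2 : ∀ i, i * n ≤ δ i) :
    ∃ i, ∀ j, i ≤ j → δ j = δ i + (j - i) * n := by
  obtain ⟨a, ha⟩ : ∃ a, ∀ j, δ a - a * n ≤ δ j - j * n :=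
    -- The difference `δ i - i * n` is non-increasing by `h1`, so it is constant from a minimiser
    -- on. Truncated subtraction is exact here by `h2`.
    ⟨_, fun j => Function.argmin_le (fun i => δ i - i * n) j⟩
  refine ⟨a, fun j hj => le_antisymm (h1 _ _ hj) ?_⟩
  obtain ⟨i, rfl⟩ := Nat.exists_eq_add_of_le hj
  have h3 := ha (a + i)
  have h4 := h2 a
  have h5 := h2 (a + i)
  rw [Nat.add_sub_cancel_left]
  rw [Nat.add_mul] at h3 h5
  omega

/-! ## Images of jet spaces -/

theorem proposition3p2 {m n : ℕ}
    {M : Type*} [TopologicalSpace M] [ChartedSpace (EuclideanSpace ℂ (Fin m)) M]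
    [IsManifold 𝓘(ℂ, EuclideanSpace ℂ (Fin m)) ω M]
    {N : Type*} [TopologicalSpace N] [ChartedSpace (EuclideanSpace ℂ (Fin n)) N]
    [IsManifold 𝓘(ℂ, EuclideanSpace ℂ (Fin n)) ω N]
    (φ : M → N)
    (hφ : ContMDiff 𝓘(ℂ, EuclideanSpace ℂ (Fin m)) 𝓘(ℂ, EuclideanSpace ℂ (Fin n)) ω φ)
    (hnd : IsNondegenerate (EuclideanSpace ℂ (Fin m)) (EuclideanSpace ℂ (Fin n)) φ)
    (l : ℕ) (Z₀ : Set (Jet (EuclideanSpace ℂ (Fin m)) M l)) (hZ₀ : IsAlgebraicSubvariety Z₀) :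
    ∃ (r : ℕ) (hlr : l ≤ r), ∀ (k : ℕ) (hrk : r ≤ k),
      let Z : Set (Jet (EuclideanSpace ℂ (Fin m)) M r) := jetsOver hlr Z₀
      let Zk : Set (Jet (EuclideanSpace ℂ (Fin m)) M k) := jetsOver hrk Z
      let W : Set (Jet (EuclideanSpace ℂ (Fin n)) N r) := Jet.map φ hφ r '' Z
      let Wk : Set (Jet (EuclideanSpace ℂ (Fin n)) N k) := Jet.map φ hφ k '' Zk
      complexDim (Fin (k + 1) → EuclideanSpace ℂ (Fin n)) Wk
          = complexDim (Fin (r + 1) → EuclideanSpace ℂ (Fin n)) W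
            + ((((k - r) * n : ℕ) : ℕ∞) : WithBot ℕ∞) ∧
        Wk ⊆ jetsOver hrk W ∧ jetsOver hrk W ⊆ closure Wk := by
  obtain ⟨C, hCf, hC, rfl⟩ := hZ₀
  have hover : ∀ {r k : ℕ} (hlr : l ≤ r) (hrk : r ≤ k)
      (A : Set (Jet (EuclideanSpace ℂ (Fin m)) M l)),
      jetsOver hrk (jetsOver hlr A) = jetsOver (hlr.trans hrk) A := fun hlr hrk A => by
    ext z
    change Jet.truncate hlr (Jet.truncate hrk z) ∈ A ↔ _
    rw [Jet.truncate_truncate]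
    rfl
  have hsub : ∀ {r k : ℕ} (hlr : l ≤ r) (hrk : r ≤ k)
      (A : Set (Jet (EuclideanSpace ℂ (Fin m)) M l)),
      Jet.truncate hrk '' (Jet.map φ hφ k '' jetsOver (hlr.trans hrk) A)
        ⊆ Jet.map φ hφ r '' jetsOver hlr A := by
    rintro r k hlr hrk A _ ⟨_, ⟨z, hz, rfl⟩, rfl⟩
    rw [Jet.truncate_map]
    refine ⟨_, ?_, rfl⟩
    change Jet.truncate hlr (Jet.truncate hrk z) ∈ A
    rw [Jet.truncate_truncate]
    exact hz
  rcases C.eq_empty_or_nonempty with rfl | ⟨A₀, hA₀⟩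
  -- For empty `Z₀` all sets are empty and both dimensions are `⊥`, which absorbs the added term.
  · refine ⟨l, le_rfl, fun k hrk => ?_⟩
    simp only [Set.sUnion_empty, jetsOver, Set.preimage_empty, Set.image_empty, complexDim_empty,
      WithBot.bot_add, Set.subset_empty_iff, Set.empty_subset, and_self]
  choose! e he using fun A hA => exists_jetsOver_subset_closure_lowOrderJets hφ hnd (hC A hA).2
    (hC A hA).1.subset_closure_regularLocus
  obtain ⟨b, hb⟩ := (hCf.image e).bddAbove
  have heb : ∀ A ∈ C, e A ≤ b := fun A hA => hb ⟨A, hA, rfl⟩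
  -- From level `q` on, `e A ≤ r`, `2 * e A ≤ r` and `l + e A ≤ r` hold for every component `A`.
  set q := l + 2 * b with hq
  set D : ℕ → WithBot ℕ∞ := fun i => complexDim (Fin (q + i + 1) → EuclideanSpace ℂ (Fin n))
    (Jet.map φ hφ (q + i) '' jetsOver (show l ≤ q + i by omega) (⋃₀ C)) with hD
  have hupper : ∀ i j, i ≤ j → D j ≤ D i + ((((j - i) * n : ℕ) : ℕ∞) : WithBot ℕ∞) := by
    intro i j hij
    have h1 := complexDim_le_complexDim_truncate_add (show q + i ≤ q + j by omega)
      (Jet.map φ hφ (q + j) '' jetsOver (show l ≤ q + j by omega) (⋃₀ C))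
    rw [finrank_euclideanSpace_fin, Nat.add_sub_add_left] at h1
    refine h1.trans (add_le_add_left (complexDim_mono ?_) _)
    exact hsub _ _ _
  -- The image of one low-order jet at level `q` has its entire fibre inside the set at level `q +
  -- i`, because all jets over it lift.
  have hlower : ∀ i, (((i * n : ℕ) : ℕ∞) : WithBot ℕ∞) ≤ D i := by
    intro i
    have hb₀ := heb A₀ hA₀
    obtain ⟨z, hz⟩ := (he A₀ hA₀ q (by omega) (by omega)).1
    have h1 := le_complexDim_of_jetsOver_singleton_subset (show q ≤ q + i by omega)
      (w := Jet.map φ hφ q z)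
      (S := Jet.map φ hφ (q + i) '' jetsOver (show l ≤ q + i by omega) (⋃₀ C)) ?_
    · rwa [finrank_euclideanSpace_fin, Nat.add_sub_cancel_left] at h1
    · intro w hw
      obtain ⟨z', hz', rfl⟩ := jetsOver_image_lowOrderJets_subset hφ (show l ≤ q by omega)
        (show q ≤ q + i by omega) (show 2 * e A₀ ≤ q by omega) (by omega) A₀
        (show w ∈ _ from ⟨z, hz, (show Jet.truncate _ w = _ from hw).symm⟩)
      exact ⟨z', ⟨A₀, hA₀, hz'⟩, rfl⟩
  -- The lower bound excludes `⊥` and the dimension of the jet space excludes `⊤`, so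
  -- subtraction-style arithmetic in `ℕ` becomes available.
  have hnat : ∀ i, ∃ d : ℕ, D i = ((d : ℕ∞) : WithBot ℕ∞) := by
    intro i
    have h1 : D i ≤ _ := complexDim_le_finrank _
    have h2 := hlower i
    revert h1 h2
    generalize D i = x
    intro h1 h2
    induction x using WithBot.recBotCoe with
    | bot => exact (WithBot.not_coe_le_bot _ h2).elim
    | coe x =>
      have h3 : x ≤ _ := WithBot.coe_le_coe.1 h1
      obtain ⟨d, hd⟩ := ENat.ne_top_iff_exists.1 (ne_top_of_le_ne_top (ENat.natCast_ne_top _) h3)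
      exact ⟨d, by rw [hd]⟩
  choose δ hδ using hnat
  obtain ⟨i, hi⟩ := exists_eventually_linear (δ := δ) (n := n)
    (fun i j hij => by
      have h1 := hupper i j hij
      rw [hδ, hδ] at h1
      exact_mod_cast h1)
    (fun i => by
      have h1 := hlower i
      rw [hδ] at h1
      exact_mod_cast h1)
  refine ⟨q + i, by omega, fun k hrk => ?_⟩
  obtain ⟨j, rfl⟩ := Nat.exists_eq_add_of_le hrk
  intro Z Zk W Wk
  have hZk : Zk = jetsOver (show l ≤ q + i + j by omega) (⋃₀ C) := hover _ _ _
  have hWk : Wk = Jet.map φ hφ (q + i + j) '' jetsOver (show l ≤ q + i + j by omega) (⋃₀ C) := by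
    rw [← hZk]
  refine ⟨?_, ?_, ?_⟩
  · have h1 := hi (i + j) (by omega)
    have h2 : complexDim (Fin (q + i + j + 1) → EuclideanSpace ℂ (Fin n)) Wk = D (i + j) := by
      rw [hWk]
      -- Only transports along `q + i + j = q + (i + j)`, which changes the type of the jets.
      have h3 : ∀ (a b : ℕ) (hab : a = b) (ha : l ≤ a) (hb : l ≤ b),
          complexDim (Fin (a + 1) → EuclideanSpace ℂ (Fin n))
            (Jet.map φ hφ a '' jetsOver ha (⋃₀ C))
          = complexDim (Fin (b + 1) → EuclideanSpace ℂ (Fin n))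
            (Jet.map φ hφ b '' jetsOver hb (⋃₀ C)) := by
        rintro a _ rfl _ _
        rfl
      exact h3 _ _ (by omega) _ _
    have h4 : complexDim (Fin (q + i + 1) → EuclideanSpace ℂ (Fin n)) W = D i := rfl
    rw [h2, h4, hδ, hδ, h1, Nat.add_sub_cancel_left, Nat.add_sub_cancel_left]
    push_cast
    rfl
  · intro w hw
    rw [hWk] at hw
    exact hsub (show l ≤ q + i by omega) hrk (⋃₀ C) ⟨w, hw, rfl⟩
  -- Density is checked one component at a time: the truncation of `w` is the image of a jet over
  -- some `A`.
  · rintro w ⟨z, ⟨A, hA, hzA⟩, hzw⟩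
    have hbA := heb A hA
    have h1 := jetsOver_image_subset_closure hφ (show l ≤ q + i by omega) hrk
      (show 2 * e A ≤ q + i by omega) (by omega) (he A hA (q + i) (by omega) (by omega)).2
      (show w ∈ _ from ⟨z, hzA, hzw⟩)
    refine closure_mono ?_ h1
    rw [hWk]
    exact Set.image_mono fun z' hz' => ⟨A, hA, hz'⟩
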